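/- **Theorem (Approximation and Leibniz rule).** *Setting.* Let $\mathbb G$ be a stratified group in exponential coordinates: a finite-dimensional real vector space $\mathbb G=H^1\oplus\dots\oplus H^\iota$ with an analytic group operation with identity $0$ whose exponential map is the identity, whose left invariant vector fields satisfy $[\mathcal V_1,\mathcal V_j]=\mathcal V_{j+1}$ for $j\ge 1$ ($\mathcal V_j=\{X: X(0)\in H^j\}$, $\mathcal V_j=0$ for $j>\iota$, $\mathcal V_\iota\ne0$), and with dilations $\delta_r$ equal to $r^i$ on $H^i$, which are group automorphisms. Fix a scalar product with mutually orthogonal layers; the horizontal left invariant fields $X_1,\dots,X_m$ are those with $(X_1(0),\dots,X_m(0))$ an orthonormal basis of $H^1$, and are declared orthonormal at each point. Let $\mu$ be the Haar (= Lebesgue) measure ($dx$ in integrals), $Q=\sum_i i\dim H^i$, $d$ a homogeneous distance (continuous, left invariant, $d(\delta_rx,\delta_ry)=r\,d(x,y)$) with open balls $B(x,r)$, and $\Omega\subset\mathbb G$ open. Put $d^{\mathcal R}(x,y)=d(xy^{-1},0)$ and $\Omega^{\mathcal R}_{\varepsilon}=\{x: \inf_{y\notin\Omega}d^{\mathcal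 R}(x,y)>\varepsilon\}$. Let $\mathcal M(\Omega)$ be the space of finite signed Radon measures on $\Omega$; for $\nu_k,\nu\in\mathcal M(\Omega)$ write $\nu_k\rightharpoonup\nu$ if $\int\phi\,d\nu_k\to\int\phi\,d\nu$ for all $\phi\in C_c(\Omega)$, also when $\nu_k$ is defined only on open sets $\Omega_k\subset\Omega$ that eventually contain every compact subset of $\Omega$. A horizontal field is a measurable $F=\sum_jF_jX_j$ on $\Omega$; $\nabla_Hu=\sum_j(X_ju)X_j$, and $\operatorname{div}\phi=\sum_jX_j\phi_j$ for $\phi=\sum_j\phi_jX_j$ of class $C^1$. $\mathcal{DM}^\infty(H\Omega)$ is the set of essentially bounded horizontal fields $F$ on $\Omega$ for which there is $\operatorname{div}F\in\mathcal M(\Omega)$ with $\int_\Omega\phi\,d\operatorname{div}F=-\int_\Omega\langle F,\nabla_H\phi\rangle\,dx$ for all $\phi\in C_c^\infty(\Omega)$. For $g\in L^\infty(\Omega)$ let $$|D_Hg|(\Omega)=\sup\Big\{\int_\Omega g\operatorname{div}\phi\,dx:\ \phi\in C^1_c(H\Omega),\ |\phi|\le1\Big\}.$$ If it is finite, there are a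 finite Radon measure $|D_Hg|$ on $\Omega$ and a horizontal field $\sigma_g$ with $|\sigma_g|=1$ $|D_Hg|$-a.e. and $\int_\Omega g\operatorname{div}\phi\,dx=-\int_\Omega\langle\phi,\sigma_g\rangle\,d|D_Hg|$ for all $\phi\in C^1_c(H\Omega)$. One writes $D_Hg=\sigma_g|D_Hg|$ and decomposes it into its absolutely continuous and singular parts with respect to $\mu$, $D_Hg=\nabla_Hg\,\mu+D_H^{\rm s}g$, where $D_H^{\rm s}g=\sigma_g|D_H^{\rm s}g|$, $|D_H^{\rm s}g|$ is the singular part of $|D_Hg|$, and $\nabla_Hg\in L^1(H\Omega)$; for $\mu$-a.e. $x\in\Omega$ the vector $\nabla_Hg(x)$ is the approximate differential of $g$ at $x$, that is, $y\mapsto L_x(y)=\langle\nabla_Hg(x),y\rangle$ is a homogeneous homomorphism $\mathbb G\to\mathbb R$ and $\frac1{\mu(B(x,r))}\int_{B(x,r)}\frac{|g(y)-g(x)-L_x(x^{-1}y)|}{r}\,dy\to0$ as $r\to0^+$. *Statement.* Let $F\in\mathcal{DM}^\infty(H\Omega)$ and let $g\in L^\infty(\Omega)$ with $|D_Hg|(\Omega)<\infty$.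 Then $gF\in\mathcal{DM}^\infty(H\Omega)$, and $|D_Hg|$, $\sigma_g$, $\nabla_Hg$ as above exist. Let $\rho\in C_c(B(0,1))$ be nonnegative with $\rho(x)=\rho(x^{-1})$ and $\int_{B(0,1)}\rho\,dx=1$; put $\rho_\varepsilon(x)=\varepsilon^{-Q}\rho(\delta_{1/\varepsilon}x)$ and $g_\varepsilon(x)=(\rho_\varepsilon*g)(x)=\int_\Omega\rho_\varepsilon(xy^{-1})g(y)\,dy$. For every $\varepsilon>0$ the derivatives $X_jg_\varepsilon$ exist and are continuous in $\Omega^{\mathcal R}_{2\varepsilon}$, and $\nabla_Hg_\varepsilon$ is integrable there. For any sequence $\tilde\varepsilon_k>0$ with $\tilde\varepsilon_k\to0$ there are a subsequence $\varepsilon_k$, a function $\tilde g\in L^\infty(\Omega;|\operatorname{div}F|)$ and measures $(F,D_Hg),(F,D_H^{\rm s}g)\in\mathcal M(\Omega)$ such that $$g_{\varepsilon_k}\overset{*}{\rightharpoonup}\tilde g\ \text{ in }L^\infty(\Omega;|\operatorname{div}F|),\qquad \langle F,\nabla_Hg_{\varepsilon_k}\rangle\mu\rightharpoonup(F,D_Hg),\qquad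 \langle F,\rho_{\varepsilon_k}*D_H^{\rm s}g\rangle\mu\rightharpoonup(F,D_H^{\rm s}g)\ \text{ in }\mathcal M(\Omega),$$ where $\langle F,\nabla_Hg_{\varepsilon}\rangle\mu$ is a measure on $\Omega^{\mathcal R}_{2\varepsilon}$ and $\rho_\varepsilon*D_H^{\rm s}g(x)=\int_\Omega\rho_\varepsilon(xy^{-1})\sigma_g(y)\,d|D_H^{\rm s}g|(y)$ (integrated in components with respect to $X_1,\dots,X_m$). Moreover $$\operatorname{div}(gF)=\tilde g\operatorname{div}F+(F,D_Hg),\qquad |(F,D_Hg)|\le\|F\|_{\infty,\Omega}|D_Hg|,\qquad |(F,D_H^{\rm s}g)|\le\|F\|_{\infty,\Omega}|D_H^{\rm s}g|,$$ and the absolutely continuous and the singular part of $(F,D_Hg)$ with respect to $\mu$ are $\langle F,\nabla_Hg\rangle\mu$ and $(F,D_H^{\rm s}g)$, respectively. -/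

import Mathlib

open Set Filter Topology MeasureTheory
open scoped ENNReal ContDiff

noncomputable section

/-! ### Stratified groups -/

/-- The left invariant vector field `X_v` of a group operation on a normed space whose identity is
`0`, with `X_v(0) = v`: its value at `p` is the differential at `0` of the left translation by `p`,
applied to `v`. -/
def leftInvField {G : Type*} [NormedAddCommGroup G] [NormedSpace ℝ G] [Mul G] (v p : G) : G :=
  fderiv ℝ (fun q : G => p * q) 0 v

/-- The linear map acting on the `i`-th (mutually orthogonal) layer as multiplication by `r ^ i`,
for `i ≤ s`. -/
def layerDilation {G : Type*} [NormedAddCommGroup G] [InnerProductSpace ℝ G]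
    [FiniteDimensional ℝ G] (L : ℕ → Submodule ℝ G) (s : ℕ) (r : ℝ) (x : G) : G :=
  ∑ i ∈ Finset.range (s + 1), r ^ i • (L i).starProjection x

/-- A stratified (Carnot) group in exponential coordinates. The group is a finite dimensional real
vector space with an analytic group operation, whose identity is `0` and whose exponential map is
the identity map (the one-parameter subgroups are the lines `t ↦ t • v`). The space is the direct
sum of the layers `H¹, …, H^s`, whose left invariant vector fields satisfy `[V₁, V_j] = V_{j+1}`
for `j ≥ 1`. The scalar product is one for which some graded basis is orthonormal, that is, the
layers are mutually orthogonal. The dilations associated with the layers are compatible with the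
group operation. -/
class StratifiedGroup (G : Type*) [NormedAddCommGroup G] [InnerProductSpace ℝ G]
    [FiniteDimensional ℝ G] extends Group G where
  one_eq_zero : (1 : G) = 0
  analytic_mul : AnalyticOnNhd ℝ (fun p : G × G => p.1 * p.2) univ
  smul_mul_smul : ∀ (v : G) (s t : ℝ), (s • v) * (t • v) = (s + t) • v
  step : ℕ
  layer : ℕ → Submodule ℝ G
  one_le_step : 1 ≤ step
  layer_zero : layer 0 = ⊥
  layer_step_ne_bot : layer step ≠ ⊥
  layer_eq_bot : ∀ j, step < j → layer j = ⊥
  orthogonal_layer : ∀ i j, i ≠ j → layer i ⟂ layer j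
  iSup_layer : ⨆ j, layer j = ⊤
  bracket_layer : ∀ j, 1 ≤ j → Submodule.span ℝ
    {z : G | ∃ v ∈ layer 1, ∃ w ∈ layer j,
      VectorField.lieBracket ℝ (leftInvField v) (leftInvField w) 0 = z} = layer (j + 1)
  dilation_mul : ∀ r : ℝ, 0 < r → ∀ x y : G,
    layerDilation layer step r (x * y) = layerDilation layer step r x * layerDilation layer step r y

section Stratified

variable {G : Type*} [NormedAddCommGroup G] [InnerProductSpace ℝ G] [FiniteDimensional ℝ G]
  [StratifiedGroup G]

/-- The intrinsic dilation `δ_r`. -/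
def dil (r : ℝ) (x : G) : G :=
  layerDilation (StratifiedGroup.layer (G := G)) (StratifiedGroup.step G) r x

variable (G) in
/-- The homogeneous dimension `Q = ∑ i · dim Hⁱ`. -/
def homDim : ℕ :=
  ∑ i ∈ Finset.range (StratifiedGroup.step G + 1),
    i * Module.finrank ℝ (StratifiedGroup.layer (G := G) i)

variable (G) in
/-- The first layer `H¹`. A horizontal vector field is represented by a function with values in
`H¹`, through the left invariant frame: `F : G → H¹` stands for `x ↦ X_{F(x)}(x)`. The left
invariant metric on the horizontal fibres becomes the scalar product of `H¹`. -/
abbrev Horiz : Type _ := ↥(StratifiedGroup.layer (G := G) 1)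

variable (G) in
/-- A fixed orthonormal basis `(e_1, …, e_m)` of the first layer. -/
def frame : OrthonormalBasis (Fin (Module.finrank ℝ (Horiz G))) ℝ (Horiz G) :=
  stdOrthonormalBasis ℝ (Horiz G)

/-- The curve `t ↦ x · (t e_i)`, the integral curve of the horizontal left invariant field `X_i`
through `x`. -/
def frameCurve (i : Fin (Module.finrank ℝ (Horiz G))) (x : G) (t : ℝ) : G :=
  x * (t • (frame G i : G))

/-- The derivative `X_i u (x)`. -/
def frameDeriv (i : Fin (Module.finrank ℝ (Horiz G))) (u : G → ℝ) (x : G) : ℝ :=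
  deriv (fun t : ℝ => u (frameCurve i x t)) 0

/-- The horizontal gradient `∇_H u = ∑ (X_i u) X_i`. -/
def horizGrad (u : G → ℝ) (x : G) : Horiz G :=
  ∑ i, frameDeriv i u x • frame G i

/-- The pointwise divergence `∑ X_i φ_i` of a horizontal field `φ = ∑ φ_i X_i`. -/
def horizDiv (φ : G → Horiz G) (x : G) : ℝ :=
  ∑ i, frameDeriv i (fun y => inner ℝ (φ y) (frame G i)) x

/-- `u ∈ C¹_H(U)`: the derivatives `X_i u` exist and are continuous in `U`. -/
def IsC1H (U : Set G) (u : G → ℝ) : Prop :=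
  (∀ x ∈ U, ∀ i, DifferentiableAt ℝ (fun t : ℝ => u (frameCurve i x t)) 0) ∧
    ContinuousOn (horizGrad u) U

/-! ### Homogeneous distances -/

variable (G) in
/-- A homogeneous distance: a continuous, left invariant distance with
`d(δ_r p, δ_r q) = r d(p, q)`. -/
structure HomogeneousDist where
  dist : G → G → ℝ
  dist_eq_zero : ∀ x y, dist x y = 0 ↔ x = y
  dist_comm : ∀ x y, dist x y = dist y x
  dist_triangle : ∀ x y z, dist x z ≤ dist x y + dist y z
  continuous_dist : Continuous fun p : G × G => dist p.1 p.2
  left_invariant : ∀ z x y, dist (z * x) (z * y) = dist x y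
  homogeneous : ∀ r : ℝ, 0 < r → ∀ x y, dist (dil r x) (dil r y) = r * dist x y

/-- The open ball `B(p, r)`. -/
def HomogeneousDist.ball (d : HomogeneousDist G) (p : G) (r : ℝ) : Set G :=
  {q | d.dist q p < r}

/-- The right invariant distance `d^R(x, y) = d(x y⁻¹, 0)`. -/
def HomogeneousDist.rdist (d : HomogeneousDist G) (x y : G) : ℝ :=
  d.dist (x * y⁻¹) 0

/-- The right inner part `Ω^R_ε = {x : dist^R(x, Ωᶜ) > ε}`; the distance to the empty set
is `+∞`. -/
def rightInner (d : HomogeneousDist G) (Ω : Set G) (ε : ℝ) : Set G :=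
  {x | ENNReal.ofReal ε < ⨅ y ∈ Ωᶜ, ENNReal.ofReal (d.rdist x y)}

variable [MeasurableSpace G] [BorelSpace G]

/-! ### Approximate differentiability -/

/-- A homogeneous homomorphism `L : G → ℝ`. -/
def IsHHom (L : G → ℝ) : Prop :=
  Continuous L ∧ (∀ x y : G, L (x * y) = L x + L y) ∧
    ∀ r : ℝ, 0 < r → ∀ x : G, L (dil r x) = r * L x

/-- `u` is approximately differentiable at `x₀`, and the vector of `H¹` that defines its
approximate differential through the scalar product is `w`. -/
def HasApproxHorizGradAt (d : HomogeneousDist G) (u : G → ℝ) (w : Horiz G) (x₀ : G) : Prop :=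
  ∃ L : G → ℝ, IsHHom L ∧ (∀ y : G, L y = inner ℝ (w : G) y) ∧
    Tendsto (fun r : ℝ => ⨍ x in d.ball x₀ r, |u x - u x₀ - L (x₀⁻¹ * x)| / r)
      (𝓝[>] 0) (𝓝 0)

/-! ### Test functions, divergence-measure fields and horizontal variation

The Haar measure is `volume`, the Lebesgue measure of the orthonormal graded coordinates. -/

/-- `φ ∈ C_c(Ω)`. -/
def IsCc (Ω : Set G) (φ : G → ℝ) : Prop :=
  Continuous φ ∧ HasCompactSupport φ ∧ tsupport φ ⊆ Ω

/-- `φ ∈ C_c^∞(Ω)`. -/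
def IsCcInf (Ω : Set G) (φ : G → ℝ) : Prop :=
  ContDiff ℝ ∞ φ ∧ HasCompactSupport φ ∧ tsupport φ ⊆ Ω

/-- `φ ∈ C¹_c(HΩ)`. -/
def IsC1cHoriz (Ω : Set G) (φ : G → Horiz G) : Prop :=
  ContDiff ℝ 1 φ ∧ HasCompactSupport φ ∧ tsupport φ ⊆ Ω

/-- `ν ∈ M(Ω)`: a finite signed Radon measure on the open set `Ω`, seen as a signed measure on `G`
that is concentrated on `Ω`. -/
def IsMeasureOn (Ω : Set G) (ν : SignedMeasure G) : Prop :=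
  ν.variation Ωᶜ = 0

/-- The distributional divergence of `F` in `Ω` is the measure `ν ∈ M(Ω)`. -/
def IsDivergence (Ω : Set G) (F : G → Horiz G) (ν : SignedMeasure G) : Prop :=
  IsMeasureOn Ω ν ∧ ∀ φ : G → ℝ, IsCcInf Ω φ →
    ∫ᵛ x, φ x ∂<•ν = - ∫ x in Ω, inner ℝ (F x) (horizGrad φ x)

/-- `F ∈ DM^∞(HΩ)`. -/
def IsDMInf (Ω : Set G) (F : G → Horiz G) : Prop :=
  MemLp F ∞ (volume.restrict Ω) ∧ ∃ ν : SignedMeasure G, IsDivergence Ω F ν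

/-- The horizontal variation `|D_H g|(Ω)`. -/
def horizVariation (Ω : Set G) (g : G → ℝ) : ℝ≥0∞ :=
  ⨆ (φ : G → Horiz G) (_ : IsC1cHoriz Ω φ) (_ : ∀ x, ‖φ x‖ ≤ 1),
    ENNReal.ofReal (∫ x in Ω, g x * horizDiv φ x)

/-- `D_H g = σ Λ` is the polar decomposition of the distributional horizontal gradient of `g` in
`Ω`, where `Λ = |D_H g|` is a finite Radon measure on `Ω` and `|σ| = 1` holds `Λ`-almost
everywhere. -/
structure IsPolarGrad (Ω : Set G) (g : G → ℝ) (σ : G → Horiz G) (Λ : Measure G) : Prop where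
  finite : IsFiniteMeasure Λ
  compl_eq_zero : Λ Ωᶜ = 0
  measurable : Measurable σ
  norm_eq_one : ∀ᵐ x ∂Λ, ‖σ x‖ = 1
  by_parts : ∀ φ : G → Horiz G, IsC1cHoriz Ω φ →
    ∫ x in Ω, g x * horizDiv φ x = - ∫ x, inner ℝ (φ x) (σ x) ∂Λ

/-! ### Mollification -/

/-- A nonnegative symmetric mollifier `ρ ∈ C_c(B(0, 1))` of integral one. -/
structure IsMollifier (d : HomogeneousDist G) (ρ : G → ℝ) : Prop where
  isCc : IsCc (d.ball 0 1) ρ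
  nonneg : ∀ x, 0 ≤ ρ x
  symm : ∀ x, ρ x = ρ x⁻¹
  integral_eq_one : ∫ x in d.ball 0 1, ρ x = 1

/-- `ρ_ε(x) = ε^{-Q} ρ(δ_{1/ε} x)`. -/
def rescale (ρ : G → ℝ) (ε : ℝ) (x : G) : ℝ :=
  (ε ^ homDim G)⁻¹ * ρ (dil ε⁻¹ x)

/-- `(ρ_ε * g)(x) = ∫_Ω ρ_ε(x y⁻¹) g(y) dy`. -/
def mollify (Ω : Set G) (ρ : G → ℝ) (ε : ℝ) (g : G → ℝ) (x : G) : ℝ :=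
  ∫ y in Ω, rescale ρ ε (x * y⁻¹) * g y

/-- The mollification `ρ_ε * (σ Λ)` of the vector measure `σ Λ`. -/
def mollifyMeasure (ρ : G → ℝ) (ε : ℝ) (σ : G → Horiz G) (Λ : Measure G) (x : G) : Horiz G :=
  ∫ y, rescale ρ ε (x * y⁻¹) • σ y ∂Λ

/-! ### Weak* convergence -/

/-- Local weak* convergence in `Ω` of the measures `u_k · volume`, the `k`-th one being defined on
`U_k ⊆ Ω`, to the measure `P`. -/
def LocWeakStarTendsto (Ω : Set G) (U : ℕ → Set G) (u : ℕ → G → ℝ) (P : SignedMeasure G) : Prop :=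
  ∀ φ : G → ℝ, IsCc Ω φ →
    Tendsto (fun k => ∫ x in U k, φ x * u k x) atTop (𝓝 (∫ᵛ x, φ x ∂<•P))

/-- Weak* convergence `u_k → v` in `L^∞(β)`, the dual space of `L¹(β)`. -/
def WeakStarLInfTendsto (β : Measure G) (u : ℕ → G → ℝ) (v : G → ℝ) : Prop :=
  (∀ k, MemLp (u k) ∞ β) ∧ MemLp v ∞ β ∧ ∀ ψ : G → ℝ, Integrable ψ β →
    Tendsto (fun k => ∫ x, ψ x * u k x ∂β) atTop (𝓝 (∫ x, ψ x * v x ∂β))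

/-- The signed measure `h ν`. -/
def smulMeasure (h : G → ℝ) (ν : SignedMeasure G) : SignedMeasure G :=
  ν.withDensity h (ContinuousLinearMap.lsmul ℝ ℝ)

end Stratified

end

noncomputable section

/-! ### Signed measures with a density -/

section SignedDensity

variable {X : Type*} [MeasurableSpace X]

/-! The Leibniz rule is exact for mollified functions. With `D_H g = σ Λ`, the mollification `g_ε`
has continuous horizontal derivatives on the inner set, and there `∇_H g_ε = ρ_ε * D_H g`. Hence `φ
g_ε` can be tested against `div F`, which gives `∫ φ g_ε d(div F) = -∫ g_ε ⟨F, ∇_H φ⟩ - ∫ φ ⟨F, ρ_ε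
* D_H g⟩` (`IsPolarGrad.integral_mul_mollify`). The theorem follows by passing to the limit in the
three terms.

The term with `∇_H φ` converges by dominated convergence, since `g_ε → g` at Lebesgue points. The
left side converges along a subsequence by weak star compactness in `L^∞(|div F|)`
(`exists_weakStar_subseq`). In the last term the symmetry of `ρ` moves the mollification from the
measure to the field: up to an error that tends to zero, it is `∫ φ ⟨ρ_ε * F, σ⟩ dΛ`
(`IsMollifier.tendsto_pairing`). The functions `⟨ρ_ε * F, σ⟩` are bounded by `‖F‖_∞`, so they have a
weak star limit `q` in `L^∞(Λ)`, and `(F, D_H g) = q Λ`. The bound on the variation is then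
immediate. Testing with functions cut off to the set that carries the singular part shows that `(F,
D_H^s g)` is `q` times the singular part of `Λ`. On the absolutely continuous part `ρ_ε * F → F`
almost everywhere, which forces `q = ⟨F, σ⟩` there (`IsMollifier.ae_eq_inner_of_weakStar`).
Uniqueness of the Lebesgue decomposition identifies the two parts.

As `ρ` is only continuous, the formula for `∇_H g_ε` is not obtained by differentiating the kernel.
Averages of the kernel along horizontal segments are test functions whose derivative is a difference
of kernels; testing `D_H g` with them expresses increments of `g_ε` as integrals of `ρ_ε * D_H g`
(`IsPolarGrad.lconv_sub`).

The polar decomposition comes from the extension theorem of M. Riesz and the Riesz representation of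
positive functionals (`exists_polar_representation`). Approximate differentiability rests on two
facts. Every element is a product of boundedly many horizontal vectors of comparable size
(`exists_mem_horizBall_pow`), so increments of `g` minus a linear map are controlled by the
variation of `D_H g` minus a constant field. At Lebesgue points this variation is small, and
comparing the mean of the remainder on a ball with its mean on the ball of half the radius yields a
geometric series (`exists_average_remainder_le`, `le_ofReal_of_halving`). -/

/-- The integral against a signed measure given by a density. -/
theorem integral_withDensityᵥ_eq {μ : Measure X} {f φ : X → ℝ} (hf : Integrable f μ)
    (hφ : AEStronglyMeasurable φ μ) (hφf : Integrable (fun x => φ x * f x) μ) :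
    VectorMeasure.integral (μ.withDensityᵥ f) φ (ContinuousLinearMap.lsmul ℝ ℝ).flip
      = ∫ x, φ x * f x ∂μ := by
  -- Applied to `f` and to `-f`, this treats the positive and the negative part of the density at
  -- once.
  have key : ∀ h : X → ℝ, Integrable h μ → (∀ x, |h x| ≤ |f x|) →
      Integrable φ (μ.withDensity fun x => ENNReal.ofReal (h x)) ∧
      ∫ x, φ x ∂(μ.withDensity fun x => ENNReal.ofReal (h x)) = ∫ x, φ x * max (h x) 0 ∂μ := by
    intro h hh hle
    have hm : AEMeasurable (fun x => ENNReal.ofReal (h x)) μ := hh.aemeasurable.ennreal_ofReal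
    have hlt : ∀ᵐ x ∂μ, ENNReal.ofReal (h x) < ⊤ := by simp
    constructor
    · rw [integrable_withDensity_iff_integrable_smul₀' hm hlt]
      refine hφf.mono (hm.ennreal_toReal.aestronglyMeasurable.smul hφ) ?_
      filter_upwards with x
      simp only [smul_eq_mul, norm_mul, Real.norm_eq_abs]
      rw [mul_comm]
      refine mul_le_mul_of_nonneg_left ?_ (abs_nonneg _)
      rw [ENNReal.toReal_ofReal', abs_of_nonneg (le_max_right _ _)]
      exact (max_le (le_abs_self _) (abs_nonneg _)).trans (hle x)
    · rw [integral_withDensity_eq_integral_toReal_smul₀ hm hlt]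
      congr 1 with x
      rw [ENNReal.toReal_ofReal', smul_eq_mul, mul_comm]
  obtain ⟨i1, e1⟩ := key f hf (fun x => le_rfl)
  obtain ⟨i2, e2⟩ := key (fun x => -f x) hf.neg (fun x => by simp)
  have := isFiniteMeasure_withDensity_ofReal hf.2
  have := isFiniteMeasure_withDensity_ofReal hf.neg.2
  rw [withDensityᵥ_eq_withDensity_pos_part_sub_withDensity_neg_part hf,
    VectorMeasure.integral_sub_vectorMeasure (by simpa [VectorMeasure.Integrable] using i1)
      (by simpa [VectorMeasure.Integrable] using i2)]
  rw [VectorMeasure.integral_toSignedMeasure, VectorMeasure.integral_toSignedMeasure, e1, e2,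
    ← integral_sub]
  · congr 1 with x
    rw [← mul_sub]
    congr 1
    rcases le_total 0 (f x) with h | h
    · rw [max_eq_left h, max_eq_right (by linarith)]; ring
    · rw [max_eq_right h, max_eq_left (by linarith)]; ring
  · refine hφf.mono (hφ.mul (hf.aestronglyMeasurable.sup aestronglyMeasurable_const)) ?_
    filter_upwards with x
    simp only [norm_mul, Real.norm_eq_abs]
    refine mul_le_mul_of_nonneg_left ?_ (abs_nonneg _)
    rw [abs_of_nonneg (le_max_right _ _)]
    exact max_le (le_abs_self _) (abs_nonneg _)
  · refine hφf.mono (hφ.mul (hf.neg.aestronglyMeasurable.sup aestronglyMeasurable_const)) ?_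
    filter_upwards with x
    simp only [norm_mul, Real.norm_eq_abs]
    refine mul_le_mul_of_nonneg_left ?_ (abs_nonneg _)
    rw [abs_of_nonneg (le_max_right _ _)]
    exact max_le (neg_le_abs _) (abs_nonneg _)

instance isFiniteMeasure_variation_signedMeasure (ν : SignedMeasure X) :
    IsFiniteMeasure ν.variation := by
  rw [← ν.totalVariation_eq_variation]
  infer_instance

/-- A signed measure has a density with respect to its total variation. -/
theorem exists_density_variation (ν : SignedMeasure X) :
    ∃ θ : X → ℝ, Measurable θ ∧ Integrable θ ν.variation ∧ ν = ν.variation.withDensityᵥ θ := by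
  refine ⟨ν.rnDeriv ν.variation, SignedMeasure.measurable_rnDeriv _ _,
    SignedMeasure.integrable_rnDeriv _ _, (SignedMeasure.withDensityᵥ_rnDeriv_eq _ _ ?_).symm⟩
  refine VectorMeasure.AbsolutelyContinuous.mk fun s hs h => ?_
  rw [Measure.toENNRealVectorMeasure_apply_measurable hs] at h
  have := ν.enorm_measure_le_variation s
  rw [h] at this
  simpa using this

theorem restrict_withDensityᵥ {μ : Measure X} {f : X → ℝ} (hf : Integrable f μ) {s : Set X}
    (hs : MeasurableSet s) :
    (μ.withDensityᵥ f).restrict s = (μ.restrict s).withDensityᵥ f := by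
  ext t ht
  rw [VectorMeasure.restrict_apply _ hs ht, withDensityᵥ_apply hf (ht.inter hs),
    withDensityᵥ_apply hf.integrableOn ht, Measure.restrict_restrict ht]

/-- Multiplication of reals is commutative. This reconciles `VectorMeasure.withDensity` in
`smulMeasure`, which uses the pairing itself, with the integral formula above, which uses the
flipped one. -/
theorem lsmul_flip_real :
    (ContinuousLinearMap.lsmul ℝ ℝ : ℝ →L[ℝ] ℝ →L[ℝ] ℝ).flip = ContinuousLinearMap.lsmul ℝ ℝ := by
  ext
  simp

theorem withDensity_withDensityᵥ {μ : Measure X} {f h : X → ℝ} (hf : Integrable f μ)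
    (hh : AEStronglyMeasurable h μ) (hhf : Integrable (fun x => h x * f x) μ) :
    (μ.withDensityᵥ f).withDensity h (ContinuousLinearMap.lsmul ℝ ℝ)
      = μ.withDensityᵥ fun x => h x * f x := by
  have hi : (μ.withDensityᵥ f).Integrable h := by
    rw [VectorMeasure.Integrable, Measure.variation_withDensityᵥ hf,
      integrable_withDensity_iff_integrable_smul₀' hf.aestronglyMeasurable.enorm (by simp)]
    refine hhf.mono (hf.aestronglyMeasurable.enorm.ennreal_toReal.aestronglyMeasurable.smul hh) ?_
    filter_upwards with x
    simp [mul_comm]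
  ext s hs
  rw [VectorMeasure.withDensity_apply hi, withDensityᵥ_apply hhf hs, restrict_withDensityᵥ hf hs,
    ← lsmul_flip_real, integral_withDensityᵥ_eq hf.integrableOn hh.restrict hhf.integrableOn]

end SignedDensity

/-! ### Weak star compactness in `L^∞` -/

/-- Bounded sequences in `L^∞` of a finite measure on a countably generated space are
sequentially weak star relatively compact. -/
theorem exists_weakStar_subseq {X : Type*} [MeasurableSpace X]
    [MeasurableSpace.CountablyGenerated X] (β : Measure X) [IsFiniteMeasure β]
    (u : ℕ → X → ℝ) (M : ℝ) (hu : ∀ k, AEStronglyMeasurable (u k) β)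
    (hM : ∀ k, ∀ᵐ x ∂β, |u k x| ≤ M) :
    ∃ s : ℕ → ℕ, StrictMono s ∧ ∃ v : X → ℝ, Measurable v ∧ (∀ᵐ x ∂β, |v x| ≤ M) ∧
      ∀ ψ : X → ℝ, Integrable ψ β →
        Tendsto (fun k => ∫ x, ψ x * u (s k) x ∂β) atTop (𝓝 (∫ x, ψ x * v x ∂β)) := by
  have : Fact ((2 : ℝ≥0∞) ≠ ⊤) := ⟨by simp⟩
  -- Compactness is taken from `L²`: since `β` is finite, the sequence is bounded there, and `L²` is
  -- separable because the σ-algebra is countably generated, so Banach–Alaoglu yields a subsequence.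
  have hmem : ∀ k, MemLp (u k) 2 β := fun k => MemLp.of_bound (hu k) M (hM k)
  let U : ℕ → Lp ℝ 2 β := fun k => (hmem k).toLp (u k)
  let R : ℝ := (β univ).toReal ^ (2 : ℝ≥0∞).toReal⁻¹ * M
  have hU : ∀ k, ‖U k‖ ≤ R ∨ M < 0 := by
    intro k
    rcases lt_or_ge M 0 with h | h
    · exact Or.inr h
    left
    refine Lp.norm_le_of_ae_bound (C := M) h ?_ |>.trans_eq ?_
    · filter_upwards [hM k, (hmem k).coeFn_toLp] with x h1 h2
      rw [h2]; exact h1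
    · simp only [R]; rfl
  -- No sign of `M` is assumed; a negative bound forces `β = 0`.
  rcases lt_or_ge M 0 with hMneg | hM0
  · have : β = 0 := by
      rw [← ae_eq_bot, ← eventually_false_iff_eq_bot]
      filter_upwards [hM 0] with x hx
      linarith [abs_nonneg (u 0 x)]
    subst this
    exact ⟨id, strictMono_id, 0, measurable_const, by simp, by simp⟩
  have hU' : ∀ k, ‖U k‖ ≤ R := fun k => (hU k).resolve_right (not_lt.2 hM0)
  let ℓ : ℕ → WeakDual ℝ (Lp ℝ 2 β) := fun k =>
    StrongDual.toWeakDual (InnerProductSpace.toDual ℝ (Lp ℝ 2 β) (U k))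
  obtain ⟨ℓ0, -, s, hs, hlim⟩ := WeakDual.isSeqCompact_closedBall ℝ (Lp ℝ 2 β) 0 R
    (x := ℓ) (fun k => by
      simp only [mem_preimage, Metric.mem_closedBall, dist_zero_right, ℓ]
      calc _ = ‖U k‖ := (InnerProductSpace.toDual ℝ (Lp ℝ 2 β)).norm_map (U k)
        _ ≤ R := hU' k)
  let V : Lp ℝ 2 β := (InnerProductSpace.toDual ℝ (Lp ℝ 2 β)).symm (WeakDual.toStrongDual ℓ0)
  have hconv : ∀ ψ : X → ℝ, MemLp ψ 2 β →
      Tendsto (fun k => ∫ x, ψ x * u (s k) x ∂β) atTop (𝓝 (∫ x, ψ x * V x ∂β)) := by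
    intro ψ hψ
    have h1 := (WeakDual.eval_continuous (𝕜 := ℝ) (hψ.toLp ψ)).continuousAt.tendsto.comp hlim
    have e1 : ∀ k, ℓ k (hψ.toLp ψ) = ∫ x, ψ x * u k x ∂β := by
      intro k
      calc _ = inner ℝ (U k) (hψ.toLp ψ) := rfl
        _ = _ := by
          rw [L2.inner_def]
          refine integral_congr_ae ?_
          filter_upwards [hψ.coeFn_toLp, (hmem k).coeFn_toLp] with x h1 h2
          rw [h1, h2]; rfl
    have e2 : ℓ0 (hψ.toLp ψ) = ∫ x, ψ x * V x ∂β := by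
      calc _ = inner ℝ V (hψ.toLp ψ) := by
            rw [← InnerProductSpace.toDual_apply_apply]
            simp [V]
        _ = _ := by
          rw [L2.inner_def]
          refine integral_congr_ae ?_
          filter_upwards [hψ.coeFn_toLp] with x h1
          rw [h1]; rfl
    rw [← e2]
    refine h1.congr fun k => ?_
    exact e1 (s k)
  have hVint : Integrable V β := (Lp.memLp V).integrable (by norm_num)
  have hset : ∀ A : Set X, MeasurableSet A →
      Tendsto (fun k => ∫ x in A, u (s k) x ∂β) atTop (𝓝 (∫ x in A, V x ∂β)) := by
    intro A hA
    have := hconv (A.indicator 1) ((memLp_const (1 : ℝ)).indicator hA)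
    have e : ∀ f : X → ℝ, ∫ x, A.indicator (1 : X → ℝ) x * f x ∂β = ∫ x in A, f x ∂β := by
      intro f
      rw [← integral_indicator hA]
      congr 1 with x
      by_cases hx : x ∈ A <;> simp [hx]
    simpa only [e] using this
  have hui : ∀ k, Integrable (u k) β := fun k => (hmem k).integrable (by norm_num)
  -- The pointwise bound survives because it is equivalent to bounds on integrals over all
  -- measurable sets, and these converge.
  have hVle : ∀ᵐ x ∂β, V x ≤ M := by
    refine ae_le_of_forall_setIntegral_le hVint (integrable_const M) fun A hA _ => ?_
    refine le_of_tendsto (hset A hA) (Eventually.of_forall fun k => ?_)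
    refine setIntegral_mono_ae (hui _).integrableOn (integrable_const M).integrableOn ?_
    filter_upwards [hM (s k)] with x hx using (abs_le.1 hx).2
  have hVge : ∀ᵐ x ∂β, -M ≤ V x := by
    refine ae_le_of_forall_setIntegral_le (integrable_const (-M)) hVint fun A hA _ => ?_
    refine ge_of_tendsto (hset A hA) (Eventually.of_forall fun k => ?_)
    refine setIntegral_mono_ae (integrable_const (-M)).integrableOn (hui _).integrableOn ?_
    filter_upwards [hM (s k)] with x hx using (abs_le.1 hx).1
  have hVM : ∀ᵐ x ∂β, |V x| ≤ M := by
    filter_upwards [hVle, hVge] with x h1 h2 using abs_le.2 ⟨h2, h1⟩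
  refine ⟨s, hs, V, (Lp.stronglyMeasurable V).measurable, hVM, fun ψ hψ => ?_⟩
  rw [Metric.tendsto_atTop]
  intro ε hε
  -- From `L²` to `L¹` test functions: simple functions lie in `L²` and are dense in `L¹`, and the
  -- error is at most `M` times the `L¹` distance. The `+ 1` covers `M = 0`.
  obtain ⟨φ, hφ1, hφ2⟩ := (memLp_one_iff_integrable.2 hψ).exists_simpleFunc_eLpNorm_sub_lt
    (by simp) (ε := ENNReal.ofReal (ε / (3 * (M + 1)))) (by
      simp only [ne_eq, ENNReal.ofReal_eq_zero, not_le]; positivity)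
  have hφ2' : Integrable φ β := memLp_one_iff_integrable.1 hφ2
  have hd : ∫ x, |ψ x - φ x| ∂β < ε / (3 * (M + 1)) := by
    rw [eLpNorm_one_eq_lintegral_enorm] at hφ1
    have : ∫ x, ‖(ψ - φ) x‖ ∂β = (∫⁻ x, ‖(ψ - φ) x‖ₑ ∂β).toReal :=
      integral_norm_eq_lintegral_enorm (hψ.sub hφ2').aestronglyMeasurable
    calc _ = ∫ x, ‖(ψ - φ) x‖ ∂β := rfl
      _ < _ := by
        rw [this]
        exact (ENNReal.lt_ofReal_iff_toReal_lt (ne_top_of_lt hφ1)).1 hφ1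
  have hbd : ∀ w : X → ℝ, AEStronglyMeasurable w β → (∀ᵐ x ∂β, |w x| ≤ M) →
      |∫ x, ψ x * w x ∂β - ∫ x, φ x * w x ∂β| < ε / 3 := by
    intro w hwm hw
    rw [← integral_sub (hψ.mul_bdd hwm hw)
      (hφ2'.mul_bdd hwm hw)]
    calc |∫ x, (ψ x * w x - φ x * w x) ∂β| ≤ ∫ x, |ψ x * w x - φ x * w x| ∂β :=
          abs_integral_le_integral_abs
      _ ≤ ∫ x, |ψ x - φ x| * M ∂β := by
          refine integral_mono_ae ?_ ((hψ.sub hφ2').abs.mul_const M) ?_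
          · exact ((hψ.mul_bdd hwm hw).sub (hφ2'.mul_bdd hwm hw)).abs
          · filter_upwards [hw] with x hx
            rw [← sub_mul, abs_mul]
            exact mul_le_mul_of_nonneg_left hx (abs_nonneg _)
      _ = (∫ x, |ψ x - φ x| ∂β) * M := integral_mul_const _ _
      _ ≤ (ε / (3 * (M + 1))) * M := mul_le_mul_of_nonneg_right hd.le hM0
      _ < ε / 3 := by
          rw [div_mul_eq_mul_div, div_lt_div_iff₀ (by positivity) (by positivity)]
          nlinarith
  have hφmem : MemLp φ 2 β := SimpleFunc.memLp_of_isFiniteMeasure φ 2 β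
  obtain ⟨N, hN⟩ := (Metric.tendsto_atTop.1 (hconv φ hφmem)) (ε / 3) (by positivity)
  refine ⟨N, fun k hk => ?_⟩
  have a1 := hbd _ (hu (s k)) (hM (s k))
  have a2 := hbd _ (Lp.stronglyMeasurable V).aestronglyMeasurable hVM
  have a3 := hN k hk
  rw [Real.dist_eq] at a3 ⊢
  rw [abs_lt] at *
  constructor <;> linarith [a1.1, a1.2, a2.1, a2.2, a3.1, a3.2]

/-! ### Differentiation of measures with respect to a doubling distance function -/

/-- Lebesgue's differentiation theorem for the closed balls of a distance function that induces
the topology and for which the measure is doubling. -/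
theorem ae_tendsto_average_of_doubling {X E : Type*} [TopologicalSpace X]
    [SecondCountableTopology X] [MeasurableSpace X] [BorelSpace X] [NormedAddCommGroup E]
    {μ : Measure X} [IsLocallyFiniteMeasure μ] (δ : X → X → ℝ) (δ_self : ∀ x, δ x x = 0)
    (δ_comm : ∀ x y, δ x y = δ y x) (δ_triangle : ∀ x y z, δ x z ≤ δ x y + δ y z)
    (isOpen_iff : ∀ s : Set X, IsOpen s ↔ ∀ x ∈ s, ∃ ε > 0, ∀ y, δ x y < ε → y ∈ s)
    (C : NNReal) (doubling : ∀ x r, 0 < r → μ {y | δ y x ≤ 2 * r} ≤ C * μ {y | δ y x ≤ r})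
    {f : X → E} (hf : LocallyIntegrable f μ) {Θ : Measure X} [IsLocallyFiniteMeasure Θ]
    (hΘ : Θ ⟂ₘ μ) :
    ∀ᵐ x ∂μ, Tendsto (fun r => ⨍ y in {y | δ y x ≤ r}, ‖f y - f x‖ ∂μ) (𝓝[>] 0) (𝓝 0) ∧
      Tendsto (fun r => Θ {y | δ y x ≤ r} / μ {y | δ y x ≤ r}) (𝓝[>] 0) (𝓝 0) := by
  -- A metric structure is installed locally on the given topology, so that the Borel structure is
  -- unchanged and the differentiation theory of doubling measures applies to the balls of `δ`.
  let _ : PseudoMetricSpace X :=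
    PseudoMetricSpace.ofDistTopology δ δ_self δ_comm δ_triangle isOpen_iff
  have hball : ∀ x r, Metric.closedBall x r = {y | δ y x ≤ r} := fun x r => rfl
  have : IsUnifLocDoublingMeasure μ := by
    refine ⟨⟨C, ?_⟩⟩
    filter_upwards [self_mem_nhdsWithin] with r hr x
    exact doubling x r hr
  have h1 := IsUnifLocDoublingMeasure.ae_tendsto_average_norm_sub μ hf 1
  have h2 := (IsUnifLocDoublingMeasure.vitaliFamily μ 1).ae_tendsto_rnDeriv Θ
  have h3 : Θ.rnDeriv μ =ᵐ[μ] 0 := Measure.rnDeriv_eq_zero_of_mutuallySingular hΘ Measure.AbsolutelyContinuous.rfl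
  filter_upwards [h1, h2, h3] with x hx1 hx2 hx3
  have hmem : ∀ᶠ r in 𝓝[>] (0 : ℝ), x ∈ Metric.closedBall x (1 * r) := by
    filter_upwards [self_mem_nhdsWithin] with r hr
    simpa using (le_of_lt hr)
  refine ⟨hx1 (fun _ => x) (fun r => r) tendsto_id hmem, ?_⟩
  rw [hx3] at hx2
  exact hx2.comp (IsUnifLocDoublingMeasure.tendsto_closedBall_filterAt μ (fun _ => x)
    (fun r => r) tendsto_id hmem)

/-! ### Representation of bounded functionals on vector fields -/

section Riesz

open CompactlySupported CompactlySupportedContinuousMap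

variable {X : Type*} [TopologicalSpace X] {H : Type*} [NormedAddCommGroup H]
  [InnerProductSpace ℝ H]

/-- A positive functional on `C_c` that is bounded on functions with values in `[0, 1]` is the
integral against a finite measure. -/
theorem exists_finite_measure_of_positive [T2Space X] [LocallyCompactSpace X] [MeasurableSpace X]
    [BorelSpace X] (A : C_c(X, ℝ) →ₗ[ℝ] ℝ) (hA : ∀ f, 0 ≤ f → 0 ≤ A f)
    (C : ℝ) (hC : ∀ f : C_c(X, ℝ), (∀ x, 0 ≤ f x ∧ f x ≤ 1) → A f ≤ C) :
    ∃ m : Measure X, IsFiniteMeasure m ∧ ∀ f : C_c(X, ℝ), A f = ∫ x, f x ∂m := by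
  let A' : C_c(X, ℝ) →ₚ[ℝ] ℝ := PositiveLinearMap.mk₀ A hA
  refine ⟨RealRMK.rieszMeasure A', ⟨?_⟩, fun f => (RealRMK.integral_rieszMeasure A' f).symm⟩
  have hreg : (RealRMK.rieszMeasure A').Regular := inferInstance
  -- By inner regularity only compact sets matter, and each is dominated by a cutoff function with
  -- values in `[0, 1]`.
  refine lt_of_le_of_lt ?_ (ENNReal.ofReal_lt_top (r := C))
  rw [isOpen_univ.measure_eq_iSup_isCompact]
  refine iSup₂_le fun K _ => iSup_le fun hK => ?_
  obtain ⟨f, hf1, -, hf2, hf3⟩ := exists_continuous_one_zero_of_isCompact hK isClosed_empty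
    (disjoint_empty K)
  let F : C_c(X, ℝ) := ⟨f, hf2⟩
  calc RealRMK.rieszMeasure A' K ≤ ENNReal.ofReal (A' F) :=
        RealRMK.rieszMeasure_le_of_eq_one A' (fun x => (hf3 x).1) hK (fun x hx => hf1 hx)
    _ ≤ ENNReal.ofReal C := ENNReal.ofReal_le_ofReal (hC F fun x => hf3 x)

/-- The linear map `ψ ↦ ψ e` from scalar functions to vector fields. -/
def ccSmulRight (e : H) : C_c(X, ℝ) →ₗ[ℝ] C_c(X, H) where
  toFun ψ := ⟨⟨fun x => ψ x • e, by fun_prop⟩, ψ.hasCompactSupport.smul_right⟩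
  map_add' ψ χ := by ext x; simp [add_smul]
  map_smul' c ψ := by ext x; simp [mul_smul]

/-- The component of a vector field along a vector. -/
def ccInner (e : H) : C_c(X, H) →ₗ[ℝ] C_c(X, ℝ) where
  toFun φ := ⟨⟨fun x => inner ℝ e (φ x), by fun_prop⟩,
    φ.hasCompactSupport.comp_left (g := fun v => inner ℝ e v) (by simp)⟩
  map_add' ψ χ := by ext x; simp [inner_add_right]
  map_smul' c ψ := by ext x; simp [inner_smul_right]

/-- The inclusion of `C_c` into the bounded continuous functions. -/
def ccToBcf : C_c(X, ℝ) →ₗ[ℝ] BoundedContinuousFunction X ℝ where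
  toFun ψ := ψ.toBoundedContinuousFunction
  map_add' ψ χ := by ext x; simp
  map_smul' c ψ := by ext x; simp

/-- A functional on a space of compactly supported continuous vector fields that is bounded with
respect to the sup norm extends to a functional `M` on pairs `(f, φ)` that is nonnegative whenever
`‖φ‖ ≤ f`. -/
theorem exists_positive_extension (x₀ : X) (S : Submodule ℝ C_c(X, H)) (L : S →ₗ[ℝ] ℝ) (C : ℝ)
    (hL : ∀ φ : S, (∀ x, ‖φ.1 x‖ ≤ 1) → L φ ≤ C) :
    ∃ M : BoundedContinuousFunction X ℝ × C_c(X, H) →ₗ[ℝ] ℝ,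
      (∀ f φ, (∀ x, ‖φ x‖ ≤ f x) → 0 ≤ M (f, φ)) ∧ (∀ φ : S, M (0, φ.1) = L φ) ∧
      M (BoundedContinuousFunction.const X 1, 0) = C := by
  -- The functional is extended from constants times `S` by the theorem of M. Riesz, for the cone of
  -- pairs with `‖φ‖ ≤ f`; the bound on `L` is precisely positivity on this cone.
  let s : PointedCone ℝ (BoundedContinuousFunction X ℝ × C_c(X, H)) :=
    { carrier := {p | ∀ x, ‖p.2 x‖ ≤ p.1 x}
      add_mem' := fun {p q} hp hq x => (norm_add_le _ _).trans (add_le_add (hp x) (hq x))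
      zero_mem' := fun x => by simp
      smul_mem' := fun c p hp x => by
        change ‖c.1 • p.2 x‖ ≤ c.1 * p.1 x
        rw [norm_smul, Real.norm_of_nonneg c.2]
        exact mul_le_mul_of_nonneg_left (hp x) c.2 }
  let one : BoundedContinuousFunction X ℝ := BoundedContinuousFunction.const X 1
  let D : Submodule ℝ (BoundedContinuousFunction X ℝ × C_c(X, H)) :=
    (Submodule.span ℝ {one}).prod S
  let T : D →ₗ[ℝ] ℝ :=
    -- The first component is a constant function, so its value at `x₀` is that constant.
    { toFun := fun p => C * p.1.1 x₀ + L ⟨p.1.2, p.2.2⟩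
      map_add' := fun p q => by
        have : (⟨(p + q).1.2, (p + q).2.2⟩ : S) = ⟨p.1.2, p.2.2⟩ + ⟨q.1.2, q.2.2⟩ := rfl
        rw [this, map_add]
        simp; ring
      map_smul' := fun c p => by
        have : (⟨(c • p).1.2, (c • p).2.2⟩ : S) = c • ⟨p.1.2, p.2.2⟩ := rfl
        rw [this, map_smul]
        simp; ring }
  obtain ⟨M, hM1, hM2⟩ := riesz_extension s ⟨D, T⟩ (by
    rintro ⟨⟨f, φ⟩, hf, hφ⟩ hs
    obtain ⟨c, rfl⟩ := Submodule.mem_span_singleton.1 hf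
    change 0 ≤ C * ((c • one) x₀) + L ⟨φ, hφ⟩
    have hs' : ∀ x, ‖φ x‖ ≤ c := fun x => by simpa [one] using hs x
    have hc : 0 ≤ c := (norm_nonneg _).trans (hs' x₀)
    have e1 : (c • one) x₀ = c := by simp [one]
    rw [e1]
    rcases hc.eq_or_lt with rfl | hc
    · have : (⟨φ, hφ⟩ : S) = 0 := by
        ext x
        simpa using hs' x
      rw [this]; simp
    · have := hL (-(c⁻¹ • ⟨φ, hφ⟩)) (fun x => by
        change ‖-(c⁻¹ • φ x)‖ ≤ 1
        rw [norm_neg, norm_smul, norm_inv, Real.norm_of_nonneg hc.le, inv_mul_le_iff₀ hc, mul_one]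
        exact hs' x)
      rw [map_neg, map_smul, smul_eq_mul] at this
      have h2 := mul_le_mul_of_nonneg_left this hc.le
      rw [mul_neg, ← mul_assoc, mul_inv_cancel₀ hc.ne', one_mul] at h2
      linarith) (by
    -- The cofinality condition: a large constant in the first component brings any pair into the
    -- cone.
    rintro ⟨f, φ⟩
    obtain ⟨B, hB⟩ := φ.hasCompactSupport.exists_bound_of_continuous φ.continuous
    refine ⟨⟨((‖f‖ + B) • one, 0), Submodule.mem_prod.2
      ⟨Submodule.smul_mem _ _ (Submodule.mem_span_singleton_self _), S.zero_mem⟩⟩, fun x => ?_⟩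
    change ‖(0 : H) + φ x‖ ≤ (‖f‖ + B) * 1 + f x
    have := hB x
    have := (abs_le.1 (f.norm_coe_le_norm x)).1
    rw [zero_add]; linarith)
  refine ⟨M, fun f φ h => hM2 _ h, fun φ => ?_, ?_⟩
  · rw [show M (0, φ.1) = T ⟨(0, φ.1), ⟨Submodule.zero_mem _, φ.2⟩⟩ from hM1 ⟨(0, φ.1), _⟩]
    simp [T]
  · rw [show M (BoundedContinuousFunction.const X 1, 0) =
      T ⟨(one, 0), ⟨Submodule.mem_span_singleton_self _, S.zero_mem⟩⟩ from hM1 ⟨(one, 0), _⟩]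
    change C * one x₀ + L 0 = C
    simp [one]

/-- **Riesz representation** of a functional on a space of compactly supported continuous vector
fields that is bounded with respect to the sup norm. -/
theorem exists_polar_representation [T2Space X] [LocallyCompactSpace X] [MeasurableSpace X]
    [BorelSpace X] {ι : Type*} [Fintype ι] (b : OrthonormalBasis ι ℝ H)
    [MeasurableSpace H] [BorelSpace H] (x₀ : X) (S : Submodule ℝ C_c(X, H)) (L : S →ₗ[ℝ] ℝ)
    (C : ℝ) (hL : ∀ φ : S, (∀ x, ‖φ.1 x‖ ≤ 1) → L φ ≤ C) :
    ∃ Λ : Measure X, IsFiniteMeasure Λ ∧ ∃ σ : X → H, Measurable σ ∧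
      (∀ᵐ x ∂Λ, ‖σ x‖ = 1) ∧ ∀ φ : S, L φ = ∫ x, inner ℝ (φ.1 x) (σ x) ∂Λ := by
  have : FiniteDimensional ℝ H := b.toBasis.finiteDimensional_of_finite
  obtain ⟨M, hM0, hM1, hM2⟩ := exists_positive_extension x₀ S L C hL
  let one : BoundedContinuousFunction X ℝ := BoundedContinuousFunction.const X 1
  -- For `‖e‖ ≤ 1` the pair `(f, f e)` lies in the cone when `f ≥ 0`, so a signed component of the
  -- functional becomes a difference of two positive ones, for `e = b i` and `e = 0`.
  have hrep : ∀ e : H, ‖e‖ ≤ 1 → ∃ m : Measure X, IsFiniteMeasure m ∧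
      ∀ f : C_c(X, ℝ), M (ccToBcf f, ccSmulRight e f) = ∫ x, f x ∂m := by
    intro e he
    refine exists_finite_measure_of_positive (M ∘ₗ (ccToBcf.prod (ccSmulRight e)))
      (fun f hf => hM0 _ _ fun x => ?_) (2 * C) (fun f hf => ?_)
    · change ‖f x • e‖ ≤ f x
      rw [norm_smul, Real.norm_of_nonneg (hf x)]
      exact mul_le_of_le_one_right (hf x) he
    -- The constant `2` works since `‖f e‖ ≤ f ≤ 2 - f` for `f ≤ 1`.
    · have h1 : 0 ≤ M ((2 : ℝ) • one - ccToBcf f, -ccSmulRight e f) := by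
        refine hM0 _ _ fun x => ?_
        change ‖-(f x • e)‖ ≤ 2 * 1 - f x
        rw [norm_neg, norm_smul, Real.norm_of_nonneg (hf x).1]
        have := mul_le_of_le_one_right (hf x).1 he
        linarith [(hf x).2]
      have h2 : ((2 : ℝ) • one - ccToBcf f, -ccSmulRight e f) =
          (2 : ℝ) • (one, (0 : C_c(X, H))) - (ccToBcf f, ccSmulRight e f) := by
        simp
      rw [h2, map_sub, map_smul, hM2, smul_eq_mul] at h1
      change M (ccToBcf f, ccSmulRight e f) ≤ 2 * C
      linarith
  obtain ⟨m, hmf, hm⟩ := hrep 0 (by simp)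
  choose n hnf hn using fun i => hrep (b i) (by simp)
  -- A common reference measure: all the signed components `n i - m` have densities with respect to
  -- it, and these are the coordinates of `σ₀`.
  let Λ₀ : Measure X := m + ∑ i, n i
  have hmac : m ≪ Λ₀ := Measure.absolutelyContinuous_of_le (Measure.le_add_right le_rfl)
  have hnac : ∀ i, n i ≪ Λ₀ := fun i => Measure.absolutelyContinuous_of_le
    ((Finset.single_le_sum (f := n) (fun j _ => Measure.zero_le _) (Finset.mem_univ i)).trans
      (Measure.le_add_left le_rfl))
  let c : ι → X → ℝ := fun i x => ((n i).rnDeriv Λ₀ x).toReal - (m.rnDeriv Λ₀ x).toReal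
  have hcm : ∀ i, Measurable (c i) := fun i =>
    ((n i).measurable_rnDeriv Λ₀).ennreal_toReal.sub (m.measurable_rnDeriv Λ₀).ennreal_toReal
  have hci : ∀ i, Integrable (c i) Λ₀ := fun i =>
    Measure.integrable_toReal_rnDeriv.sub Measure.integrable_toReal_rnDeriv
  let σ₀ : X → H := fun x => ∑ i, c i x • b i
  have hσm : Measurable σ₀ := Finset.measurable_sum _ fun i _ => (hcm i).smul_const _
  have hσi : Integrable σ₀ Λ₀ := integrable_finsetSum _ fun i _ => (hci i).smul_const _
  have hsum : ∀ φ : C_c(X, H), φ = ∑ i, ccSmulRight (b i) (ccInner (b i) φ) := by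
    intro φ
    ext x
    rw [CompactlySupportedContinuousMap.sum_apply]
    exact (b.sum_repr' (φ x)).symm
  have hL' : ∀ φ : S, L φ = ∫ x, inner ℝ (φ.1 x) (σ₀ x) ∂Λ₀ := by
    intro φ
    have hzero : ∀ f : C_c(X, ℝ), ccSmulRight (0 : H) f = 0 := fun f => by
      ext x; change f x • (0 : H) = 0; simp
    calc L φ = M (0, φ.1) := (hM1 φ).symm
      _ = ∑ i, (∫ x, inner ℝ (b i) (φ.1 x) ∂(n i) - ∫ x, inner ℝ (b i) (φ.1 x) ∂m) := by
        conv_lhs => rw [hsum φ.1]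
        have : ((0 : BoundedContinuousFunction X ℝ), ∑ i, ccSmulRight (b i) (ccInner (b i) φ.1)) =
            ∑ i, ((ccToBcf (ccInner (b i) φ.1), ccSmulRight (b i) (ccInner (b i) φ.1)) -
              (ccToBcf (ccInner (b i) φ.1), ccSmulRight (0 : H) (ccInner (b i) φ.1))) := by
          simp_rw [hzero]
          ext1
          · simp [Prod.fst_sum]
          · simp [Prod.snd_sum]
        rw [this, map_sum]
        refine Finset.sum_congr rfl fun i _ => ?_
        rw [map_sub, hm, hn]
        rfl
      _ = ∑ i, ∫ x, c i x * inner ℝ (b i) (φ.1 x) ∂Λ₀ := by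
        refine Finset.sum_congr rfl fun i _ => ?_
        rw [← integral_rnDeriv_smul hmac, ← integral_rnDeriv_smul (hnac i), ← integral_sub]
        · congr 1 with x
          simp only [c, smul_eq_mul]; ring
        · rw [integrable_rnDeriv_smul_iff (hnac i)]
          exact (ccInner (b i) φ.1).integrable
        · rw [integrable_rnDeriv_smul_iff hmac]
          exact (ccInner (b i) φ.1).integrable
      _ = ∫ x, inner ℝ (φ.1 x) (σ₀ x) ∂Λ₀ := by
        rw [← integral_finsetSum]
        · congr 1 with x
          simp only [σ₀, inner_sum, inner_smul_right]
          simp_rw [real_inner_comm]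
        · intro i _
          have := (ccInner (b i) φ.1).continuous
          obtain ⟨B, hB⟩ := (ccInner (b i) φ.1).hasCompactSupport.exists_bound_of_continuous this
          exact (hci i).mul_bdd this.aestronglyMeasurable (Eventually.of_forall hB)
  -- Polar form of `σ₀ Λ₀`. Where `σ₀ = 0` the inverse is `0` by convention, but the new measure
  -- does not charge that set.
  refine ⟨Λ₀.withDensity (fun x => ‖σ₀ x‖ₑ), ⟨by simpa using! hσi.2⟩, fun x => ‖σ₀ x‖⁻¹ • σ₀ x,
    hσm.norm.inv.smul hσm, ?_, fun φ => ?_⟩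
  · rw [ae_withDensity_iff hσm.enorm]
    filter_upwards with x hx
    have : ‖σ₀ x‖ ≠ 0 := by simpa using hx
    rw [norm_smul, norm_inv, norm_norm, inv_mul_cancel₀ this]
  · rw [hL', integral_withDensity_eq_integral_toReal_smul hσm.enorm (by simp)]
    congr 1 with x
    by_cases hx : σ₀ x = 0
    · simp [hx]
    · rw [inner_smul_right, smul_eq_mul, toReal_enorm, ← mul_assoc,
        mul_inv_cancel₀ (by simpa using hx), one_mul]

end Riesz

/-! ### The group structure -/

namespace StratifiedGroup

variable {G : Type*} [NormedAddCommGroup G] [InnerProductSpace ℝ G] [FiniteDimensional ℝ G]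
  [StratifiedGroup G]

/-- The line through `x` is a one-parameter subgroup. -/
theorem inv_eq_neg (x : G) : x⁻¹ = -x := by
  refine inv_eq_of_mul_eq_one_right ?_
  have := smul_mul_smul x 1 (-1)
  simpa [one_eq_zero] using this

theorem contDiff_mul : ContDiff ℝ ω (fun p : G × G => p.1 * p.2) :=
  contDiff_omega_iff_analyticOnNhd.2 analytic_mul

instance isTopologicalGroup : IsTopologicalGroup G where
  continuous_mul := contDiff_mul.continuous
  continuous_inv := by
    have : (fun x : G => x⁻¹) = fun x => -x := funext inv_eq_neg
    rw [this]
    exact continuous_neg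

theorem zero_mul' (x : G) : (0 : G) * x = x := by rw [← one_eq_zero, one_mul]

theorem mul_zero' (x : G) : x * (0 : G) = x := by rw [← one_eq_zero, mul_one]

theorem inv_zero' : (0 : G)⁻¹ = 0 := by rw [inv_eq_neg, neg_zero]

theorem contDiff_mul_left (p : G) : ContDiff ℝ ω (fun q : G => p * q) :=
  contDiff_mul.comp (contDiff_const.prodMk contDiff_id)

variable (G) in
/-- The component in the `i`-th layer. -/
def proj (i : ℕ) : G →L[ℝ] G := (layer (G := G) i).starProjection

theorem proj_mem (i : ℕ) (x : G) : proj G i x ∈ layer (G := G) i :=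
  Submodule.starProjection_apply_mem _ _

theorem proj_of_mem {i : ℕ} {x : G} (hx : x ∈ layer (G := G) i) : proj G i x = x :=
  Submodule.starProjection_eq_self_iff.2 hx

theorem proj_of_mem_ne {i j : ℕ} (hij : i ≠ j) {x : G} (hx : x ∈ layer (G := G) j) :
    proj G i x = 0 :=
  (Submodule.starProjection_apply_eq_zero_iff _).2
    ((orthogonal_layer i j hij).symm.le hx)

theorem proj_zero_apply (x : G) : proj G 0 x = 0 := by
  have := proj_mem 0 x
  rwa [layer_zero, Submodule.mem_bot] at this

theorem proj_eq_zero_of_step_lt {i : ℕ} (hi : step G < i) (x : G) : proj G i x = 0 := by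
  have := proj_mem i x
  rwa [layer_eq_bot i hi, Submodule.mem_bot] at this

/-- The difference of the two sides is orthogonal to every layer, and the layers span. Layers beyond
the step contribute nothing. -/
theorem sum_proj (x : G) : ∑ i ∈ Finset.range (step G + 1), proj G i x = x := by
  rw [← sub_eq_zero]
  set y := ∑ i ∈ Finset.range (step G + 1), proj G i x - x with hy
  have h : ∀ j, y ∈ (layer (G := G) j)ᗮ := by
    intro j
    rw [← Submodule.starProjection_apply_eq_zero_iff]
    change proj G j y = 0
    rw [hy, map_sub, map_sum]
    by_cases hj : j ∈ Finset.range (step G + 1)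
    · rw [Finset.sum_eq_single_of_mem j hj fun i _ hij =>
        proj_of_mem_ne hij.symm (proj_mem i x), proj_of_mem (proj_mem j x), sub_self]
    · rw [Finset.sum_eq_zero fun i hi => proj_of_mem_ne (show j ≠ i from fun h => hj (h ▸ hi)) (proj_mem i x),
        proj_eq_zero_of_step_lt (by simpa using hj), sub_zero]
  have h2 : y ∈ (⨆ j, layer (G := G) j)ᗮ := by
    rw [← Submodule.iInf_orthogonal]
    exact (Submodule.mem_iInf _).2 h
  rwa [iSup_layer, Submodule.top_orthogonal_eq_bot, Submodule.mem_bot] at h2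

theorem ext_proj {x y : G} (h : ∀ i, proj G i x = proj G i y) : x = y := by
  rw [← sum_proj x, ← sum_proj y]
  exact Finset.sum_congr rfl fun i _ => h i

variable (G) in
/-- The dilation as a continuous linear map. -/
def dilL (r : ℝ) : G →L[ℝ] G := ∑ i ∈ Finset.range (step G + 1), r ^ i • proj G i

theorem dil_eq_sum (r : ℝ) (x : G) :
    dil r x = ∑ i ∈ Finset.range (step G + 1), r ^ i • proj G i x := rfl

theorem dilL_apply (r : ℝ) (x : G) : dilL G r x = dil r x := by
  simp [dilL, dil_eq_sum]

theorem dil_mul {r : ℝ} (hr : 0 < r) (x y : G) : dil r (x * y) = dil r x * dil r y :=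
  dilation_mul r hr x y

theorem proj_dil (i : ℕ) (r : ℝ) (x : G) : proj G i (dil r x) = r ^ i • proj G i x := by
  rw [dil_eq_sum, map_sum]
  by_cases hi : i ∈ Finset.range (step G + 1)
  · rw [Finset.sum_eq_single_of_mem i hi, map_smul, proj_of_mem (proj_mem i x)]
    intro j _ hj
    rw [map_smul, proj_of_mem_ne hj.symm (proj_mem j x), smul_zero]
  · rw [proj_eq_zero_of_step_lt (x := x) (by simpa using hi), smul_zero]
    refine Finset.sum_eq_zero fun j hj => ?_
    rw [map_smul, proj_of_mem_ne (show i ≠ j from fun h => hi (h ▸ hj)) (proj_mem j x), smul_zero]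

theorem dil_dil (r t : ℝ) (x : G) : dil r (dil t x) = dil (r * t) x :=
  ext_proj fun i => by rw [proj_dil, proj_dil, proj_dil, smul_smul, mul_pow]

theorem dil_one (x : G) : dil 1 x = x := ext_proj fun i => by rw [proj_dil, one_pow, one_smul]

theorem dil_zero_left (x : G) : dil 0 x = 0 := ext_proj fun i => by
  rw [proj_dil, map_zero]
  rcases i with _ | i
  · rw [proj_zero_apply, smul_zero]
  · simp

theorem dil_zero_right (r : ℝ) : dil r (0 : G) = 0 := by rw [← dilL_apply, map_zero]

theorem dil_inv_dil {r : ℝ} (hr : r ≠ 0) (x : G) : dil r⁻¹ (dil r x) = x := by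
  rw [dil_dil, inv_mul_cancel₀ hr, dil_one]

theorem dil_dil_inv {r : ℝ} (hr : r ≠ 0) (x : G) : dil r (dil r⁻¹ x) = x := by
  rw [dil_dil, mul_inv_cancel₀ hr, dil_one]

theorem dil_of_mem {i : ℕ} {x : G} (hx : x ∈ layer (G := G) i) (r : ℝ) : dil r x = r ^ i • x :=
  ext_proj fun j => by
    rw [proj_dil, map_smul]
    by_cases h : j = i
    · rw [h]
    · rw [proj_of_mem_ne h hx, smul_zero, smul_zero]

theorem dil_inv (r : ℝ) (x : G) : dil r x⁻¹ = (dil r x)⁻¹ := by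
  rw [inv_eq_neg, inv_eq_neg, ← dilL_apply, ← dilL_apply, map_neg]

theorem continuous_dil : Continuous fun p : ℝ × G => dil p.1 p.2 := by
  simp only [dil_eq_sum]
  fun_prop

theorem continuous_dil_right (r : ℝ) : Continuous fun x : G => dil r x :=
  continuous_dil.comp (Continuous.prodMk_right r)

theorem continuous_dil_left (x : G) : Continuous fun r : ℝ => dil r x :=
  continuous_dil.comp (Continuous.prodMk_left x)

theorem norm_dil_le {r : ℝ} (hr0 : 0 ≤ r) (hr1 : r ≤ 1) (x : G) :
    ‖dil r x‖ ≤ (step G + 1) * (r * ‖x‖) := by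
  rw [dil_eq_sum]
  refine (norm_sum_le _ _).trans ?_
  have : ∀ i ∈ Finset.range (step G + 1), ‖r ^ i • proj G i x‖ ≤ r * ‖x‖ := by
    intro i _
    rcases i with _ | i
    · rw [proj_zero_apply, smul_zero, norm_zero]; positivity
    · rw [norm_smul, norm_pow, Real.norm_of_nonneg hr0]
      refine mul_le_mul ?_ (Submodule.norm_starProjection_apply_le _ _) (norm_nonneg _) hr0
      exact pow_le_of_le_one hr0 hr1 (by simp)
  refine (Finset.sum_le_card_nsmul _ _ _ this).trans_eq ?_
  simp

theorem isInternal_layer : DirectSum.IsInternal (fun i : Fin (step G + 1) => layer (G := G) i) := by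
  have hV : OrthogonalFamily ℝ (fun i : Fin (step G + 1) => layer (G := G) i)
      (fun i => (layer (G := G) i).subtypeₗᵢ) :=
    OrthogonalFamily.of_pairwise fun i j hij =>
      orthogonal_layer (G := G) i j fun h => hij (Fin.ext h)
  rw [hV.isInternal_iff, Submodule.eq_bot_iff]
  intro x hx
  rw [← sum_proj x]
  refine Finset.sum_eq_zero fun i hi => ?_
  refine (Submodule.starProjection_apply_eq_zero_iff _).2 ?_
  exact Submodule.orthogonal_le
    (le_iSup (fun i : Fin (step G + 1) => layer (G := G) i) ⟨i, by simpa using hi⟩) hx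

/-- In a basis adapted to the layers the dilation is diagonal, with `r ^ i` repeated `dim Hⁱ` times.
-/
theorem det_dilL (r : ℝ) : LinearMap.det (dilL G r : G →ₗ[ℝ] G) = r ^ homDim G := by
  let b := (isInternal_layer (G := G)).collectedBasis
    fun i => Module.finBasis ℝ (layer (G := G) i)
  rw [← LinearMap.det_toMatrix b]
  have : LinearMap.toMatrix b b (dilL G r : G →ₗ[ℝ] G) =
      Matrix.diagonal fun a => r ^ (a.1 : ℕ) := by
    ext a c
    have hb : b c ∈ layer (G := G) c.1 :=
      (isInternal_layer (G := G)).collectedBasis_mem _ c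
    rw [LinearMap.toMatrix_apply, ContinuousLinearMap.coe_coe, dilL_apply, dil_of_mem hb, map_smul,
      b.repr_self, Matrix.diagonal_apply, Finsupp.smul_apply, Finsupp.single_apply]
    by_cases h : a = c
    · simp [h]
    · simp [h, Ne.symm h]
  rw [this, Matrix.det_diagonal, Fintype.prod_sigma, homDim, ← Finset.prod_pow_eq_pow_sum,
    Finset.prod_range]
  refine Finset.prod_congr rfl fun i _ => ?_
  simp [pow_mul]

/-! ### Invariance of the Lebesgue measure -/

/-- Dilations are automorphisms, so `δ_r` intertwines the left translations by `p` and by `δ_r p`,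
and the determinant is constant along `r ↦ δ_r p`. As `r → 0` it tends to the determinant of the
identity. -/
theorem det_fderiv_mul_left_zero (p : G) : (fderiv ℝ (fun q : G => p * q) 0).det = 1 := by
  have hcont : Continuous fun p : G => (fderiv ℝ (fun q : G => p * q) 0).det := by
    refine ContinuousLinearMap.continuous_det.comp ?_
    have : ∀ p : G, fderiv ℝ (fun q : G => p * q) 0 =
        (fderiv ℝ (fun z : G × G => z.1 * z.2) (p, 0)).comp (ContinuousLinearMap.inr ℝ G G) := by
      intro p
      have h1 : HasFDerivAt (fun z : G × G => z.1 * z.2)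
        (fderiv ℝ (fun z : G × G => z.1 * z.2) (p, 0)) (p, 0) :=
        (contDiff_mul.differentiable (by simp) _).hasFDerivAt
      exact (h1.comp (0 : G) (hasFDerivAt_prodMk_right p (0 : G))).fderiv
    simp_rw [this]
    have h2 : Continuous (fderiv ℝ (fun z : G × G => z.1 * z.2)) :=
      contDiff_mul.continuous_fderiv (by simp)
    exact (h2.comp (by fun_prop : Continuous fun p : G => (p, (0 : G)))).clm_comp continuous_const
  have hinv : ∀ r : ℝ, 0 < r → (fderiv ℝ (fun q : G => dil r p * q) 0).det =
      (fderiv ℝ (fun q : G => p * q) 0).det := by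
    intro r hr
    have hd : ∀ p q : G, HasFDerivAt (fun q : G => p * q) (fderiv ℝ (fun q : G => p * q) q) q :=
      fun p q => ((contDiff_mul_left p).differentiable (by simp) _).hasFDerivAt
    have h1 : HasFDerivAt (fun q : G => dil r (p * q))
        ((dilL G r).comp (fderiv ℝ (fun q : G => p * q) 0)) 0 := by
      have := (dilL G r).hasFDerivAt.comp (0 : G) (hd p 0)
      refine this.congr_of_eventuallyEq (Eventually.of_forall fun q => ?_)
      exact (dilL_apply r (p * q)).symm
    have h2 : HasFDerivAt (fun q : G => dil r (p * q))
        ((fderiv ℝ (fun q : G => dil r p * q) 0).comp (dilL G r)) 0 := by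
      have h0 : dilL G r 0 = 0 := map_zero _
      have := (hd (dil r p) (dilL G r 0)).comp (0 : G) (dilL G r).hasFDerivAt
      rw [h0] at this
      refine this.congr_of_eventuallyEq (Eventually.of_forall fun q => ?_)
      simp only [Function.comp, dilL_apply]
      exact dil_mul hr p q
    have h3 := congrArg (fun A : G →L[ℝ] G => LinearMap.det (A : G →ₗ[ℝ] G)) (h1.unique h2)
    simp only [ContinuousLinearMap.toLinearMap_comp, LinearMap.det_comp, det_dilL] at h3
    rw [mul_comm] at h3
    exact (mul_right_cancel₀ (pow_ne_zero _ hr.ne') h3).symm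
  have hlim : Tendsto (fun r : ℝ => (fderiv ℝ (fun q : G => dil r p * q) 0).det) (𝓝[>] 0)
      (𝓝 (fderiv ℝ (fun q : G => dil 0 p * q) 0).det) :=
    ((hcont.comp (continuous_dil_left p)).tendsto 0).mono_left nhdsWithin_le_nhds
  have hlim2 : Tendsto (fun r : ℝ => (fderiv ℝ (fun q : G => dil r p * q) 0).det) (𝓝[>] 0)
      (𝓝 (fderiv ℝ (fun q : G => p * q) 0).det) := by
    refine tendsto_const_nhds.congr' ?_
    filter_upwards [self_mem_nhdsWithin] with r hr using (hinv r hr).symm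
  rw [tendsto_nhds_unique hlim2 hlim, dil_zero_left]
  have : (fun q : G => 0 * q) = id := funext zero_mul'
  rw [this, fderiv_id]
  simp [ContinuousLinearMap.det]

/-- The chain rule for `z ↦ p (q z)` at the origin reduces this to base point `0`. -/
theorem det_fderiv_mul_left (p q : G) : (fderiv ℝ (fun q : G => p * q) q).det = 1 := by
  have hd : ∀ p q : G, HasFDerivAt (fun q : G => p * q) (fderiv ℝ (fun q : G => p * q) q) q :=
    fun p q => ((contDiff_mul_left p).differentiable (by simp) _).hasFDerivAt
  have h1 : HasFDerivAt (fun z : G => p * q * z)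
      ((fderiv ℝ (fun q : G => p * q) q).comp (fderiv ℝ (fun z : G => q * z) 0)) 0 := by
    have := (show HasFDerivAt (fun q : G => p * q) (fderiv ℝ (fun q : G => p * q) q) (q * 0) by
      rw [mul_zero']; exact hd p q).comp (0 : G) (hd q 0)
    refine this.congr_of_eventuallyEq (Eventually.of_forall fun z => ?_)
    exact mul_assoc p q z
  have h2 := congrArg (fun A : G →L[ℝ] G => LinearMap.det (A : G →ₗ[ℝ] G)) (h1.fderiv)
  simp only [ContinuousLinearMap.toLinearMap_comp, LinearMap.det_comp] at h2
  have e1 := det_fderiv_mul_left_zero (p * q)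
  have e2 := det_fderiv_mul_left_zero q
  simp only [ContinuousLinearMap.det] at e1 e2 ⊢
  rw [e1, e2, mul_one] at h2
  exact h2.symm

variable [MeasurableSpace G] [BorelSpace G]

instance isMulLeftInvariant_volume : (volume : Measure G).IsMulLeftInvariant := by
  refine ⟨fun p => ?_⟩
  ext s hs
  rw [Measure.map_apply (measurable_const_mul p) hs]
  have hpre : (fun x => p * x) ⁻¹' s = (fun x => p⁻¹ * x) '' s := by
    ext x
    constructor
    · intro hx
      exact ⟨p * x, hx, by simp⟩
    · rintro ⟨y, hy, rfl⟩
      simpa using hy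
  rw [hpre, ← lintegral_abs_det_fderiv_eq_addHaar_image volume hs
    (fun x _ => ((contDiff_mul_left p⁻¹).differentiable (by simp) x).hasFDerivAt.hasFDerivWithinAt)
    (mul_right_injective _).injOn]
  simp [det_fderiv_mul_left]

instance isInvInvariant_volume : (volume : Measure G).IsInvInvariant := by
  refine ⟨?_⟩
  have : (Inv.inv : G → G) = Neg.neg := funext inv_eq_neg
  rw [Measure.inv, this]
  exact Measure.neg_eq_self volume

/-- Right translation is left translation conjugated by inversion, which is `x ↦ -x` and preserves
Lebesgue measure. Unimodularity is used throughout for the kernels `k (x * y⁻¹)`. -/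
instance isMulRightInvariant_volume : (volume : Measure G).IsMulRightInvariant := by
  refine ⟨fun p => ?_⟩
  have h : (fun x : G => x * p) = Inv.inv ∘ (fun x => p⁻¹ * x) ∘ Inv.inv := by
    ext x; simp
  rw [h, ← Measure.map_map (by fun_prop) (by fun_prop), ← Measure.map_map (by fun_prop) (by fun_prop)]
  have e : Measure.map Inv.inv (volume : Measure G) = volume := Measure.inv_eq_self volume
  rw [e, map_mul_left_eq_self, e]

theorem volume_dil_image {r : ℝ} (hr : 0 < r) (s : Set G) :
    volume ((fun x => dil r x) '' s) = ENNReal.ofReal (r ^ homDim G) * volume s := by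
  have := Measure.addHaar_image_linearMap (volume : Measure G) (dilL G r : G →ₗ[ℝ] G) s
  rw [det_dilL, abs_of_pos (pow_pos hr _)] at this
  rw [← this]
  congr 1
  refine image_congr fun x _ => (dilL_apply r x).symm

theorem integral_comp_dil {E : Type*} [NormedAddCommGroup E] [NormedSpace ℝ E] {r : ℝ}
    (hr : 0 < r) (f : G → E) :
    ∫ x, f (dil r x) = (r ^ homDim G)⁻¹ • ∫ x, f x := by
  have h := Measure.map_linearMap_addHaar_eq_smul_addHaar (volume : Measure G)
    (f := (dilL G r : G →ₗ[ℝ] G)) (by rw [det_dilL]; exact pow_ne_zero _ hr.ne')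
  rw [det_dilL, abs_of_pos (inv_pos.2 (pow_pos hr _))] at h
  let e : G ≃ₜ G :=
    { toFun := fun x => dil r x
      invFun := fun x => dil r⁻¹ x
      left_inv := dil_inv_dil hr.ne'
      right_inv := dil_dil_inv hr.ne'
      continuous_toFun := continuous_dil_right r
      continuous_invFun := continuous_dil_right _ }
  have h2 : (⇑(dilL G r : G →ₗ[ℝ] G)) = e := funext fun x => dilL_apply r x
  rw [h2] at h
  have h3 := e.measurableEmbedding.integral_map (μ := volume) f
  rw [h, integral_smul_measure, ENNReal.toReal_ofReal (inv_nonneg.2 (pow_nonneg hr.le _))] at h3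
  exact h3.symm

end StratifiedGroup

/-! ### Homogeneous distances -/

namespace HomogeneousDist

open StratifiedGroup

variable {G : Type*} [NormedAddCommGroup G] [InnerProductSpace ℝ G] [FiniteDimensional ℝ G]
  [StratifiedGroup G] (d : HomogeneousDist G)

/-- The homogeneous norm `d(x, 0)`. -/
def hnorm (x : G) : ℝ := d.dist x 0

theorem dist_eq_hnorm (x y : G) : d.dist x y = d.hnorm (y⁻¹ * x) := by
  rw [hnorm, ← d.left_invariant y⁻¹ x y, inv_mul_cancel, one_eq_zero]

theorem dist_self (x : G) : d.dist x x = 0 := (d.dist_eq_zero x x).2 rfl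

theorem dist_nonneg (x y : G) : 0 ≤ d.dist x y := by
  have := d.dist_triangle x y x
  rw [d.dist_self, d.dist_comm y x] at this
  linarith

theorem hnorm_nonneg (x : G) : 0 ≤ d.hnorm x := d.dist_nonneg x 0

theorem hnorm_eq_zero {x : G} : d.hnorm x = 0 ↔ x = 0 := d.dist_eq_zero x 0

theorem hnorm_zero : d.hnorm 0 = 0 := d.hnorm_eq_zero.2 rfl

theorem hnorm_inv (x : G) : d.hnorm x⁻¹ = d.hnorm x := by
  rw [hnorm, d.dist_comm, d.dist_eq_hnorm, inv_inv, mul_zero']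

theorem hnorm_mul_le (x y : G) : d.hnorm (x * y) ≤ d.hnorm x + d.hnorm y := by
  have := d.dist_triangle (x * y) x 0
  rw [d.dist_eq_hnorm (x * y) x, inv_mul_cancel_left] at this
  simp only [hnorm] at *
  linarith

theorem hnorm_dil {r : ℝ} (hr : 0 < r) (x : G) : d.hnorm (dil r x) = r * d.hnorm x := by
  have := d.homogeneous r hr x 0
  rwa [dil_zero_right] at this

theorem continuous_hnorm : Continuous d.hnorm :=
  d.continuous_dist.comp (Continuous.prodMk_left 0)

theorem rdist_eq (x y : G) : d.rdist x y = d.hnorm (x * y⁻¹) := rfl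

theorem rdist_comm (x y : G) : d.rdist x y = d.rdist y x := by
  rw [rdist_eq, rdist_eq, ← d.hnorm_inv (x * y⁻¹), mul_inv_rev, inv_inv]

/-- The homogeneous norm is bounded away from zero outside the unit ball. -/
theorem exists_hnorm_lt_imp_norm_lt : ∃ c > 0, ∀ x : G, d.hnorm x < c → ‖x‖ < 1 := by
  have key : ∃ c > 0, ∀ x : G, ‖x‖ = 1 → c ≤ d.hnorm x := by
    rcases (Metric.sphere (0 : G) 1).eq_empty_or_nonempty with h | h
    · refine ⟨1, one_pos, fun x hx => ?_⟩
      have : x ∈ Metric.sphere (0 : G) 1 := by simpa using hx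
      rw [h] at this
      exact this.elim
    · obtain ⟨x₀, hx₀, hmin⟩ := (isCompact_sphere (0 : G) 1).exists_isMinOn h
        d.continuous_hnorm.continuousOn
      refine ⟨d.hnorm x₀, ?_, fun x hx => hmin (by simpa using hx)⟩
      refine lt_of_le_of_ne (d.hnorm_nonneg _) fun h0 => ?_
      rw [eq_comm, d.hnorm_eq_zero] at h0
      simp [h0] at hx₀
  obtain ⟨c, hc, hk⟩ := key
  refine ⟨c, hc, fun x hx => ?_⟩
  by_contra! hge
  -- A point with `‖x‖ ≥ 1` is shrunk by some `δ_t`, `t ≤ 1`, onto the Euclidean unit sphere, where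
  -- the homogeneous norm is at least `c`; homogeneity gives the bound at `x`.
  have hcont : ContinuousOn (fun t : ℝ => ‖dil t x‖) (Icc 0 1) :=
    (continuous_dil_left x).norm.continuousOn
  obtain ⟨t, ht, ht1⟩ := intermediate_value_Icc zero_le_one hcont
    (show (1 : ℝ) ∈ Icc ‖dil 0 x‖ ‖dil 1 x‖ by
      rw [dil_zero_left, dil_one, norm_zero]; exact ⟨zero_le_one, hge⟩)
  have htpos : 0 < t := by
    refine lt_of_le_of_ne ht.1 fun h => ?_
    rw [← h] at ht1
    simp [dil_zero_left] at ht1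
  have h1 := hk _ ht1
  rw [d.hnorm_dil htpos] at h1
  nlinarith [d.hnorm_nonneg x, ht.2]

/-- A suitable dilation carries the ball into the Euclidean unit ball. -/
theorem isCompact_hnorm_le (R : ℝ) : IsCompact {x : G | d.hnorm x ≤ R} := by
  obtain ⟨c, hc, h⟩ := d.exists_hnorm_lt_imp_norm_lt
  let t : ℝ := c / (2 * (|R| + 1))
  have ht : 0 < t := by positivity
  refine ((isCompact_closedBall (0 : G) 1).image (continuous_dil_right t⁻¹)).of_isClosed_subset
    (isClosed_le d.continuous_hnorm continuous_const) fun x hx => ?_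
  refine ⟨dil t x, ?_, dil_inv_dil ht.ne' x⟩
  rw [mem_closedBall_zero_iff]
  refine (h _ ?_).le
  rw [d.hnorm_dil ht]
  calc t * d.hnorm x ≤ t * |R| := mul_le_mul_of_nonneg_left (le_trans hx (le_abs_self R)) ht.le
    _ < c := by
      simp only [t]
      rw [div_mul_eq_mul_div, div_lt_iff₀ (by positivity)]
      nlinarith [abs_nonneg R]

/-- Homogeneous balls form a base of neighbourhoods of `0`, because `δ_r` with `r ≤ 1` contracts the
Euclidean norm by a factor comparable to `r`. -/
theorem exists_hnorm_lt_subset {U : Set G} (hU : U ∈ 𝓝 (0 : G)) :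
    ∃ ε > 0, ∀ x, d.hnorm x < ε → x ∈ U := by
  obtain ⟨c, hc, h⟩ := d.exists_hnorm_lt_imp_norm_lt
  obtain ⟨η, hη, hηU⟩ := Metric.mem_nhds_iff.1 hU
  obtain ⟨r, hr0, hr1, hr⟩ : ∃ r : ℝ, 0 < r ∧ r ≤ 1 ∧ (step G + 1) * r ≤ η :=
    ⟨min 1 (η / (step G + 1)), by positivity, min_le_left _ _, by
      calc ((step G : ℝ) + 1) * min 1 (η / (step G + 1)) ≤ (step G + 1) * (η / (step G + 1)) := by
            gcongr; exact min_le_right _ _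
        _ = η := by field_simp⟩
  refine ⟨r * c, by positivity, fun x hx => hηU ?_⟩
  have h1 : ‖dil r⁻¹ x‖ < 1 := h _ (by
    rw [d.hnorm_dil (inv_pos.2 hr0), inv_mul_lt_iff₀ hr0]; exact hx)
  rw [mem_ball_zero_iff, ← dil_dil_inv hr0.ne' x]
  refine (norm_dil_le hr0.le hr1 _).trans_lt ?_
  calc ((step G : ℝ) + 1) * (r * ‖dil r⁻¹ x‖) < (step G + 1) * (r * 1) := by gcongr
    _ ≤ η := by rw [mul_one]; exact hr

theorem isOpen_iff_dist (s : Set G) :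
    IsOpen s ↔ ∀ x ∈ s, ∃ ε > 0, ∀ y, d.dist x y < ε → y ∈ s := by
  constructor
  · intro hs x hx
    have : (fun z => x * z) ⁻¹' s ∈ 𝓝 (0 : G) :=
      (continuous_const_mul x).continuousAt.preimage_mem_nhds
        (by rw [mul_zero']; exact hs.mem_nhds hx)
    obtain ⟨ε, hε, h⟩ := d.exists_hnorm_lt_subset this
    refine ⟨ε, hε, fun y hy => ?_⟩
    have := h (x⁻¹ * y) (by rw [← d.dist_eq_hnorm, d.dist_comm]; exact hy)
    simpa using this
  · intro h
    rw [isOpen_iff_mem_nhds]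
    intro x hx
    obtain ⟨ε, hε, hs⟩ := h x hx
    refine mem_of_superset ?_ hs
    have : Continuous fun y => d.dist x y := d.continuous_dist.comp (Continuous.prodMk_right x)
    exact (isOpen_lt this continuous_const).mem_nhds (by simpa [d.dist_self] using hε)

/-- The closed ball `{y | d(y, x) ≤ r}`. -/
def cball (x : G) (r : ℝ) : Set G := {y | d.dist y x ≤ r}

theorem mem_cball {x y : G} {r : ℝ} : y ∈ d.cball x r ↔ d.hnorm (x⁻¹ * y) ≤ r := by
  rw [cball, mem_ofPred_eq, d.dist_eq_hnorm]

theorem mem_ball' {x y : G} {r : ℝ} : y ∈ d.ball x r ↔ d.hnorm (x⁻¹ * y) < r := by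
  rw [ball, mem_ofPred_eq, d.dist_eq_hnorm]

theorem isOpen_ball (x : G) (r : ℝ) : IsOpen (d.ball x r) :=
  isOpen_lt (d.continuous_dist.comp (Continuous.prodMk_left x)) continuous_const

theorem isClosed_cball (x : G) (r : ℝ) : IsClosed (d.cball x r) :=
  isClosed_le (d.continuous_dist.comp (Continuous.prodMk_left x)) continuous_const

theorem ball_subset_cball (x : G) (r : ℝ) : d.ball x r ⊆ d.cball x r :=
  fun y (hy : d.dist y x < r) => show d.dist y x ≤ r from hy.le

theorem isCompact_cball (x : G) (r : ℝ) : IsCompact (d.cball x r) := by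
  refine ((d.isCompact_hnorm_le r).image (continuous_const_mul x)).of_isClosed_subset
    (d.isClosed_cball x r) fun y hy => ⟨x⁻¹ * y, d.mem_cball.1 hy, by simp⟩

theorem preimage_mul_left_cball (x : G) (r : ℝ) :
    (fun z => x * z) ⁻¹' (d.cball x r) = {z | d.hnorm z ≤ r} := by
  ext z
  simp [mem_cball]

theorem preimage_mul_left_ball (x : G) (r : ℝ) :
    (fun z => x * z) ⁻¹' (d.ball x r) = {z | d.hnorm z < r} := by
  ext z
  simp [mem_ball']

variable [MeasurableSpace G] [BorelSpace G]

theorem volume_hnorm_lt {r : ℝ} (hr : 0 < r) :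
    volume {z : G | d.hnorm z < r} =
      ENNReal.ofReal (r ^ homDim G) * volume {z : G | d.hnorm z < 1} := by
  rw [← volume_dil_image hr]
  congr 1
  ext z
  constructor
  · intro hz
    refine ⟨dil r⁻¹ z, ?_, dil_dil_inv hr.ne' z⟩
    rw [mem_ofPred_eq, d.hnorm_dil (inv_pos.2 hr), inv_mul_lt_iff₀ hr, mul_one]
    exact hz
  · rintro ⟨w, hw, rfl⟩
    rw [mem_ofPred_eq, d.hnorm_dil hr]
    exact (mul_lt_iff_lt_one_right hr).2 hw

theorem volume_ball (x : G) {r : ℝ} (hr : 0 < r) :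
    volume (d.ball x r) = ENNReal.ofReal (r ^ homDim G) * volume {z : G | d.hnorm z < 1} := by
  rw [← d.volume_hnorm_lt hr, ← d.preimage_mul_left_ball x r, measure_preimage_mul]

theorem volume_hnorm_lt_one_lt_top : volume {z : G | d.hnorm z < 1} < ⊤ :=
  (measure_mono (t := {z | d.hnorm z ≤ 1}) fun z (hz : d.hnorm z < 1) =>
    show d.hnorm z ≤ 1 from hz.le).trans_lt (d.isCompact_hnorm_le 1).measure_lt_top

theorem volume_ball_lt_top (x : G) (r : ℝ) : volume (d.ball x r) < ⊤ :=
  (measure_mono (d.ball_subset_cball x r)).trans_lt (d.isCompact_cball x r).measure_lt_top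

theorem volume_ball_pos (x : G) {r : ℝ} (hr : 0 < r) : 0 < volume (d.ball x r) :=
  (d.isOpen_ball x r).measure_pos volume ⟨x, by simpa [mem_ball', one_eq_zero, d.hnorm_zero] using hr⟩

theorem volume_cball_le (x : G) {r t : ℝ} (hr : 0 < r) (ht : 1 < t) :
    volume (d.cball x r) ≤ ENNReal.ofReal (t ^ homDim G) * volume (d.ball x r) := by
  have h : d.cball x r ⊆ d.ball x (t * r) := fun y (hy : d.dist y x ≤ r) =>
    show d.dist y x < t * r by nlinarith
  refine (measure_mono h).trans_eq ?_
  rw [d.volume_ball x hr, d.volume_ball x (by positivity), mul_pow,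
    ENNReal.ofReal_mul (by positivity), mul_assoc]

/-- Lebesgue's differentiation theorem for the homogeneous balls. -/
theorem ae_tendsto_average_cball {E : Type*} [NormedAddCommGroup E] {f : G → E}
    (hf : LocallyIntegrable f volume) {Θ : Measure G} [IsLocallyFiniteMeasure Θ]
    (hΘ : Θ ⟂ₘ volume) :
    ∀ᵐ x, Tendsto (fun r => ⨍ y in d.cball x r, ‖f y - f x‖) (𝓝[>] 0) (𝓝 0) ∧
      Tendsto (fun r => Θ (d.cball x r) / volume (d.cball x r)) (𝓝[>] 0) (𝓝 0) := by
  -- The doubling constant is `4 ^ Q`: the closed ball of radius `2 r` lies in the open ball of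
  -- radius `4 r`, whose volume is known exactly.
  refine ae_tendsto_average_of_doubling d.dist d.dist_self d.dist_comm d.dist_triangle
    d.isOpen_iff_dist (Real.toNNReal (4 ^ homDim G)) (fun x r hr => ?_) hf hΘ
  refine (measure_mono (t := d.ball x (4 * r)) fun y (hy : d.dist y x ≤ 2 * r) =>
    show d.dist y x < 4 * r by linarith).trans ?_
  refine le_trans ?_ (mul_le_mul_right (measure_mono (d.ball_subset_cball x r)) _)
  rw [d.volume_ball x hr, d.volume_ball x (by positivity), mul_pow,
    ENNReal.ofReal_mul (by positivity), mul_assoc]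
  exact le_rfl

/-- Lebesgue points for the right invariant balls. -/
theorem ae_tendsto_average_rdist {E : Type*} [NormedAddCommGroup E] {f : G → E}
    (hf : LocallyIntegrable f volume) :
    ∀ᵐ x, Tendsto (fun r => ⨍ y in {y | d.rdist x y ≤ r}, ‖f y - f x‖) (𝓝[>] 0) (𝓝 0) := by
  -- Inversion preserves the volume and turns balls of `d^R` around `x` into balls of `d` around
  -- `x⁻¹`. Kernels `k (x * y⁻¹)` see the balls of `d^R`.
  have hmp : MeasurePreserving (Inv.inv : G → G) volume volume :=
    Measure.measurePreserving_inv volume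
  have hemb : MeasurableEmbedding (Inv.inv : G → G) := (Homeomorph.inv G).measurableEmbedding
  have hf' : LocallyIntegrable (fun x => f x⁻¹) volume := by
    rw [← hmp.map_eq] at hf
    have h3 := (locallyIntegrable_map_homeomorph (Homeomorph.inv G) (f := f) (μ := volume)).1 hf
    exact h3
  have h := d.ae_tendsto_average_cball hf' (Θ := 0) (Measure.MutuallySingular.zero_left)
  have h2 := hmp.quasiMeasurePreserving.ae h
  filter_upwards [h2] with x hx
  refine hx.1.congr fun r => ?_
  have hset : {y | d.rdist x y ≤ r} = Inv.inv ⁻¹' (d.cball x⁻¹ r) := by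
    ext y
    rw [mem_preimage, mem_cball, inv_inv, mem_ofPred_eq, rdist_eq]
  simp only [setAverage_eq, inv_inv]
  rw [hset, ← hmp.setIntegral_preimage_emb hemb (fun y => ‖f y⁻¹ - f x‖)]
  simp only [inv_inv, measureReal_def]
  rw [hmp.measure_preimage_emb hemb]

end HomogeneousDist

/-! ### Generation of the group by its first layer -/

namespace StratifiedGroup

variable {G : Type*} [NormedAddCommGroup G] [InnerProductSpace ℝ G] [FiniteDimensional ℝ G]
  [StratifiedGroup G]

/-- The second order expansion of the group operation at the identity. -/
theorem exists_bilin_expansion : ∃ B : G →L[ℝ] G →L[ℝ] G,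
    (∀ ε > 0, ∃ η > 0, ∀ a b : G, ‖a‖ < η → ‖b‖ < η →
      ‖a * b - a - b - B a b‖ ≤ ε * (‖a‖ * ‖b‖)) ∧
    ∀ v w : G, VectorField.lieBracket ℝ (leftInvField v) (leftInvField w) 0 = B v w - B w v := by
  let m : G × G → G := fun p => p.1 * p.2
  have hm : ContDiff ℝ ω m := contDiff_mul
  let χ : G × G → G →L[ℝ] G := fun p => (fderiv ℝ m p).comp (ContinuousLinearMap.inr ℝ G G)
  have hmχ : ∀ a b : G, HasFDerivAt (fun q : G => a * q) (χ (a, b)) b := fun a b =>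
    ((hm.differentiable (by simp) (a, b)).hasFDerivAt).comp b (hasFDerivAt_prodMk_right a b)
  have hχ : ContDiff ℝ ω χ := (hm.fderiv_right (by simp)).clm_comp contDiff_const
  -- `B` is the mixed second derivative of the product at the origin. It is also the derivative of
  -- `p ↦ X_w(p)` at `0`, hence its relation to the bracket.
  let D : G × G →L[ℝ] G →L[ℝ] G := fderiv ℝ χ 0
  have hD : HasStrictFDerivAt χ D 0 := hχ.contDiffAt.hasStrictFDerivAt (by simp)
  let B : G →L[ℝ] G →L[ℝ] G := D.comp (ContinuousLinearMap.inl ℝ G G)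
  refine ⟨B, fun ε hε => ?_, fun v w => ?_⟩
  · obtain ⟨η, hη, h⟩ := Metric.eventually_nhds_iff.1 (hD.isLittleO.def hε)
    refine ⟨η, hη, fun a b ha hb => ?_⟩
    -- The mean value inequality in `q` gives an error of product type `ε ‖a‖ ‖b‖`; this form is
    -- what survives division by `r ^ (i + j)` later.
    let f : G → G := fun q => a * q - 0 * q - B a q
    have hf : ∀ q, HasFDerivAt f (χ (a, q) - χ (0, q) - B a) q := fun q =>
      ((hmχ a q).sub (hmχ 0 q)).sub (B a).hasFDerivAt
    have hbound : ∀ q ∈ Metric.ball (0 : G) η, ‖χ (a, q) - χ (0, q) - B a‖ ≤ ε * ‖a‖ := by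
      intro q hq
      have := h (y := ((a, q), (0, q))) (by
        rw [mem_ball_zero_iff] at hq
        simp only [Prod.zero_eq_mk, Prod.dist_eq, dist_zero_right, norm_zero]
        simp [ha, hq])
      simpa [B] using this
    have := (convex_ball (0 : G) η).norm_image_sub_le_of_norm_hasFDerivWithin_le
      (fun q _ => (hf q).hasFDerivWithinAt) hbound (Metric.mem_ball_self hη)
      (by simpa using hb : b ∈ Metric.ball (0 : G) η)
    have e : f b - f 0 = a * b - a - b - B a b := by
      simp only [f, zero_mul', mul_zero', map_zero]
      abel
    rw [e, sub_zero, mul_assoc] at this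
    exact this
  · have hl : ∀ w : G, leftInvField w = fun p => χ (p, 0) w := fun w =>
      funext fun p => by rw [leftInvField, (hmχ p 0).fderiv]
    have hd : ∀ w : G, HasFDerivAt (leftInvField w) ((B.flip) w) 0 := by
      intro w
      rw [hl]
      have h1 : HasFDerivAt (fun p : G => χ (p, 0)) B 0 :=
        HasFDerivAt.comp (f := fun e : G => (e, (0 : G))) (0 : G) hD.hasFDerivAt
          (hasFDerivAt_prodMk_left (0 : G) (0 : G))
      have h2 := h1.clm_apply (hasFDerivAt_const w (0 : G))
      refine h2.congr_fderiv ?_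
      ext v
      simp
    have h0 : ∀ w : G, leftInvField w 0 = w := by
      intro w
      rw [leftInvField]
      have : (fun q : G => 0 * q) = id := funext zero_mul'
      rw [this, fderiv_id]; rfl
    rw [VectorField.lieBracket, (hd w).fderiv, (hd v).fderiv, h0, h0]
    simp

variable (G) in
/-- The vectors whose components in the layers below `i` vanish. -/
def Fil (i : ℕ) : Set G := {x | ∀ k < i, proj G k x = 0}

theorem fil_one (x : G) : x ∈ Fil G 1 := fun k hk => by
  obtain rfl : k = 0 := by omega
  exact proj_zero_apply x

theorem mem_fil_succ {i : ℕ} {x : G} (hx : x ∈ Fil G i) (h : proj G i x = 0) :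
    x ∈ Fil G (i + 1) := fun k hk => by
  rcases Nat.lt_succ_iff_lt_or_eq.1 hk with h' | rfl
  · exact hx k h'
  · exact h

theorem inv_mem_fil {i : ℕ} {x : G} (hx : x ∈ Fil G i) : x⁻¹ ∈ Fil G i := fun k hk => by
  rw [inv_eq_neg, map_neg, hx k hk, neg_zero]

/-- The renormalized dilation `r⁻ⁱ δ_r` on `Fil i`. -/
def renDil (i : ℕ) (r : ℝ) (x : G) : G :=
  ∑ k ∈ Finset.range (step G + 1), r ^ (k - i) • proj G k x

theorem dil_eq_smul_renDil {i : ℕ} {x : G} (hx : x ∈ Fil G i) (r : ℝ) :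
    dil r x = r ^ i • renDil i r x := by
  rw [dil_eq_sum, renDil, Finset.smul_sum]
  refine Finset.sum_congr rfl fun k _ => ?_
  rcases lt_or_ge k i with h | h
  · rw [hx k h, smul_zero, smul_zero, smul_zero]
  · rw [smul_smul, ← pow_add, Nat.add_sub_cancel' h]

theorem continuous_renDil (i : ℕ) (x : G) : Continuous fun r => renDil i r x := by
  unfold renDil
  fun_prop

theorem renDil_zero {i : ℕ} {x : G} (hx : x ∈ Fil G i) : renDil i 0 x = proj G i x := by
  rw [renDil]
  by_cases hi : i ∈ Finset.range (step G + 1)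
  · rw [Finset.sum_eq_single_of_mem i hi, Nat.sub_self, pow_zero, one_smul]
    intro k _ hk
    rcases lt_or_gt_of_ne hk with h | h
    · rw [hx k h, smul_zero]
    · rw [zero_pow (by omega), zero_smul]
  · rw [proj_eq_zero_of_step_lt (x := x) (by simpa using hi)]
    refine Finset.sum_eq_zero fun k hk => ?_
    rw [hx k (by simp at hi hk; omega), smul_zero]

/-- The components of a product, up to the first layer where the group operation is not
additive. -/
theorem proj_mul_of_mem_fil {B : G →L[ℝ] G →L[ℝ] G}
    (hB : ∀ ε > 0, ∃ η > 0, ∀ a b : G, ‖a‖ < η → ‖b‖ < η →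
      ‖a * b - a - b - B a b‖ ≤ ε * (‖a‖ * ‖b‖))
    {i j k : ℕ} {x y : G} (hx : x ∈ Fil G i) (hy : y ∈ Fil G j)
    (hk : k ≤ i + j) :
    proj G k (x * y) = proj G k x + proj G k y +
      (0 : ℝ) ^ (i + j - k) • proj G k (B (proj G i x) (proj G j y)) := by
  -- Dilate both factors and let `r → 0`: layer `k` of `P` scales by `r ^ k`, whereas `B` is of
  -- order `r ^ (i + j)` and the error is of smaller order. The power of `0` is `1` if `k = i + j`
  -- and `0` if `k` is smaller.
  let P : G → G → G := fun a b => a * b - a - b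
  suffices h : proj G k (P x y) =
      (0 : ℝ) ^ (i + j - k) • proj G k (B (proj G i x) (proj G j y)) by
    rw [← h]; simp only [P, map_sub]; abel
  have hE : Tendsto (fun r : ℝ => (r ^ (i + j))⁻¹ • (P (dil r x) (dil r y) -
      B (dil r x) (dil r y))) (𝓝[>] 0) (𝓝 0) := by
    rw [Metric.tendsto_nhds]
    intro ε hε
    let M : ℝ := ‖proj G i x‖ * ‖proj G j y‖ + 1
    have hM : 0 < M := by positivity
    obtain ⟨η, hη, h⟩ := hB (ε / (2 * M)) (by positivity)
    have c1 : Tendsto (fun r : ℝ => ‖dil r x‖) (𝓝[>] 0) (𝓝 0) := by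
      have := ((continuous_dil_left x).norm.tendsto 0).mono_left (nhdsWithin_le_nhds (s := Ioi 0))
      simpa [dil_zero_left] using this
    have c2 : Tendsto (fun r : ℝ => ‖dil r y‖) (𝓝[>] 0) (𝓝 0) := by
      have := ((continuous_dil_left y).norm.tendsto 0).mono_left (nhdsWithin_le_nhds (s := Ioi 0))
      simpa [dil_zero_left] using this
    have c3 : Tendsto (fun r : ℝ => ‖renDil i r x‖ * ‖renDil j r y‖) (𝓝[>] 0)
        (𝓝 (‖proj G i x‖ * ‖proj G j y‖)) := by
      have hc : Continuous fun r : ℝ => ‖renDil i r x‖ * ‖renDil j r y‖ :=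
        (continuous_renDil i x).norm.mul (continuous_renDil j y).norm
      have := (hc.tendsto 0).mono_left (nhdsWithin_le_nhds (s := Ioi 0))
      simpa [renDil_zero hx, renDil_zero hy] using this
    filter_upwards [c1.eventually_lt_const hη, c2.eventually_lt_const hη,
      c3.eventually_lt_const (u := M) (by simp [M]), self_mem_nhdsWithin] with r h1 h2 h3 hr
    have hr : 0 < r := hr
    rw [dist_zero_right, norm_smul, norm_inv, norm_pow, Real.norm_of_nonneg hr.le]
    have h4 := h _ _ h1 h2
    rw [inv_mul_lt_iff₀ (pow_pos hr _)]
    refine h4.trans_lt ?_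
    rw [dil_eq_smul_renDil hx, dil_eq_smul_renDil hy, norm_smul, norm_smul, norm_pow, norm_pow,
      Real.norm_of_nonneg hr.le]
    calc ε / (2 * M) * (r ^ i * ‖renDil i r x‖ * (r ^ j * ‖renDil j r y‖))
        = r ^ (i + j) * (ε / (2 * M) * (‖renDil i r x‖ * ‖renDil j r y‖)) := by ring
      _ ≤ r ^ (i + j) * (ε / (2 * M) * M) := by gcongr
      _ < r ^ (i + j) * ε := by
        refine mul_lt_mul_of_pos_left ?_ (pow_pos hr _)
        rw [div_mul_eq_mul_div, div_lt_iff₀ (by positivity)]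
        nlinarith
  have hBl : Tendsto (fun r : ℝ => B (renDil i r x) (renDil j r y)) (𝓝[>] 0)
      (𝓝 (B (proj G i x) (proj G j y))) := by
    have hc : Continuous fun r : ℝ => B (renDil i r x) (renDil j r y) :=
      (B.continuous.comp (continuous_renDil i x)).clm_apply (continuous_renDil j y)
    have := (hc.tendsto 0).mono_left (nhdsWithin_le_nhds (s := Ioi 0))
    simpa [renDil_zero hx, renDil_zero hy] using this
  have hpow : Tendsto (fun r : ℝ => r ^ (i + j - k)) (𝓝[>] 0) (𝓝 (0 ^ (i + j - k))) :=
    ((continuous_pow _).tendsto 0).mono_left nhdsWithin_le_nhds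
  have hlim := hpow.smul (((proj G k).continuous.tendsto _).comp (hE.add hBl))
  rw [zero_add] at hlim
  refine tendsto_nhds_unique (tendsto_const_nhds.congr' ?_) hlim
  filter_upwards [self_mem_nhdsWithin] with r hr
  have hr : 0 < r := hr
  have h1 : proj G k (P (dil r x) (dil r y)) = r ^ k • proj G k (P x y) := by
    simp only [P]
    rw [← dil_mul hr, map_sub, map_sub, proj_dil, proj_dil, proj_dil, map_sub, map_sub, smul_sub,
      smul_sub]
  have h2 : B (dil r x) (dil r y) = r ^ (i + j) • B (renDil i r x) (renDil j r y) := by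
    rw [dil_eq_smul_renDil hx, dil_eq_smul_renDil hy]
    simp [smul_smul, pow_add, mul_comm]
  simp only [Function.comp]
  rw [h2, smul_sub, smul_smul, inv_mul_cancel₀ (pow_ne_zero _ hr.ne'), one_smul, sub_add_cancel,
    map_smul, h1, smul_smul, smul_smul]
  have : r ^ (i + j - k) * ((r ^ (i + j))⁻¹ * r ^ k) = 1 := by
    have : r ^ (i + j) = r ^ (i + j - k) * r ^ k := by rw [← pow_add, Nat.sub_add_cancel hk]
    rw [this]
    field_simp
  rw [mul_assoc, this, one_smul]

theorem proj_mul_of_lt {i j k : ℕ} {x y : G} (hx : x ∈ Fil G i) (hy : y ∈ Fil G j)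
    (hk : k < i + j) : proj G k (x * y) = proj G k x + proj G k y := by
  obtain ⟨B, hB, -⟩ := exists_bilin_expansion (G := G)
  rw [proj_mul_of_mem_fil hB hx hy hk.le, zero_pow (by omega), zero_smul, add_zero]

theorem proj_one_mul (x y : G) : proj G 1 (x * y) = proj G 1 x + proj G 1 y :=
  proj_mul_of_lt (fil_one x) (fil_one y) (by norm_num)

/-- The group commutator of a horizontal vector and an element of `Fil j` is given by the Lie
bracket, up to higher layers. -/
theorem commutator_mem_fil {j : ℕ} (hj : 1 ≤ j) {v y : G} (hv : v ∈ layer (G := G) 1)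
    (hy : y ∈ Fil G j) :
    v * y * (y * v)⁻¹ ∈ Fil G (j + 1) ∧ proj G (j + 1) (v * y * (y * v)⁻¹) =
      VectorField.lieBracket ℝ (leftInvField v) (leftInvField (proj G j y)) 0 := by
  obtain ⟨B, hB, hbr⟩ := exists_bilin_expansion (G := G)
  set c := v * y * (y * v)⁻¹ with hc
  -- The commutator is read off by comparing the layers of both sides: up to layer `j` all products
  -- are additive, so `c` has no component there; in layer `j + 1` the terms `B v y_j` and `B y_j v`
  -- remain.
  have hcz : c * (y * v) = v * y := by rw [hc, inv_mul_cancel_right]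
  have hfil : ∀ k, k ≤ j → c ∈ Fil G (k + 1) := by
    intro k
    induction k with
    | zero => exact fun _ => fil_one c
    | succ k ih =>
      intro hk
      have hck := ih (by omega)
      refine mem_fil_succ hck ?_
      have h1 := proj_mul_of_lt hck (fil_one (y * v))
        (show k + 1 < k + 1 + 1 by omega)
      have h2 := proj_mul_of_lt (fil_one v) hy (show k + 1 < 1 + j by omega)
      have h3 := proj_mul_of_lt hy (fil_one v) (show k + 1 < j + 1 by omega)
      rw [hcz, h2, h3] at h1
      have : proj G (k + 1) c = (proj G (k + 1) v + proj G (k + 1) y) -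
        (proj G (k + 1) y + proj G (k + 1) v) := by rw [h1]; abel
      rw [this]; abel
  have hcj := hfil j le_rfl
  refine ⟨hcj, ?_⟩
  have h1 := proj_mul_of_lt hcj (fil_one (y * v))
    (show j + 1 < j + 1 + 1 by omega)
  have h2 := proj_mul_of_mem_fil hB (fil_one v) hy (show j + 1 ≤ 1 + j by omega)
  have h3 := proj_mul_of_mem_fil hB hy (fil_one v) (show j + 1 ≤ j + 1 by omega)
  rw [show 1 + j - (j + 1) = 0 by omega, pow_zero, one_smul] at h2
  rw [Nat.sub_self, pow_zero, one_smul] at h3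
  rw [proj_of_mem hv] at h2 h3
  rw [hcz, h2, h3] at h1
  have hmem : VectorField.lieBracket ℝ (leftInvField v) (leftInvField (proj G j y)) 0 ∈
      layer (G := G) (j + 1) := by
    rw [← bracket_layer j hj]
    exact Submodule.subset_span ⟨v, hv, _, proj_mem j y, rfl⟩
  rw [← proj_of_mem hmem, hbr, map_sub]
  have : proj G (j + 1) c = (proj G (j + 1) v + proj G (j + 1) y +
      proj G (j + 1) (B v (proj G j y))) - (proj G (j + 1) y + proj G (j + 1) v +
        proj G (j + 1) (B (proj G j y) v)) := by rw [h1]; abel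
  rw [this]; abel

/-- Every vector of a layer is the leading component of an element of the subgroup generated by
the first layer. -/
theorem exists_mem_closure_proj_eq (j : ℕ) (w : G) (hw : w ∈ layer (G := G) (j + 1)) :
    ∃ x ∈ Subgroup.closure (layer (G := G) 1 : Set G), x ∈ Fil G (j + 1) ∧
      proj G (j + 1) x = w := by
  induction j generalizing w with
  | zero => exact ⟨w, Subgroup.subset_closure hw, fil_one w, proj_of_mem hw⟩
  | succ j ih =>
    rw [← bracket_layer (j + 1) (by omega)] at hw
    -- The generated subgroup is not obviously stable under scalars, so multiples are carried along;
    -- in a bracket the scalar is absorbed by the horizontal vector.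
    suffices h : ∀ c : ℝ, ∃ x ∈ Subgroup.closure (layer (G := G) 1 : Set G),
        x ∈ Fil G (j + 1 + 1) ∧ proj G (j + 1 + 1) x = c • w by
      simpa using h 1
    induction hw using Submodule.span_induction with
    | mem z hz =>
      obtain ⟨v, hv, u, hu, rfl⟩ := hz
      intro c
      obtain ⟨y, hyS, hyF, hyu⟩ := ih u hu
      have hcv : c • v ∈ layer (G := G) 1 := Submodule.smul_mem _ c hv
      obtain ⟨h1, h2⟩ := commutator_mem_fil (by omega) hcv hyF
      refine ⟨_, ?_, h1, ?_⟩
      · exact mul_mem (mul_mem (Subgroup.subset_closure hcv) hyS)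
          (inv_mem (mul_mem hyS (Subgroup.subset_closure hcv)))
      · obtain ⟨B, -, hbr⟩ := exists_bilin_expansion (G := G)
        rw [h2, hyu, hbr, hbr]
        simp [smul_sub]
    | zero =>
      intro c
      refine ⟨0, ?_, fun k _ => by simp, by simp⟩
      rw [← one_eq_zero]
      exact one_mem _
    | add a b _ _ ha hb =>
      intro c
      obtain ⟨x, hxS, hxF, hx⟩ := ha c
      obtain ⟨y, hyS, hyF, hy⟩ := hb c
      refine ⟨x * y, mul_mem hxS hyS, fun k hk => ?_, ?_⟩
      · rw [proj_mul_of_lt hxF hyF (by omega), hxF k hk, hyF k hk, add_zero]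
      · rw [proj_mul_of_lt hxF hyF (by omega), hx, hy, smul_add]
    | smul a z _ hz =>
      intro c
      obtain ⟨x, hxS, hxF, hx⟩ := hz (c * a)
      exact ⟨x, hxS, hxF, by rw [hx, mul_smul]⟩

/-- The first layer generates the group. -/
theorem closure_layer_one : Subgroup.closure (layer (G := G) 1 : Set G) = ⊤ := by
  -- Descending induction on the filtration: dividing by a generated element with the same leading
  -- component moves the remainder one step deeper, until it vanishes.
  have key : ∀ n j, 1 ≤ j → step G + 1 = j + n →
      Fil G j ⊆ Subgroup.closure (layer (G := G) 1 : Set G) := by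
    intro n
    induction n with
    | zero =>
      intro j _ hjn x hx
      have : x = 0 := ext_proj fun k => by
        rw [map_zero]
        rcases lt_or_ge k j with h | h
        · exact hx k h
        · exact proj_eq_zero_of_step_lt (by omega) x
      rw [this, ← one_eq_zero]
      exact one_mem _
    | succ n ih =>
      intro j hj hjn y hy
      obtain ⟨i, rfl⟩ : ∃ i, j = i + 1 := ⟨j - 1, by omega⟩
      obtain ⟨x, hxS, hxF, hx⟩ := exists_mem_closure_proj_eq i _ (proj_mem (i + 1) y)
      have hz : x⁻¹ * y ∈ Fil G (i + 1 + 1) := by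
        have hadd : ∀ k < i + 1 + 1, proj G k (x⁻¹ * y) = -proj G k x + proj G k y := by
          intro k hk
          rw [proj_mul_of_lt (inv_mem_fil hxF) hy (by omega), inv_eq_neg,
            map_neg]
        intro k hk
        rw [hadd k hk]
        rcases Nat.lt_succ_iff_lt_or_eq.1 hk with h | rfl
        · rw [hxF k h, hy k h]; simp
        · rw [hx]; simp
      have := mul_mem hxS (ih (i + 1 + 1) (by omega) (by omega) hz)
      simpa using this
  rw [eq_top_iff]
  exact fun x _ => key (step G) 1 le_rfl (by omega) (fil_one x)

variable (G) in
/-- The horizontal vectors of norm at most `R`. -/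
def horizBall (R : ℝ) : Set G := {v | v ∈ layer (G := G) 1 ∧ ‖v‖ ≤ R}

theorem isCompact_horizBall (R : ℝ) : IsCompact (horizBall G R) := by
  have : horizBall G R = (layer (G := G) 1 : Set G) ∩ Metric.closedBall 0 R := by
    ext v; simp [horizBall]
  rw [this]
  exact (isCompact_closedBall 0 R).inter_left (Submodule.closed_of_finiteDimensional _)

theorem horizBall_mono {R R' : ℝ} (h : R ≤ R') : horizBall G R ⊆ horizBall G R' :=
  fun _ hv => ⟨hv.1, hv.2.trans h⟩

theorem one_mem_horizBall {R : ℝ} (h : 0 ≤ R) : (1 : G) ∈ horizBall G R := by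
  rw [one_eq_zero]
  exact ⟨Submodule.zero_mem _, by simpa using h⟩

open scoped Pointwise

theorem inv_mem_horizBall_pow {R : ℝ} {n : ℕ} {x : G} (hx : x ∈ horizBall G R ^ n) :
    x⁻¹ ∈ horizBall G R ^ n := by
  have hinv : (horizBall G R)⁻¹ = horizBall G R := by
    ext v
    simp [horizBall, inv_eq_neg]
  have : x⁻¹ ∈ (horizBall G R ^ n)⁻¹ := by simpa using hx
  rwa [← inv_pow, hinv] at this

theorem dil_mem_horizBall_pow {R r : ℝ} (hr : 0 < r) {n : ℕ} {x : G}
    (hx : x ∈ horizBall G R ^ n) : dil r x ∈ horizBall G (r * R) ^ n := by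
  induction n generalizing x with
  | zero =>
    rw [pow_zero, Set.mem_one] at hx ⊢
    rw [hx, one_eq_zero, dil_zero_right]
  | succ n ih =>
    rw [pow_succ] at hx ⊢
    obtain ⟨a, ha, v, hv, rfl⟩ := hx
    simp only
    rw [dil_mul hr]
    refine Set.mul_mem_mul (ih ha) ?_
    rw [dil_of_mem hv.1, pow_one]
    refine ⟨Submodule.smul_mem _ _ hv.1, ?_⟩
    rw [norm_smul, Real.norm_of_nonneg hr.le]
    exact mul_le_mul_of_nonneg_left hv.2 hr.le

/-- Quantitative connectivity by horizontal segments. -/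
theorem exists_mem_horizBall_pow (d : HomogeneousDist G) : ∃ (N : ℕ) (C : ℝ), 0 < C ∧
    ∀ r > 0, ∀ z : G, d.hnorm z ≤ r → z ∈ horizBall G (C * r) ^ N := by
  -- Baire's theorem makes generation quantitative: countably many compact sets cover the group, so
  -- one of them has interior points.
  have hunion : ⋃ n : ℕ, horizBall G n ^ n = univ := by
    refine eq_univ_of_forall fun x => ?_
    have hmono : ∀ {n m : ℕ}, n ≤ m → horizBall G n ^ n ⊆ horizBall G m ^ m := by
      intro n m h
      exact (Set.pow_subset_pow_left (horizBall_mono (by exact_mod_cast h))).trans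
        (Set.pow_subset_pow_right (one_mem_horizBall (by positivity)) h)
    have hx : x ∈ Subgroup.closure (layer (G := G) 1 : Set G) := by
      rw [closure_layer_one]; trivial
    induction hx using Subgroup.closure_induction with
    | mem v hv =>
      obtain ⟨n, hn⟩ := exists_nat_ge ‖v‖
      refine mem_iUnion.2 ⟨n + 1, ?_⟩
      have : v ∈ horizBall G ((n + 1 : ℕ) : ℝ) ^ 1 := by
        rw [pow_one]
        exact ⟨hv, hn.trans (by push_cast; linarith)⟩
      exact Set.pow_subset_pow_right (one_mem_horizBall (by positivity)) (by omega) this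
    | one => exact mem_iUnion.2 ⟨0, by simp⟩
    | mul a b _ _ ha hb =>
      obtain ⟨n, hn⟩ := mem_iUnion.1 ha
      obtain ⟨m, hm⟩ := mem_iUnion.1 hb
      refine mem_iUnion.2 ⟨n + m, ?_⟩
      rw [pow_add]
      exact Set.mul_mem_mul
        (Set.pow_subset_pow_left (horizBall_mono (by push_cast; linarith)) hn)
        (Set.pow_subset_pow_left (horizBall_mono (by push_cast; linarith)) hm)
    | inv a _ ha =>
      obtain ⟨n, hn⟩ := mem_iUnion.1 ha
      exact mem_iUnion.2 ⟨n, inv_mem_horizBall_pow hn⟩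
  have hcomp : ∀ (R : ℝ) (n : ℕ), IsCompact (horizBall G R ^ n) := by
    intro R n
    induction n with
    | zero => rw [pow_zero]; exact isCompact_singleton
    | succ n ih => rw [pow_succ]; exact ih.mul (isCompact_horizBall R)
  obtain ⟨n, u, hu⟩ := nonempty_interior_of_iUnion_of_closed
    (fun n : ℕ => (hcomp n n).isClosed) hunion
  have hnhds : (fun z => u * z) ⁻¹' interior (horizBall G n ^ n) ∈ 𝓝 (0 : G) :=
    (continuous_const_mul u).continuousAt.preimage_mem_nhds
      (by rw [mul_zero']; exact isOpen_interior.mem_nhds hu)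
  obtain ⟨ε, hε, h⟩ := d.exists_hnorm_lt_subset hnhds
  -- The interior is translated to the origin by `u⁻¹`, which doubles the number of factors;
  -- dilation by `2 r / ε` then reaches every radius. The `+ 1` only makes the constant positive.
  refine ⟨n + n, 2 / ε * (n + 1), by positivity, fun r hr z hz => ?_⟩
  have hsmall : dil (ε / (2 * r)) z ∈ horizBall G n ^ (n + n) := by
    have := interior_subset (h (dil (ε / (2 * r)) z) (by
      rw [d.hnorm_dil (by positivity)]
      calc ε / (2 * r) * d.hnorm z ≤ ε / (2 * r) * r := by gcongr
        _ = ε / 2 := by field_simp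
        _ < ε := by linarith))
    rw [pow_add]
    have h2 := Set.mul_mem_mul (inv_mem_horizBall_pow (interior_subset hu)) this
    simpa using h2
  have := dil_mem_horizBall_pow (r := (ε / (2 * r))⁻¹) (by positivity) hsmall
  rw [dil_inv_dil (by positivity)] at this
  refine Set.pow_subset_pow_left (horizBall_mono ?_) this
  rw [inv_div]
  calc 2 * r / ε * n ≤ 2 * r / ε * (n + 1) := by gcongr; linarith
    _ = 2 / ε * (n + 1) * r := by ring

end StratifiedGroup

/-! ### Convolution with kernels -/

section Convolution

open StratifiedGroup
open scoped Pointwise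

variable {G : Type*} [NormedAddCommGroup G] [InnerProductSpace ℝ G] [FiniteDimensional ℝ G]
  [StratifiedGroup G] [MeasurableSpace G] [BorelSpace G]
  {E : Type*} [NormedAddCommGroup E] [NormedSpace ℝ E]

/-- The convolution `x ↦ ∫ k(x y⁻¹) u(y) dμ(y)`. -/
def lconv (k : G → ℝ) (u : G → E) (μ : Measure G) (x : G) : E := ∫ y, k (x * y⁻¹) • u y ∂μ

/-- A continuous, compactly supported, nonnegative kernel of integral one. -/
structure IsKernel (k : G → ℝ) : Prop where
  continuous : Continuous k
  hasCompactSupport : HasCompactSupport k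
  nonneg : ∀ x, 0 ≤ k x
  integral_eq_one : ∫ x, k x = 1

/-- The substitution `z = x y⁻¹` combines an inversion with a left translation, both of which
preserve the volume. -/
theorem integral_mul_inv_eq (f : G → G → E) (x : G) :
    ∫ y, f (x * y⁻¹) y = ∫ z, f z (z⁻¹ * x) := by
  rw [← integral_mul_left_eq_self (fun z => f z (z⁻¹ * x)) x,
    ← integral_inv_eq_self (fun y => f (x * y) ((x * y)⁻¹ * x))]
  congr 1 with y
  simp

theorem lconv_eq (k : G → ℝ) (u : G → E) (x : G) :
    lconv k u volume x = ∫ z, k z • u (z⁻¹ * x) :=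
  integral_mul_inv_eq (fun z y => k z • u y) x

theorem continuous_lconv {k : G → ℝ} (hk : Continuous k) (hks : HasCompactSupport k) {u : G → E}
    {μ : Measure G} (hu : LocallyIntegrable u μ) : Continuous (lconv k u μ) := by
  rw [← continuousOn_univ]
  refine isOpen_univ.continuousOn_iff.2 fun {x} _ => ?_
  obtain ⟨V, hV, hxV⟩ := exists_compact_mem_nhds x
  have hK : IsCompact ((tsupport k)⁻¹ * V) := hks.isCompact.inv.mul hV
  have := continuousOn_integral_bilinear_of_locally_integrable_of_compact_support (μ := μ) (s := V)
    (k := (tsupport k)⁻¹ * V) (f := fun x y => k (x * y⁻¹)) (g := u)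
    (ContinuousLinearMap.lsmul ℝ ℝ : ℝ →L[ℝ] E →L[ℝ] E).flip hK
    (by
      refine Continuous.continuousOn ?_
      exact hk.comp (by fun_prop))
    (fun p y hp hy => by
      by_contra h
      refine hy ⟨(p * y⁻¹)⁻¹, ?_, p, hp, by simp⟩
      exact Set.inv_mem_inv.2 (subset_tsupport k h))
    (hu.integrableOn_isCompact hK)
  exact this.continuousAt hxV

omit [BorelSpace G] in
theorem tsupport_lconv_subset {k : G → ℝ} (hks : HasCompactSupport k) {u : G → E}
    (hu : HasCompactSupport u) (μ : Measure G) :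
    tsupport (lconv k u μ) ⊆ tsupport k * tsupport u := by
  refine closure_minimal (fun x hx => ?_) (hks.isCompact.mul hu.isCompact).isClosed
  by_contra h
  refine hx ?_
  refine integral_eq_zero_of_ae (Eventually.of_forall fun y => ?_)
  by_contra h2
  have h2 : k (x * y⁻¹) • u y ≠ 0 := h2
  refine h ⟨x * y⁻¹, subset_tsupport k ?_, y, subset_tsupport u ?_, by simp⟩
  · exact (smul_ne_zero_iff.1 h2).1
  · exact (smul_ne_zero_iff.1 h2).2

omit [BorelSpace G] in
theorem hasCompactSupport_lconv {k : G → ℝ} (hks : HasCompactSupport k) {u : G → E}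
    (hu : HasCompactSupport u) (μ : Measure G) : HasCompactSupport (lconv k u μ) :=
  (hks.isCompact.mul hu.isCompact).of_isClosed_subset (isClosed_tsupport _)
    (tsupport_lconv_subset hks hu μ)

theorem contDiff_lconv {k : G → ℝ} (hk : ContDiff ℝ ∞ k) (hks : HasCompactSupport k) {u : G → ℝ}
    (hu : LocallyIntegrable u volume) : ContDiff ℝ ∞ (lconv k u volume) := by
  rw [contDiff_iff_contDiffAt]
  intro x
  have hK : IsCompact ((Metric.closedBall x 1)⁻¹ * tsupport k) :=
    (isCompact_closedBall x 1).inv.mul hks.isCompact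
  have hg : ContDiff ℝ ∞ (fun p : G × G => k (p.1 * p.2)) :=
    hk.comp (contDiff_mul.of_le le_top)
  -- Since inversion is negation, `k (p * y⁻¹)` is `k (p * (0 - y))`: an additive convolution
  -- evaluated at `0` whose kernel depends smoothly on the parameter `p`.
  have := contDiffOn_convolution_right_with_param_comp (μ := (volume : Measure G)) (n := ⊤)
    (ContinuousLinearMap.lsmul ℝ ℝ).flip (s := Metric.ball x 1) (v := fun _ : G => (0 : G))
    contDiffOn_const (f := u) (g := fun p w => k (p * w)) Metric.isOpen_ball hK
    (fun p w hp hw => by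
      by_contra h
      refine hw ⟨p⁻¹, Set.inv_mem_inv.2 (Metric.ball_subset_closedBall hp), p * w,
        subset_tsupport k h, by simp⟩)
    hu hg.contDiffOn
  refine (this.contDiffAt (Metric.ball_mem_nhds x one_pos)).congr_of_eventuallyEq
    (Eventually.of_forall fun p => ?_)
  simp only [lconv, convolution, zero_sub, inv_eq_neg]
  rfl

namespace IsKernel

variable {k : G → ℝ} (hk : IsKernel k)

include hk

omit [StratifiedGroup G] in
theorem integrable : Integrable k volume :=
  hk.continuous.integrable_of_hasCompactSupport hk.hasCompactSupport

theorem integral_mul_inv (x : G) : ∫ y, k (x * y⁻¹) = 1 := by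
  rw [integral_mul_inv_eq (fun z _ => k z) x, hk.integral_eq_one]

theorem integrable_mul_inv (x : G) : Integrable (fun y => k (x * y⁻¹)) volume := by
  refine (hk.continuous.comp (by fun_prop)).integrable_of_hasCompactSupport ?_
  refine HasCompactSupport.intro (K := (tsupport k)⁻¹ * {x})
    (hk.hasCompactSupport.isCompact.inv.mul isCompact_singleton) fun y hy => ?_
  by_contra h
  exact hy ⟨(x * y⁻¹)⁻¹, Set.inv_mem_inv.2 (subset_tsupport k h), x, rfl, by simp⟩

theorem norm_lconv_le {u : G → E} {M : ℝ} (hu : ∀ᵐ y, ‖u y‖ ≤ M) (x : G) :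
    ‖lconv k u volume x‖ ≤ M := by
  calc ‖lconv k u volume x‖ ≤ ∫ y, k (x * y⁻¹) * M := by
        refine norm_integral_le_of_norm_le ((hk.integrable_mul_inv x).mul_const M) ?_
        filter_upwards [hu] with y hy
        rw [norm_smul, Real.norm_of_nonneg (hk.nonneg _)]
        exact mul_le_mul_of_nonneg_left hy (hk.nonneg _)
    _ = M := by rw [integral_mul_const, hk.integral_mul_inv, one_mul]

theorem norm_lconv_sub_le [CompleteSpace E] {u : G → E} (hu : LocallyIntegrable u volume) {x : G}
    {c : E} {M : ℝ}
    (hM : ∀ z ∈ Function.support k, ‖u (z⁻¹ * x) - c‖ ≤ M) :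
    ‖lconv k u volume x - c‖ ≤ M := by
  have hi : Integrable (fun y => k (x * y⁻¹) • u y) volume := by
    have hK : IsCompact ((tsupport k)⁻¹ * {x}) :=
      hk.hasCompactSupport.isCompact.inv.mul isCompact_singleton
    have h1 : IntegrableOn (fun y => k (x * y⁻¹) • u y) ((tsupport k)⁻¹ * {x}) volume :=
      (hu.integrableOn_isCompact hK).continuousOn_smul
        (hk.continuous.comp (by fun_prop)).continuousOn hK
    refine (integrableOn_iff_integrable_of_support_subset fun y hy => ?_).1 h1
    have : k (x * y⁻¹) ≠ 0 := (smul_ne_zero_iff.1 hy).1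
    exact ⟨(x * y⁻¹)⁻¹, Set.inv_mem_inv.2 (subset_tsupport k this), x, rfl, by simp⟩
  have : lconv k u volume x - c = ∫ y, k (x * y⁻¹) • (u y - c) := by
    simp_rw [smul_sub]
    rw [integral_sub hi ((hk.integrable_mul_inv x).smul_const c), integral_smul_const,
      hk.integral_mul_inv, one_smul]
    rfl
  rw [this]
  calc ‖∫ y, k (x * y⁻¹) • (u y - c)‖ ≤ ∫ y, k (x * y⁻¹) * M := by
        refine norm_integral_le_of_norm_le ((hk.integrable_mul_inv x).mul_const M) ?_
        filter_upwards with y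
        rw [norm_smul, Real.norm_of_nonneg (hk.nonneg _)]
        by_cases h : k (x * y⁻¹) = 0
        · rw [h]; simp
        · have := hM _ h
          simp only [mul_inv_rev, inv_inv, inv_mul_cancel_right] at this
          exact mul_le_mul_of_nonneg_left this (hk.nonneg _)
    _ = M := by rw [integral_mul_const, hk.integral_mul_inv, one_mul]

end IsKernel

omit [MeasurableSpace G] [BorelSpace G] [NormedSpace ℝ E] in
/-- Compactly supported continuous functions are uniformly continuous for left translations. -/
theorem eventually_norm_translate_sub_le {u : G → E} (hu : Continuous u)
    (hus : HasCompactSupport u) {ε : ℝ} (hε : 0 < ε) :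
    ∀ᶠ z in 𝓝 (0 : G), ∀ x, ‖u (z⁻¹ * x) - u x‖ ≤ ε := by
  obtain ⟨V, hV, h0V⟩ := exists_compact_mem_nhds (0 : G)
  have hK : IsCompact (V * tsupport u) := hV.mul hus.isCompact
  have h1 : ∀ᶠ z in 𝓝 (0 : G), ∀ x ∈ V * tsupport u, ‖u (z⁻¹ * x) - u x‖ ≤ ε := by
    refine hK.eventually_forall_of_forall_eventually fun x _ => ?_
    have hc : Continuous fun p : G × G => ‖u (p.1⁻¹ * p.2) - u p.2‖ := by fun_prop
    have h2 := hc.tendsto (0, x)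
    simp only [inv_zero', zero_mul', sub_self, norm_zero] at h2
    exact (h2.eventually_lt_const hε).mono fun p hp => hp.le
  filter_upwards [h1, h0V] with z hz hzV x
  by_cases hx : x ∈ V * tsupport u
  · exact hz x hx
  · have e1 : u x = 0 := by
      by_contra h
      exact hx ⟨0, mem_of_mem_nhds h0V, x, subset_tsupport u h, zero_mul' x⟩
    have e2 : u (z⁻¹ * x) = 0 := by
      by_contra h
      exact hx ⟨z, hzV, z⁻¹ * x, subset_tsupport u h, by simp⟩
    rw [e1, e2, sub_zero, norm_zero]
    exact hε.le

omit [StratifiedGroup G] in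
/-- Smooth kernels with small support. -/
theorem exists_smooth_kernel (n : ℕ) : ∃ k : G → ℝ, IsKernel k ∧ ContDiff ℝ ∞ k ∧
    tsupport k ⊆ Metric.closedBall 0 (1 / ((n : ℝ) + 1)) := by
  let f : ContDiffBump (0 : G) :=
    ⟨1 / ((n : ℝ) + 1) / 2, 1 / ((n : ℝ) + 1), by positivity, by
      have : (0 : ℝ) < 1 / ((n : ℝ) + 1) := by positivity
      linarith⟩
  refine ⟨f.normed volume, ⟨f.continuous_normed, f.hasCompactSupport_normed, f.nonneg_normed,
    f.integral_normed⟩, f.contDiff_normed, ?_⟩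
  rw [f.tsupport_normed_eq]

/-! ### Derivatives along horizontal curves -/

/-- `a` is the derivative of `u` at `x` along the left invariant field of `v`. -/
def HasHDerivAt (v : G) (u : G → ℝ) (a : ℝ) (x : G) : Prop :=
  HasDerivAt (fun t : ℝ => u (x * (t • v))) a 0

-- Along a one-parameter subgroup, the derivative at time `s` is the derivative at time `0` from the
-- point reached at time `s`.
omit [MeasurableSpace G] [BorelSpace G] in
theorem HasHDerivAt.hasDerivAt {v : G} {u : G → ℝ} {a : ℝ} {x : G} {s : ℝ}
    (h : HasHDerivAt v u a (x * (s • v))) : HasDerivAt (fun t : ℝ => u (x * (t • v))) a s := by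
  have h1 : HasDerivAt (fun t : ℝ => u (x * (s • v) * (t • v))) a (s - s) := by
    rw [sub_self]; exact h
  have h2 := HasDerivAt.comp (h := fun t : ℝ => t - s) s h1 ((hasDerivAt_id s).sub_const s)
  rw [mul_one] at h2
  refine h2.congr_of_eventuallyEq (Eventually.of_forall fun t => ?_)
  simp only [Function.comp]
  rw [mul_assoc, StratifiedGroup.smul_mul_smul, add_sub_cancel]

omit [MeasurableSpace G] [BorelSpace G] in
theorem hasHDerivAt_of_differentiable {u : G → ℝ} (hu : Differentiable ℝ u) (v x : G) :
    HasHDerivAt v u (fderiv ℝ u x (leftInvField v x)) x := by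
  have h1 : HasFDerivAt (fun q : G => x * q) (fderiv ℝ (fun q : G => x * q) 0) ((0 : ℝ) • v) := by
    rw [zero_smul]
    exact ((contDiff_mul_left x).differentiable (by simp) 0).hasFDerivAt
  have h2 : HasDerivAt (fun t : ℝ => t • v) v 0 := by
    simpa using (hasDerivAt_id (0 : ℝ)).smul_const v
  have h3 : HasDerivAt (fun t : ℝ => x * (t • v)) (leftInvField v x) 0 := h1.comp_hasDerivAt 0 h2
  have h4 : HasFDerivAt u (fderiv ℝ u x) (x * ((0 : ℝ) • v)) := by
    rw [zero_smul, mul_zero']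
    exact (hu x).hasFDerivAt
  exact h4.comp_hasDerivAt 0 h3

omit [MeasurableSpace G] [BorelSpace G] in
theorem HasHDerivAt.eq_zero_of_notMem_tsupport {v : G} {u : G → ℝ} {a : ℝ} {x : G}
    (h : HasHDerivAt v u a x) (hx : x ∉ tsupport u) : a = 0 := by
  have h1 : ∀ᶠ t : ℝ in 𝓝 0, u (x * (t • v)) = 0 := by
    have hc : Continuous fun t : ℝ => x * (t • v) := by fun_prop
    have := hc.tendsto 0
    rw [zero_smul, mul_zero'] at this
    filter_upwards [this ((isClosed_tsupport u).isOpen_compl.mem_nhds hx)] with t ht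
    exact image_eq_zero_of_notMem_tsupport ht
  exact (h.unique ((hasDerivAt_const (0 : ℝ) (0 : ℝ)).congr_of_eventuallyEq h1))

omit [MeasurableSpace G] [BorelSpace G] in
theorem hasCompactSupport_of_hasHDerivAt {v : G} {u u' : G → ℝ} (hus : HasCompactSupport u)
    (h : ∀ x, HasHDerivAt v u (u' x) x) : HasCompactSupport u' ∧ tsupport u' ⊆ tsupport u := by
  have : tsupport u' ⊆ tsupport u := closure_minimal (fun x hx => by
    by_contra hx2
    exact hx ((h x).eq_zero_of_notMem_tsupport hx2)) (isClosed_tsupport u)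
  exact ⟨hus.isCompact.of_isClosed_subset (isClosed_tsupport _) this, this⟩

/-- Written as `∫ k(z) u(z⁻¹ x) dz`, the convolution averages left translates of `u`, and these
commute with left invariant derivatives. So the derivative falls on `u`, and `u` need not be smooth.
-/
theorem hasHDerivAt_lconv {k : G → ℝ} (hk : Continuous k) (hks : HasCompactSupport k) {v : G}
    {u u' : G → ℝ} (hu : Continuous u) (hus : HasCompactSupport u) (hu' : Continuous u')
    (h : ∀ x, HasHDerivAt v u (u' x) x) (x : G) :
    HasHDerivAt v (lconv k u volume) (lconv k u' volume x) x := by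
  obtain ⟨M, hM⟩ := (hasCompactSupport_of_hasHDerivAt hus h).1.exists_bound_of_continuous hu'
  have hki : Integrable k volume := hk.integrable_of_hasCompactSupport hks
  have key := (hasDerivAt_integral_of_dominated_loc_of_deriv_le (μ := (volume : Measure G))
    (F := fun (t : ℝ) z => k z * u (z⁻¹ * (x * (t • v))))
    (F' := fun (t : ℝ) z => k z * u' (z⁻¹ * (x * (t • v)))) (x₀ := (0 : ℝ)) (s := univ)
    (bound := fun z => ‖k z‖ * M) univ_mem
    (Eventually.of_forall fun t => (by fun_prop : Continuous _).aestronglyMeasurable)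
    ((by fun_prop : Continuous _).integrable_of_hasCompactSupport hks.mul_right)
    (by fun_prop : Continuous _).aestronglyMeasurable
    (Eventually.of_forall fun z t _ => by
      rw [norm_mul]; exact mul_le_mul_of_nonneg_left (hM _) (norm_nonneg _))
    (hki.norm.mul_const M)
    (Eventually.of_forall fun z t _ => by
      refine HasDerivAt.const_mul _ ?_
      have := (h (z⁻¹ * x * (t • v))).hasDerivAt
      simpa only [mul_assoc] using this)).2
  rw [HasHDerivAt]
  have e1 : (fun t : ℝ => lconv k u volume (x * (t • v))) =
      fun t : ℝ => ∫ z, k z * u (z⁻¹ * (x * (t • v))) := funext fun t => lconv_eq k u _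
  have e2 : lconv k u' volume x = ∫ z, k z * u' (z⁻¹ * (x * ((0 : ℝ) • v))) := by
    rw [lconv_eq, zero_smul, mul_zero']; rfl
  rw [e1, e2]
  exact key

/-- Smooth approximation of a compactly supported function, together with those of its horizontal
derivatives that exist and are continuous. -/
theorem exists_smooth_approx {Ω : Set G} (hΩ : IsOpen Ω) {u : G → ℝ} (hu : IsCc Ω u) :
    ∃ w : ℕ → G → ℝ, ∃ K ⊆ Ω, IsCompact K ∧ (∀ᶠ n in atTop, IsCcInf Ω (w n)) ∧
      (∀ᶠ n in atTop, tsupport (w n) ⊆ K) ∧ TendstoUniformly w u atTop ∧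
      ∀ (v : G) (u' : G → ℝ), Continuous u' → (∀ x, HasHDerivAt v u (u' x) x) →
        ∃ w' : ℕ → G → ℝ, (∀ n x, HasHDerivAt v (w n) (w' n x) x) ∧
          TendstoUniformly w' u' atTop := by
  obtain ⟨hc, hs, hsub⟩ := hu
  choose k hk hks hksub using exists_smooth_kernel (G := G)
  have hsmall : ∀ U ∈ 𝓝 (0 : G), ∀ᶠ n in atTop, tsupport (k n) ⊆ U := by
    intro U hU
    obtain ⟨η, hη, hηU⟩ := Metric.nhds_basis_closedBall.mem_iff.1 hU
    have : Tendsto (fun n : ℕ => 1 / ((n : ℝ) + 1)) atTop (𝓝 0) :=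
      tendsto_one_div_add_atTop_nhds_zero_nat
    filter_upwards [this.eventually_le_const hη] with n hn
    exact (hksub n).trans ((Metric.closedBall_subset_closedBall hn).trans hηU)
  have hunif : ∀ f : G → ℝ, Continuous f → HasCompactSupport f →
      TendstoUniformly (fun n => lconv (k n) f volume) f atTop := by
    intro f hf hfs
    rw [Metric.tendstoUniformly_iff]
    intro ε hε
    filter_upwards [hsmall _ (eventually_norm_translate_sub_le hf hfs (half_pos hε))] with n hn x
    rw [dist_comm, dist_eq_norm]
    refine ((hk n).norm_lconv_sub_le hf.locallyIntegrable (M := ε / 2) fun z hz => ?_).trans_lt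
      (by linarith)
    exact hn (subset_tsupport _ hz) x
  obtain ⟨K, hK, hK1, hK2⟩ := exists_compact_between hs.isCompact hΩ hsub
  obtain ⟨V, hV, hVK⟩ := compact_open_separated_mul_left hs.isCompact isOpen_interior hK1
  rw [one_eq_zero] at hV
  have hsupp : ∀ᶠ n in atTop, tsupport (lconv (k n) u volume) ⊆ K := by
    filter_upwards [hsmall V hV] with n hn
    exact (tsupport_lconv_subset (hk n).hasCompactSupport hs volume).trans
      ((Set.mul_subset_mul_right hn).trans (hVK.trans interior_subset))
  refine ⟨fun n => lconv (k n) u volume, K, hK2, hK, ?_, hsupp, hunif u hc hs, ?_⟩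
  · filter_upwards [hsupp] with n hn
    exact ⟨contDiff_lconv (hks n) (hk n).hasCompactSupport hc.locallyIntegrable,
      hasCompactSupport_lconv (hk n).hasCompactSupport hs volume, hn.trans hK2⟩
  · intro v u' hu' hd
    exact ⟨fun n => lconv (k n) u' volume,
      fun n x => hasHDerivAt_lconv (hk n).continuous (hk n).hasCompactSupport hc hs hu' hd x,
      hunif u' hu' (hasCompactSupport_of_hasHDerivAt hs hd).1⟩

end Convolution

/-! ### Test functions with continuous horizontal derivatives -/

section TestFunctions

open StratifiedGroup

variable {G : Type*} [NormedAddCommGroup G] [InnerProductSpace ℝ G] [FiniteDimensional ℝ G]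
  [StratifiedGroup G]

theorem HasHDerivAt.frameDeriv_eq {i : Fin (Module.finrank ℝ (Horiz G))} {u : G → ℝ} {a : ℝ} {x : G}
    (h : HasHDerivAt (frame G i : G) u a x) : frameDeriv i u x = a :=
  HasDerivAt.deriv h

theorem horizGrad_eq_of_hasHDerivAt {u : G → ℝ} {w : Horiz G} {x : G}
    (h : ∀ i, HasHDerivAt (frame G i : G) u (inner ℝ w (frame G i)) x) : horizGrad u x = w := by
  rw [horizGrad]
  conv_rhs => rw [← (frame G).sum_repr' w]
  refine Finset.sum_congr rfl fun i _ => ?_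
  rw [(h i).frameDeriv_eq, real_inner_comm]

theorem sum_frameDeriv_mul_inner {u : G → ℝ} (hu : Differentiable ℝ u) (v : Horiz G) (x : G) :
    ∑ i, frameDeriv i u x * inner ℝ (frame G i) v = fderiv ℝ u x (leftInvField (v : G) x) := by
  have : (v : G) = ∑ i, inner ℝ (frame G i) v • (frame G i : G) := by
    conv_lhs => rw [← (frame G).sum_repr' v]
    simp
  rw [leftInvField, this, map_sum, map_sum]
  refine Finset.sum_congr rfl fun i _ => ?_
  rw [(hasHDerivAt_of_differentiable hu (frame G i : G) x).frameDeriv_eq, map_smul, map_smul,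
    leftInvField, smul_eq_mul, mul_comm]

theorem inner_horizGrad {u : G → ℝ} (hu : Differentiable ℝ u) (v : Horiz G) (x : G) :
    inner ℝ (horizGrad u x) v = fderiv ℝ u x (leftInvField (v : G) x) := by
  rw [← sum_frameDeriv_mul_inner hu, horizGrad, sum_inner]
  simp_rw [real_inner_smul_left]

theorem horizDiv_smul_const {u : G → ℝ} (hu : Differentiable ℝ u) (v : Horiz G) (x : G) :
    horizDiv (fun y => u y • v) x = fderiv ℝ u x (leftInvField (v : G) x) := by
  rw [← sum_frameDeriv_mul_inner hu, horizDiv]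
  refine Finset.sum_congr rfl fun i _ => ?_
  have h := hasHDerivAt_of_differentiable hu (frame G i : G) x
  rw [h.frameDeriv_eq]
  refine HasHDerivAt.frameDeriv_eq ?_
  rw [HasHDerivAt]
  simp_rw [real_inner_smul_left]
  rw [real_inner_comm]
  exact HasDerivAt.mul_const h _

theorem continuous_fderiv_leftInvField {u : G → ℝ} (hu : ContDiff ℝ 1 u) (v : G) :
    Continuous fun x => fderiv ℝ u x (leftInvField v x) := by
  have h2 : ContDiff ℝ 0 fun x : G => fderiv ℝ (fun q : G => x * q) 0 :=
    ContDiff.fderiv (m := 1) (StratifiedGroup.contDiff_mul.of_le le_top) contDiff_const (by simp)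
  exact (hu.continuous_fderiv one_ne_zero).clm_apply (h2.continuous.clm_apply continuous_const)

variable [MeasurableSpace G] [BorelSpace G]

omit [StratifiedGroup G] in
theorem MeasureTheory.MemLp.integrableOn_isCompact_of_top {E : Type*} [NormedAddCommGroup E]
    {f : G → E} {Ω K : Set G} (hf : MemLp f ∞ (volume.restrict Ω)) (hK : IsCompact K) :
    IntegrableOn f K (volume.restrict Ω) := by
  have : IsFiniteMeasure ((volume.restrict Ω).restrict K) :=
    ⟨by
      rw [Measure.restrict_apply_univ]
      exact (Measure.restrict_apply_le _ _).trans_lt hK.measure_lt_top⟩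
  exact (hf.restrict K).integrable le_top

/-- Dominated convergence: the supports stay in `K`, and `M + 1` bounds `|w n|` once the uniform
distance to `u` is below `1`. -/
theorem tendsto_integral_mul_of_tendstoUniformly {X : Type*} [TopologicalSpace X]
    [MeasurableSpace X] [BorelSpace X] {μ : Measure X} {w : ℕ → X → ℝ} {u f : X → ℝ}
    {K : Set X} (hKm : MeasurableSet K) (hw : ∀ᶠ n in atTop, Continuous (w n))
    (hK : ∀ᶠ n in atTop, tsupport (w n) ⊆ K) (hu : TendstoUniformly w u atTop) {M : ℝ}
    (hM : ∀ x, |u x| ≤ M) (hf : AEStronglyMeasurable f μ) (hfK : IntegrableOn f K μ) :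
    Tendsto (fun n => ∫ x, w n x * f x ∂μ) atTop (𝓝 (∫ x, u x * f x ∂μ)) := by
  refine tendsto_integral_filter_of_dominated_convergence
    (K.indicator fun x => (M + 1) * ‖f x‖) ?_ ?_ ?_ ?_
  · filter_upwards [hw] with n hn
    exact hn.measurable.aestronglyMeasurable.mul hf
  · filter_upwards [hK, Metric.tendstoUniformly_iff.1 hu 1 one_pos] with n h1 h2
    refine Eventually.of_forall fun x => ?_
    by_cases hx : x ∈ K
    · rw [indicator_of_mem hx, norm_mul]
      refine mul_le_mul_of_nonneg_right ?_ (norm_nonneg _)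
      have h3 := h2 x
      rw [dist_comm, Real.dist_eq] at h3
      have h4 := abs_add_le (w n x - u x) (u x)
      rw [sub_add_cancel] at h4
      rw [Real.norm_eq_abs]
      linarith [hM x]
    · rw [indicator_of_notMem hx, image_eq_zero_of_notMem_tsupport fun h => hx (h1 h)]
      simp
  · exact (integrable_indicator_iff hKm).2 (hfK.norm.const_mul (M + 1))
  · exact Eventually.of_forall fun x => (hu.tendsto_at x).mul_const _

/-- The integration by parts formula of the horizontal gradient measure extends to test functions
that are merely continuous with a continuous derivative in the direction considered. -/
theorem IsPolarGrad.integral_mul_hDeriv {Ω : Set G} (hΩ : IsOpen Ω) {g : G → ℝ}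
    (hg : MemLp g ∞ (volume.restrict Ω)) {σ : G → Horiz G} {Λ : Measure G}
    (h : IsPolarGrad Ω g σ Λ) {v : Horiz G} {u u' : G → ℝ} (hu : IsCc Ω u) (hu' : Continuous u')
    (hd : ∀ x, HasHDerivAt (v : G) u (u' x) x) :
    ∫ x in Ω, u' x * g x = - ∫ x, u x * inner ℝ v (σ x) ∂Λ := by
  have := h.finite
  -- The formula holds for smooth approximations `w n`; these and their derivatives along `v`
  -- converge uniformly with supports in `K`, so both sides pass to the limit.
  obtain ⟨w, K, hKΩ, hK, hw, hwK, hwu, hder⟩ := exists_smooth_approx hΩ hu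
  obtain ⟨w', hw', hwu'⟩ := hder v u' hu' hd
  obtain ⟨M, hM⟩ := hu.2.1.exists_bound_of_continuous hu.1
  obtain ⟨M', hM'⟩ := (hasCompactSupport_of_hasHDerivAt hu.2.1 hd).1.exists_bound_of_continuous hu'
  have hw'eq : ∀ᶠ n in atTop, w' n = fun x => fderiv ℝ (w n) x (leftInvField (v : G) x) := by
    filter_upwards [hw] with n hn
    funext x
    exact (hw' n x).unique (hasHDerivAt_of_differentiable (hn.1.differentiable (by simp)) _ _)
  have hw'c : ∀ᶠ n in atTop, Continuous (w' n) := by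
    filter_upwards [hw, hw'eq] with n hn hn'
    rw [hn']
    exact continuous_fderiv_leftInvField (hn.1.of_le (by norm_cast)) v
  have hw'K : ∀ᶠ n in atTop, tsupport (w' n) ⊆ K := by
    filter_upwards [hw, hwK] with n hn hn'
    exact (hasCompactSupport_of_hasHDerivAt hn.2.1 (hw' n)).2.trans hn'
  have hgK := hg.integrableOn_isCompact_of_top hK
  have t1 := tendsto_integral_mul_of_tendstoUniformly hK.measurableSet hw'c hw'K hwu' hM' hg.1 hgK
  have hσm : Measurable fun x => (inner ℝ v (σ x) : ℝ) := measurable_const.inner h.measurable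
  have hσi : Integrable (fun x => (inner ℝ v (σ x) : ℝ)) Λ := by
    refine Integrable.of_bound hσm.aestronglyMeasurable ‖v‖ ?_
    filter_upwards [h.norm_eq_one] with x hx
    simpa [hx] using norm_inner_le_norm (𝕜 := ℝ) v (σ x)
  have t2 := tendsto_integral_mul_of_tendstoUniformly (μ := Λ) hK.measurableSet
    (hw.mono fun n hn => hn.1.continuous) hwK hwu hM hσm.aestronglyMeasurable hσi.integrableOn
  refine tendsto_nhds_unique t1 (t2.neg.congr' ?_)
  filter_upwards [hw, hw'eq] with n hn hn'
  have hC : IsC1cHoriz Ω fun x => w n x • v := by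
    refine ⟨(hn.1.of_le (by norm_cast)).smul contDiff_const, hn.2.1.smul_right, ?_⟩
    exact (closure_mono (Function.support_smul_subset_left _ _)).trans hn.2.2
  have h3 := h.by_parts _ hC
  simp_rw [horizDiv_smul_const (hn.1.differentiable (by simp)), real_inner_smul_left] at h3
  rw [← h3, hn']
  simp_rw [mul_comm]

/-- The distributional divergence can be tested against compactly supported functions whose
derivatives along the horizontal frame are continuous. -/
theorem IsDivergence.integral_eq {Ω : Set G} (hΩ : IsOpen Ω) {F : G → Horiz G}
    (hF : MemLp F ∞ (volume.restrict Ω)) {ν : SignedMeasure G} (h : IsDivergence Ω F ν)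
    {u : G → ℝ} (hu : IsCc Ω u) {Φ : G → Horiz G} (hΦ : Continuous Φ)
    (hd : ∀ i x, HasHDerivAt (frame G i : G) u (inner ℝ (Φ x) (frame G i)) x) :
    ∫ᵛ x, u x ∂<•ν = - ∫ x in Ω, inner ℝ (F x) (Φ x) := by
  obtain ⟨θ, hθm, hθi, hθ⟩ := exists_density_variation ν
  set β := ν.variation
  obtain ⟨w, K₀, -, hK₀, hw, hwK₀, hwu, hder⟩ := exists_smooth_approx hΩ hu
  obtain ⟨K, hK, hK₀K, huK⟩ : ∃ K, IsCompact K ∧ K₀ ⊆ K ∧ tsupport u ⊆ K :=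
    ⟨K₀ ∪ tsupport u, hK₀.union hu.2.1.isCompact, subset_union_left, subset_union_right⟩
  have hwK := hwK₀.mono fun n hn => hn.trans hK₀K
  have hΦc : ∀ i, Continuous fun x => (inner ℝ (Φ x) (frame G i) : ℝ) := fun i => by fun_prop
  choose w' hw' hwu' using fun i => hder (frame G i : G) _ (hΦc i) (hd i)
  -- With the density `θ`, limits against `ν` become limits against the positive finite measure `β`.
  have hβ : ∀ f : G → ℝ, Continuous f → (∃ M, ∀ x, ‖f x‖ ≤ M) →
      ∫ᵛ x, f x ∂<•ν = ∫ x, f x * θ x ∂β := by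
    rintro f hf ⟨M, hM⟩
    rw [hθ]
    exact integral_withDensityᵥ_eq hθi hf.aestronglyMeasurable
      (hθi.bdd_mul hf.aestronglyMeasurable (Eventually.of_forall hM))
  obtain ⟨M, hM⟩ := hu.2.1.exists_bound_of_continuous hu.1
  have t2 := tendsto_integral_mul_of_tendstoUniformly (μ := β) hK.measurableSet
    (hw.mono fun n hn => hn.1.continuous) hwK hwu hM hθi.aestronglyMeasurable hθi.integrableOn
  have hFi : ∀ i, MemLp (fun x => (inner ℝ (F x) (frame G i) : ℝ)) ∞ (volume.restrict Ω) :=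
    fun i => hF.inner_const (frame G i)
  have hFK := fun i => (hFi i).integrableOn_isCompact_of_top hK
  have h_int : ∀ (f : G → ℝ), Continuous f → tsupport f ⊆ K → ∀ i, Integrable
      (fun x => f x * inner ℝ (F x) (frame G i)) (volume.restrict Ω) := by
    intro f hf hfK i
    have hfs : HasCompactSupport f := hK.of_isClosed_subset (isClosed_tsupport _) hfK
    obtain ⟨C, hC⟩ := hfs.exists_bound_of_continuous hf
    have h1 : IntegrableOn (fun x => f x * inner ℝ (F x) (frame G i)) K (volume.restrict Ω) :=
      (hFK i).bdd_mul hf.aestronglyMeasurable (Eventually.of_forall hC)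
    refine (integrableOn_iff_integrable_of_support_subset fun y hy => ?_).1 h1
    exact hfK (subset_tsupport _ (left_ne_zero_of_mul hy))
  have hsum : ∀ Ψ : G → Horiz G, (∀ i, Continuous fun x => (inner ℝ (Ψ x) (frame G i) : ℝ)) →
      (∀ i, tsupport (fun x => (inner ℝ (Ψ x) (frame G i) : ℝ)) ⊆ K) →
      ∫ x in Ω, inner ℝ (F x) (Ψ x) =
        ∑ i, ∫ x in Ω, inner ℝ (Ψ x) (frame G i) * inner ℝ (F x) (frame G i) := by
    intro Ψ hΨ hΨK
    rw [← integral_finsetSum _ fun i _ => h_int _ (hΨ i) (hΨK i) i]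
    congr 1 with x
    rw [← (frame G).sum_inner_mul_inner (F x) (Ψ x)]
    exact Finset.sum_congr rfl fun i _ => by rw [mul_comm, real_inner_comm]
  have hΦK : ∀ i, tsupport (fun x => (inner ℝ (Φ x) (frame G i) : ℝ)) ⊆ tsupport u := fun i =>
    (hasCompactSupport_of_hasHDerivAt hu.2.1 (hd i)).2
  have hgrad : ∀ᶠ n in atTop, ∀ i x,
      w' i n x = inner ℝ (horizGrad (w n) x) (frame G i) := by
    filter_upwards [hw] with n hn i x
    have hdiff := hn.1.differentiable (by simp)
    rw [inner_horizGrad hdiff]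
    exact (hw' i n x).unique (hasHDerivAt_of_differentiable hdiff _ _)
  have hgradc : ∀ᶠ n in atTop, ∀ i, Continuous (w' i n) := by
    filter_upwards [hw, hgrad] with n hn h1 i
    have : w' i n = fun x => fderiv ℝ (w n) x (leftInvField (frame G i : G) x) := by
      funext x
      rw [h1, inner_horizGrad (hn.1.differentiable (by simp))]
    rw [this]
    exact continuous_fderiv_leftInvField (hn.1.of_le (by norm_cast)) _
  have hgradK : ∀ᶠ n in atTop, ∀ i, tsupport (w' i n) ⊆ K := by
    filter_upwards [hw, hwK] with n hn h1 i
    exact (hasCompactSupport_of_hasHDerivAt hn.2.1 (hw' i n)).2.trans h1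
  choose C hC using fun i =>
    (hasCompactSupport_of_hasHDerivAt hu.2.1 (hd i)).1.exists_bound_of_continuous (hΦc i)
  have t1 : ∀ i, Tendsto (fun n => ∫ x in Ω, w' i n x * inner ℝ (F x) (frame G i)) atTop
      (𝓝 (∫ x in Ω, inner ℝ (Φ x) (frame G i) * inner ℝ (F x) (frame G i))) := fun i =>
    tendsto_integral_mul_of_tendstoUniformly hK.measurableSet (hgradc.mono fun n h => h i)
      (hgradK.mono fun n h => h i) (hwu' i) (hC i) (hFi i).1 (hFK i)
  rw [hβ u hu.1 ⟨M, hM⟩, hsum Φ hΦc fun i => (hΦK i).trans huK]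
  refine tendsto_nhds_unique t2 ((tendsto_finsetSum _ fun i _ => t1 i).neg.congr' ?_)
  filter_upwards [hw, hgrad, hgradc, hgradK] with n hn h1 h2 h3
  rw [← hβ (w n) hn.1.continuous (hn.2.1.exists_bound_of_continuous hn.1.continuous), h.2 _ hn]
  have h1' : ∀ i, w' i n = fun x => (inner ℝ (horizGrad (w n) x) (frame G i) : ℝ) :=
    fun i => funext fun x => h1 i x
  rw [hsum (horizGrad (w n)) (fun i => h1' i ▸ h2 i) (fun i => h1' i ▸ h3 i)]
  simp_rw [h1]

end TestFunctions

/-! ### Polar decomposition of the horizontal gradient measure -/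

section Polar

open StratifiedGroup CompactlySupported

variable {G : Type*} [NormedAddCommGroup G] [InnerProductSpace ℝ G] [FiniteDimensional ℝ G]
  [StratifiedGroup G]

theorem contDiff_inner_frame {φ : G → Horiz G} (hφ : ContDiff ℝ 1 φ)
    (i : Fin (Module.finrank ℝ (Horiz G))) :
    ContDiff ℝ 1 fun y => (inner ℝ (φ y) (frame G i) : ℝ) :=
  hφ.inner ℝ contDiff_const

theorem horizDiv_eq {φ : G → Horiz G} (hφ : ContDiff ℝ 1 φ) (x : G) :
    horizDiv φ x = ∑ i, fderiv ℝ (fun y => (inner ℝ (φ y) (frame G i) : ℝ)) x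
      (leftInvField (frame G i : G) x) :=
  Finset.sum_congr rfl fun i _ => (hasHDerivAt_of_differentiable
    ((contDiff_inner_frame hφ i).differentiable one_ne_zero) _ _).frameDeriv_eq

theorem horizDiv_add {φ ψ : G → Horiz G} (hφ : ContDiff ℝ 1 φ) (hψ : ContDiff ℝ 1 ψ) (x : G) :
    horizDiv (fun y => φ y + ψ y) x = horizDiv φ x + horizDiv ψ x := by
  rw [horizDiv_eq hφ, horizDiv_eq hψ, horizDiv_eq (hφ.add hψ), ← Finset.sum_add_distrib]
  refine Finset.sum_congr rfl fun i _ => ?_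
  simp_rw [inner_add_left]
  rw [fderiv_fun_add ((contDiff_inner_frame hφ i).differentiable one_ne_zero x)
    ((contDiff_inner_frame hψ i).differentiable one_ne_zero x)]
  rfl

theorem horizDiv_smul (c : ℝ) {φ : G → Horiz G} (hφ : ContDiff ℝ 1 φ) (x : G) :
    horizDiv (fun y => c • φ y) x = c * horizDiv φ x := by
  rw [horizDiv_eq hφ, horizDiv_eq (hφ.const_smul c), Finset.mul_sum]
  refine Finset.sum_congr rfl fun i _ => ?_
  simp_rw [real_inner_smul_left]
  rw [fderiv_const_mul ((contDiff_inner_frame hφ i).differentiable one_ne_zero x)]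
  rfl

theorem continuous_horizDiv {φ : G → Horiz G} (hφ : ContDiff ℝ 1 φ) : Continuous (horizDiv φ) := by
  rw [funext (horizDiv_eq hφ)]
  exact continuous_finsetSum _ fun i _ =>
    continuous_fderiv_leftInvField (contDiff_inner_frame hφ i) _

theorem horizDiv_eq_zero_of_notMem_tsupport {φ : G → Horiz G} (hφ : ContDiff ℝ 1 φ) {x : G}
    (hx : x ∉ tsupport φ) : horizDiv φ x = 0 := by
  rw [horizDiv_eq hφ]
  refine Finset.sum_eq_zero fun i _ => ?_
  refine (hasHDerivAt_of_differentiable ((contDiff_inner_frame hφ i).differentiable one_ne_zero)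
    (frame G i : G) x).eq_zero_of_notMem_tsupport fun h => hx (closure_mono (fun y hy => ?_) h)
  intro h0
  exact hy (by simp [h0])

variable [MeasurableSpace G] [BorelSpace G]

theorem integrable_mul_horizDiv {Ω : Set G} {g : G → ℝ} (hg : MemLp g ∞ (volume.restrict Ω))
    {φ : G → Horiz G} (hφ : ContDiff ℝ 1 φ) (hφs : HasCompactSupport φ) :
    Integrable (fun x => g x * horizDiv φ x) (volume.restrict Ω) := by
  have hs : HasCompactSupport (horizDiv φ) :=
    HasCompactSupport.intro hφs.isCompact fun x hx => horizDiv_eq_zero_of_notMem_tsupport hφ hx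
  obtain ⟨C, hC⟩ := hs.exists_bound_of_continuous (continuous_horizDiv hφ)
  have h1 : IntegrableOn (fun x => g x * horizDiv φ x) (tsupport φ) (volume.restrict Ω) :=
    (hg.integrableOn_isCompact_of_top hφs.isCompact).mul_bdd
      (continuous_horizDiv hφ).aestronglyMeasurable (Eventually.of_forall hC)
  refine (integrableOn_iff_integrable_of_support_subset fun y hy => ?_).1 h1
  by_contra h
  exact hy (by simp [horizDiv_eq_zero_of_notMem_tsupport hφ h])

/-- The space `C¹_c(HΩ)`. -/
def c1cHoriz (Ω : Set G) : Submodule ℝ C_c(G, Horiz G) where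
  carrier := {φ | IsC1cHoriz Ω φ}
  zero_mem' := ⟨contDiff_const, HasCompactSupport.zero, by simp [tsupport]⟩
  add_mem' := fun {φ ψ} hφ hψ => ⟨hφ.1.add hψ.1, hφ.2.1.add hψ.2.1,
    (tsupport_add _ _).trans (union_subset hφ.2.2 hψ.2.2)⟩
  smul_mem' := fun c φ hφ => ⟨hφ.1.const_smul c, hφ.2.1.smul_left (f := fun _ => c),
    (closure_mono (Function.support_smul_subset_right (fun _ => c) φ)).trans hφ.2.2⟩

/-- The functional `φ ↦ -∫_Ω g div φ`. -/
def gradFunctional {Ω : Set G} {g : G → ℝ} (hg : MemLp g ∞ (volume.restrict Ω)) :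
    c1cHoriz Ω →ₗ[ℝ] ℝ where
  toFun φ := - ∫ x in Ω, g x * horizDiv φ.1 x
  map_add' φ ψ := by
    have h : ∀ x, g x * horizDiv (φ + ψ).1 x = g x * horizDiv φ.1 x + g x * horizDiv ψ.1 x := by
      intro x
      rw [← mul_add, ← horizDiv_add φ.2.1 ψ.2.1]
      rfl
    simp_rw [h]
    rw [integral_add (integrable_mul_horizDiv hg φ.2.1 φ.2.2.1)
      (integrable_mul_horizDiv hg ψ.2.1 ψ.2.2.1), neg_add]
  map_smul' c φ := by
    have h : ∀ x, g x * horizDiv (c • φ).1 x = c * (g x * horizDiv φ.1 x) := by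
      intro x
      rw [mul_left_comm, ← horizDiv_smul c φ.2.1]
      rfl
    simp_rw [h]
    rw [integral_const_mul, RingHom.id_apply, smul_eq_mul, mul_neg]

/-- A bounded function of finite horizontal variation has a horizontal gradient measure. -/
theorem exists_isPolarGrad {Ω : Set G} (hΩ : IsOpen Ω) {g : G → ℝ}
    (hg : MemLp g ∞ (volume.restrict Ω)) (hvar : horizVariation Ω g < ⊤) :
    ∃ (σ : G → Horiz G) (Λ : Measure G), IsPolarGrad Ω g σ Λ := by
  -- The bound on the functional is the definition of the variation, applied to `-φ` because of the
  -- sign in `gradFunctional`.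
  obtain ⟨Λ, hΛ, σ, hσ, hσ1, hrep⟩ := exists_polar_representation (frame G) (0 : G) (c1cHoriz Ω)
    (gradFunctional hg) (horizVariation Ω g).toReal (by
      intro φ hφ
      have h1 : IsC1cHoriz Ω (-φ).1 := (-φ).2
      have h2 : gradFunctional hg φ = ∫ x in Ω, g x * horizDiv (-φ).1 x := by
        rw [← neg_neg (gradFunctional hg φ), ← map_neg]
        exact neg_neg _
      rw [h2]
      refine (ENNReal.ofReal_le_iff_le_toReal hvar.ne).1 ?_
      refine le_iSup_of_le ((-φ).1 : G → Horiz G) (le_iSup_of_le h1 (le_iSup_of_le ?_ le_rfl))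
      intro x
      change ‖-(φ.1 x)‖ ≤ 1
      rw [norm_neg]
      exact hφ x)
  -- The representing measure lives on the whole group; its part off `Ω` is dropped, which the test
  -- fields do not see.
  refine ⟨σ, Λ.restrict Ω, inferInstance, ?_, hσ, ae_restrict_of_ae hσ1, ?_⟩
  · rw [Measure.restrict_apply hΩ.measurableSet.compl, compl_inter_self, measure_empty]
  · intro φ hφ
    have h1 := hrep ⟨⟨⟨φ, hφ.1.continuous⟩, hφ.2.1⟩, hφ⟩
    rw [setIntegral_eq_integral_of_forall_compl_eq_zero (μ := Λ)]
    · rw [← neg_eq_iff_eq_neg]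
      exact h1
    · intro x hx
      rw [image_eq_zero_of_notMem_tsupport fun h => hx (hφ.2.2 h), inner_zero_left]

end Polar

/-! ### Horizontal derivatives of convolutions -/

section ConvolutionGradient

open StratifiedGroup
open scoped Pointwise

variable {G : Type*} [NormedAddCommGroup G] [InnerProductSpace ℝ G] [FiniteDimensional ℝ G]
  [StratifiedGroup G] [MeasurableSpace G] [BorelSpace G]

-- Replacing `y` by `y (t v)` shifts the parameter `s` to `s - t`, so only the ends of the interval
-- of integration move. This produces a derivative out of a merely continuous kernel.
omit [MeasurableSpace G] [BorelSpace G] in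
theorem hasHDerivAt_segment_average {k : G → ℝ} (hk : Continuous k) (x v y : G) :
    HasHDerivAt v (fun y => ∫ s in (0 : ℝ)..1, k (x * (s • v) * y⁻¹))
      (k (x * y⁻¹) - k (x * v * y⁻¹)) y := by
  set f : ℝ → ℝ := fun s => k (x * (s • v) * y⁻¹) with hf
  have hfc : Continuous f := by fun_prop
  have h1 : ∀ t : ℝ, ∫ s in (0 : ℝ)..1, k (x * (s • v) * (y * (t • v))⁻¹) =
      (∫ s in (0 : ℝ)..(1 - t), f s) - ∫ s in (0 : ℝ)..(0 - t), f s := by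
    intro t
    rw [intervalIntegral.integral_interval_sub_left (hfc.intervalIntegrable _ _)
      (hfc.intervalIntegrable _ _), ← intervalIntegral.integral_comp_sub_right]
    congr 1 with s
    rw [hf]
    simp only [mul_inv_rev, mul_assoc]
    congr 2
    rw [← mul_assoc, inv_eq_neg (t • v), ← neg_smul, StratifiedGroup.smul_mul_smul, sub_eq_add_neg]
  rw [HasHDerivAt]
  simp_rw [h1]
  have h2 : ∀ b : ℝ, HasDerivAt (fun t : ℝ => ∫ s in (0 : ℝ)..(b - t), f s) (-f b) 0 := by
    intro b
    have h3 : HasDerivAt (fun u => ∫ s in (0 : ℝ)..u, f s) (f b) (b - 0) := by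
      rw [sub_zero]
      exact (hfc.integral_hasStrictDerivAt 0 b).hasDerivAt
    have h4 := HasDerivAt.comp (h := fun t : ℝ => b - t) 0 h3 ((hasDerivAt_id (0 : ℝ)).const_sub b)
    simpa using! h4
  have h5 := (h2 1).sub (h2 0)
  have e : -f 1 - -f 0 = k (x * y⁻¹) - k (x * v * y⁻¹) := by
    simp only [hf, one_smul, zero_smul, mul_zero']
    ring
  rwa [e] at h5

/-- The averages of `k` over the segment from `x` to `x v` are used as a test function for `D_H g`:
their derivative is the difference of the kernels at the two ends. Fubini then brings the average
outside. -/
theorem IsPolarGrad.lconv_sub {Ω : Set G} (hΩ : IsOpen Ω) {g : G → ℝ}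
    (hg : MemLp g ∞ (volume.restrict Ω)) {σ : G → Horiz G} {Λ : Measure G}
    (h : IsPolarGrad Ω g σ Λ) {k : G → ℝ} (hk : Continuous k) (hks : HasCompactSupport k)
    {x : G} {v : Horiz G}
    (hsub : ∀ s ∈ Icc (0 : ℝ) 1, ∀ y, x * (s • (v : G)) * y⁻¹ ∈ tsupport k → y ∈ Ω) :
    lconv k (Ω.indicator g) volume (x * v) - lconv k (Ω.indicator g) volume x =
      ∫ s in (0 : ℝ)..1, inner ℝ v (lconv k σ Λ (x * (s • (v : G)))) := by
  have := h.finite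
  set u : G → ℝ := fun y => ∫ s in (0 : ℝ)..1, k (x * (s • (v : G)) * y⁻¹) with hu
  have huc : Continuous u := by
    refine intervalIntegral.continuous_parametric_intervalIntegral_of_continuous' ?_ 0 1
    exact hk.comp (by fun_prop)
  -- A compact set containing all `y` that some point of the segment sees through `k`.
  let T : Set G := (tsupport k)⁻¹ * (fun s : ℝ => x * (s • (v : G))) '' Icc 0 1
  have hT : IsCompact T := hks.isCompact.inv.mul (isCompact_Icc.image (by fun_prop))
  have hTΩ : T ⊆ Ω := by
    rintro _ ⟨a, ha, _, ⟨s, hs, rfl⟩, rfl⟩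
    refine hsub s hs _ ?_
    rw [mul_inv_rev, mul_inv_cancel_left]
    exact ha
  have huT : ∀ y, y ∉ T → u y = 0 := by
    intro y hy
    refine intervalIntegral.integral_zero_ae (Eventually.of_forall fun s hs => ?_)
    by_contra hne
    rw [uIoc_of_le zero_le_one] at hs
    refine hy ⟨(x * (s • (v : G)) * y⁻¹)⁻¹, ?_, _, ⟨s, Ioc_subset_Icc_self hs, rfl⟩, by group⟩
    exact Set.inv_mem_inv.2 (subset_tsupport k hne)
  have hus : IsCc Ω u := ⟨huc, HasCompactSupport.intro hT huT,
    (closure_minimal (Function.support_subset_iff'.2 huT) hT.isClosed).trans hTΩ⟩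
  have key := h.integral_mul_hDeriv hΩ hg (v := v) hus
    (u' := fun y => k (x * y⁻¹) - k (x * v * y⁻¹)) (by fun_prop)
    fun y => hasHDerivAt_segment_average hk x v y
  have hind : ∀ z, lconv k (Ω.indicator g) volume z = ∫ y in Ω, k (z * y⁻¹) * g y := by
    intro z
    rw [lconv, ← integral_indicator hΩ.measurableSet]
    congr 1 with y
    by_cases hy : y ∈ Ω <;> simp [hy]
  have h_int : ∀ z, Integrable (fun y => k (z * y⁻¹) * g y) (volume.restrict Ω) := by
    intro z
    have hK : IsCompact ((tsupport k)⁻¹ * {z}) := hks.isCompact.inv.mul isCompact_singleton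
    obtain ⟨C, hC⟩ := hks.exists_bound_of_continuous hk
    have h1 : IntegrableOn (fun y => k (z * y⁻¹) * g y) ((tsupport k)⁻¹ * {z})
        (volume.restrict Ω) :=
      (hg.integrableOn_isCompact_of_top hK).bdd_mul
        (hk.comp (by fun_prop)).aestronglyMeasurable (Eventually.of_forall fun y => hC _)
    refine (integrableOn_iff_integrable_of_support_subset fun y hy => ?_).1 h1
    have : k (z * y⁻¹) ≠ 0 := left_ne_zero_of_mul hy
    exact ⟨(z * y⁻¹)⁻¹, Set.inv_mem_inv.2 (subset_tsupport k this), z, rfl, by simp⟩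
  simp_rw [sub_mul] at key
  rw [integral_sub (h_int x) (h_int (x * v)), ← hind, ← hind] at key
  rw [← neg_sub, key, neg_neg]
  obtain ⟨C, hC⟩ := hks.exists_bound_of_continuous hk
  have hσm : Measurable fun y => (inner ℝ v (σ y) : ℝ) := measurable_const.inner h.measurable
  have hF : Integrable (Function.uncurry fun (y : G) (s : ℝ) =>
      k (x * (s • (v : G)) * y⁻¹) * inner ℝ v (σ y))
      (Λ.prod (volume.restrict (Ioc (0 : ℝ) 1))) := by
    refine Integrable.of_bound (C := C * ‖v‖) ?_ ?_
    · refine AEStronglyMeasurable.mul ?_ ?_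
      · refine Continuous.aestronglyMeasurable ?_
        exact hk.comp (by fun_prop)
      · exact (hσm.comp measurable_fst).aestronglyMeasurable
    · have h1 : ∀ᵐ p ∂(Λ.prod (volume.restrict (Ioc (0 : ℝ) 1))), ‖σ p.1‖ = 1 :=
        Measure.quasiMeasurePreserving_fst.ae h.norm_eq_one
      filter_upwards [h1] with p hp
      rw [Function.uncurry, norm_mul]
      refine mul_le_mul (hC _) ?_ (norm_nonneg _) ((norm_nonneg _).trans (hC 0))
      simpa [hp] using norm_inner_le_norm (𝕜 := ℝ) v (σ p.1)
  rw [intervalIntegral.integral_of_le zero_le_one]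
  have e1 : ∀ y, u y * inner ℝ v (σ y) =
      ∫ s in Ioc (0 : ℝ) 1, k (x * (s • (v : G)) * y⁻¹) * inner ℝ v (σ y) := by
    intro y
    rw [integral_mul_const, ← intervalIntegral.integral_of_le zero_le_one]
  simp_rw [e1]
  rw [integral_integral_swap hF]
  congr 1 with s
  have hi : Integrable (fun y => k (x * (s • (v : G)) * y⁻¹) • σ y) Λ := by
    refine Integrable.of_bound (C := C) ?_ ?_
    · exact (by fun_prop : Continuous fun y => k (x * (s • (v : G)) * y⁻¹)).aestronglyMeasurable.smul
        h.measurable.aestronglyMeasurable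
    · filter_upwards [h.norm_eq_one] with y hy
      rw [norm_smul, hy, mul_one]
      exact hC _
  rw [lconv, ← integral_inner hi]
  simp_rw [real_inner_smul_right]

theorem IsPolarGrad.integrable {Ω : Set G} {g : G → ℝ} {σ : G → Horiz G} {Λ : Measure G}
    (h : IsPolarGrad Ω g σ Λ) : Integrable σ Λ := by
  have := h.finite
  exact Integrable.of_bound (C := 1) h.measurable.aestronglyMeasurable
    (h.norm_eq_one.mono fun x hx => hx.le)

/-- The horizontal derivatives of a convolution. -/
theorem IsPolarGrad.hasHDerivAt_lconv {Ω : Set G} (hΩ : IsOpen Ω) {g : G → ℝ}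
    (hg : MemLp g ∞ (volume.restrict Ω)) {σ : G → Horiz G} {Λ : Measure G}
    (h : IsPolarGrad Ω g σ Λ) {k : G → ℝ} (hk : Continuous k) (hks : HasCompactSupport k)
    {x : G} (hsub : ∀ y, x * y⁻¹ ∈ tsupport k → y ∈ Ω) (v : Horiz G) :
    HasHDerivAt (v : G) (lconv k (Ω.indicator g) volume) (inner ℝ v (lconv k σ Λ x)) x := by
  have hA : Continuous (lconv k σ Λ) := continuous_lconv hk hks h.integrable.locallyIntegrable
  have hK : IsCompact ((tsupport k)⁻¹ * {x}) := hks.isCompact.inv.mul isCompact_singleton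
  have hKΩ : (tsupport k)⁻¹ * {x} ⊆ Ω := by
    rintro _ ⟨a, ha, _, rfl, rfl⟩
    refine hsub _ ?_
    simpa using ha
  obtain ⟨V, hV, hVΩ⟩ := compact_open_separated_mul_right hK hΩ hKΩ
  rw [one_eq_zero] at hV
  have hcont : Continuous fun t : ℝ => t • (v : G) := by fun_prop
  have ht := hcont.tendsto 0
  rw [zero_smul] at ht
  obtain ⟨η, hη, hηV⟩ := Metric.mem_nhds_iff.1 (ht hV)
  set f : ℝ → ℝ := fun s => inner ℝ v (lconv k σ Λ (x * (s • (v : G)))) with hf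
  have hfc : Continuous f := by
    have : Continuous fun s : ℝ => lconv k σ Λ (x * (s • (v : G))) := hA.comp (by fun_prop)
    fun_prop
  -- For small `t` the segment stays admissible, so along the curve the convolution is a primitive
  -- of a continuous function, and the fundamental theorem of calculus concludes.
  have hloc : ∀ᶠ t : ℝ in 𝓝 0, lconv k (Ω.indicator g) volume (x * (t • (v : G))) =
      lconv k (Ω.indicator g) volume x + ∫ s in (0 : ℝ)..t, f s := by
    filter_upwards [Metric.ball_mem_nhds (0 : ℝ) hη] with t ht
    have h1 := h.lconv_sub hΩ hg hk hks (x := x) (v := t • v) (by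
      intro s hs y hy
      refine hVΩ ⟨y * (s • (t • (v : G)))⁻¹, ⟨(x * (s • (t • (v : G))) * y⁻¹)⁻¹,
        Set.inv_mem_inv.2 (by simpa using hy), x, rfl, by group⟩, s • (t • (v : G)), ?_, by simp⟩
      rw [smul_smul]
      refine hηV ?_
      rw [mem_ball_zero_iff, norm_mul] at *
      refine lt_of_le_of_lt ?_ ht
      have : ‖s‖ ≤ 1 := by rw [Real.norm_of_nonneg hs.1]; exact hs.2
      nlinarith [norm_nonneg t])
    rw [← sub_eq_iff_eq_add', Submodule.coe_smul] at *
    rw [h1]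
    have h2 := intervalIntegral.mul_integral_comp_mul_left (a := 0) (b := 1) (f := f) (c := t)
    rw [mul_zero, mul_one] at h2
    rw [← h2, ← intervalIntegral.integral_const_mul]
    congr 1 with s
    rw [hf, real_inner_smul_left, smul_smul, mul_comm s t]
  rw [HasHDerivAt]
  refine HasDerivAt.congr_of_eventuallyEq ?_ hloc
  have h3 := (hfc.integral_hasStrictDerivAt 0 0).hasDerivAt.const_add
    (lconv k (Ω.indicator g) volume x)
  convert h3 using 1
  rw [hf]
  simp [mul_zero']

end ConvolutionGradient

/-! ### Mollification -/

section Mollification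

open StratifiedGroup
open scoped Pointwise

variable {G : Type*} [NormedAddCommGroup G] [InnerProductSpace ℝ G] [FiniteDimensional ℝ G]
  [StratifiedGroup G] [MeasurableSpace G] [BorelSpace G]
  {H : Type*} [NormedAddCommGroup H] [InnerProductSpace ℝ H]

namespace IsKernel

variable {k : G → ℝ} (hk : IsKernel k)

include hk

theorem integrable_mul_right (y : G) : Integrable (fun x => k (x * y⁻¹)) volume :=
  hk.integrable.comp_mul_right y⁻¹

theorem integral_mul_right (y : G) : ∫ x, k (x * y⁻¹) = 1 := by
  rw [integral_mul_right_eq_self, hk.integral_eq_one]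

theorem integrable_prod {Θ : Measure G} [IsFiniteMeasure Θ] {u : G → H} (hu : Integrable u Θ) :
    Integrable (fun p : G × G => k (p.1 * p.2⁻¹) • u p.2) (volume.prod Θ) := by
  have hm : AEStronglyMeasurable (fun p : G × G => k (p.1 * p.2⁻¹) • u p.2)
      ((volume : Measure G).prod Θ) :=
    (hk.continuous.comp (by fun_prop)).aestronglyMeasurable.smul hu.aestronglyMeasurable.comp_snd
  refine (integrable_prod_iff' hm).2 ⟨Eventually.of_forall fun y =>
    (hk.integrable_mul_right y).smul_const (u y), ?_⟩
  have : ∀ y, ∫ x, ‖k (x * y⁻¹) • u y‖ = ‖u y‖ := by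
    intro y
    simp_rw [norm_smul, Real.norm_of_nonneg (hk.nonneg _)]
    rw [integral_mul_const, hk.integral_mul_right, one_mul]
  simp_rw [this]
  exact hu.norm

theorem integrable_lconv {Θ : Measure G} [IsFiniteMeasure Θ] {u : G → H} (hu : Integrable u Θ) :
    Integrable (lconv k u Θ) volume :=
  (hk.integrable_prod hu).integral_prod_left

/-- Convolution with a symmetric kernel is symmetric. -/
theorem integral_inner_lconv [CompleteSpace H] (hsymm : ∀ z, k z⁻¹ = k z) {Θ : Measure G}
    [IsFiniteMeasure Θ] {u : G → H} (hu : Integrable u Θ) {f : G → H}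
    (hf : AEStronglyMeasurable f volume) {M : ℝ} (hM : ∀ᵐ x, ‖f x‖ ≤ M) :
    ∫ x, inner ℝ (f x) (lconv k u Θ x) = ∫ y, inner ℝ (lconv k f volume y) (u y) ∂Θ := by
  have hi : Integrable (Function.uncurry fun x y => inner ℝ (f x) (k (x * y⁻¹) • u y))
      (volume.prod Θ) := by
    refine ((hk.integrable_prod hu).norm.const_mul M).mono'
      (hf.comp_fst.inner (hk.integrable_prod hu).aestronglyMeasurable) ?_
    filter_upwards [Measure.quasiMeasurePreserving_fst.ae hM] with p hp
    exact (norm_inner_le_norm _ _).trans (mul_le_mul_of_nonneg_right hp (norm_nonneg _))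
  have h1 := integral_integral_swap hi
  have h2 : ∀ᵐ x, ∫ y, inner ℝ (f x) (k (x * y⁻¹) • u y) ∂Θ = inner ℝ (f x) (lconv k u Θ x) := by
    filter_upwards [(hk.integrable_prod hu).prod_right_ae] with x hx
    rw [lconv, ← integral_inner hx]
  rw [integral_congr_ae h2] at h1
  rw [h1]
  congr 1 with y
  have hfk : Integrable (fun x => k (y * x⁻¹) • f x) volume := by
    refine ((hk.integrable_mul_inv y).mul_const M).mono'
      ((hk.continuous.comp (by fun_prop)).aestronglyMeasurable.smul hf) ?_
    filter_upwards [hM] with x hx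
    rw [norm_smul, Real.norm_of_nonneg (hk.nonneg _)]
    exact mul_le_mul_of_nonneg_left hx (hk.nonneg _)
  rw [lconv, real_inner_comm, ← integral_inner hfk]
  congr 1 with x
  rw [real_inner_smul_right, real_inner_smul_right, real_inner_comm, ← hsymm, mul_inv_rev, inv_inv]

end IsKernel

/-! #### Right inner parts -/

variable (d : HomogeneousDist G)

omit [MeasurableSpace G] [BorelSpace G] in
theorem mem_of_mem_rightInner {Ω : Set G} {ε : ℝ} {x y : G} (hx : x ∈ rightInner d Ω ε)
    (hxy : d.rdist x y ≤ ε) : y ∈ Ω := by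
  by_contra h
  have hx' : ENNReal.ofReal ε < ⨅ y ∈ Ωᶜ, ENNReal.ofReal (d.rdist x y) := hx
  exact hx'.not_ge ((iInf₂_le y h).trans (ENNReal.ofReal_le_ofReal hxy))

omit [MeasurableSpace G] [BorelSpace G] in
theorem rightInner_anti (Ω : Set G) {ε ε' : ℝ} (h : ε ≤ ε') :
    rightInner d Ω ε' ⊆ rightInner d Ω ε := fun _ hx =>
  lt_of_le_of_lt (ENNReal.ofReal_le_ofReal h) (show ENNReal.ofReal ε' < _ from hx)

/-- An infimum of continuous functions, however many, is upper semicontinuous. -/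
theorem measurableSet_rightInner (Ω : Set G) (ε : ℝ) : MeasurableSet (rightInner d Ω ε) := by
  refine measurableSet_lt measurable_const (UpperSemicontinuous.measurable ?_)
  refine upperSemicontinuous_biInf fun y _ => Continuous.upperSemicontinuous ?_
  refine ENNReal.continuous_ofReal.comp ?_
  simp_rw [d.rdist_eq]
  exact d.continuous_hnorm.comp (by fun_prop)

-- A neighbourhood `V` of the identity with `V K ⊆ Ω` keeps `K` at a positive right invariant
-- distance from the complement.
omit [MeasurableSpace G] [BorelSpace G] in
theorem eventually_subset_rightInner {Ω K : Set G} (hΩ : IsOpen Ω) (hK : IsCompact K)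
    (hKΩ : K ⊆ Ω) : ∀ᶠ ε : ℝ in 𝓝 0, K ⊆ rightInner d Ω (2 * ε) := by
  obtain ⟨V, hV, hVΩ⟩ := compact_open_separated_mul_left hK hΩ hKΩ
  rw [one_eq_zero] at hV
  obtain ⟨η, hη, hηV⟩ := d.exists_hnorm_lt_subset hV
  filter_upwards [gt_mem_nhds (half_pos hη)] with ε hε x hx
  refine lt_of_lt_of_le ((ENNReal.ofReal_lt_ofReal_iff hη).2 (by linarith : 2 * ε < η))
    (le_iInf₂ fun y hy => ENNReal.ofReal_le_ofReal ?_)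
  by_contra h
  rw [d.rdist_comm, not_le, d.rdist_eq] at h
  exact hy (hVΩ ⟨y * x⁻¹, hηV _ h, x, hx, by simp⟩)

/-! #### Rescaled mollifiers -/

theorem mollify_eq {Ω : Set G} (hΩ : MeasurableSet Ω) (ρ : G → ℝ) (ε : ℝ) (g : G → ℝ) :
    mollify Ω ρ ε g = lconv (rescale ρ ε) (Ω.indicator g) volume := by
  funext x
  rw [mollify, lconv, ← integral_indicator hΩ]
  congr 1 with y
  by_cases hy : y ∈ Ω <;> simp [hy]

namespace IsMollifier

variable {d} {ρ : G → ℝ} (hρ : IsMollifier d ρ)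

include hρ

theorem hnorm_lt {ε : ℝ} (hε : 0 < ε) {z : G} (hz : rescale ρ ε z ≠ 0) : d.hnorm z < ε := by
  have h1 : ρ (dil ε⁻¹ z) ≠ 0 := right_ne_zero_of_mul hz
  have h2 : d.dist (dil ε⁻¹ z) 0 < 1 := hρ.isCc.2.2 (subset_tsupport ρ h1)
  change d.hnorm _ < 1 at h2
  rw [d.hnorm_dil (inv_pos.2 hε), inv_mul_lt_iff₀ hε, mul_one] at h2
  exact h2

theorem tsupport_rescale_subset {ε : ℝ} (hε : 0 < ε) :
    tsupport (rescale ρ ε) ⊆ {z | d.hnorm z ≤ ε} :=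
  closure_minimal (fun _ hz => (hρ.hnorm_lt hε hz).le)
    (isClosed_le d.continuous_hnorm continuous_const)

theorem isKernel_rescale {ε : ℝ} (hε : 0 < ε) : IsKernel (rescale ρ ε) where
  continuous := continuous_const.mul (hρ.isCc.1.comp (continuous_dil_right _))
  hasCompactSupport := (d.isCompact_hnorm_le ε).of_isClosed_subset (isClosed_tsupport _)
    (hρ.tsupport_rescale_subset hε)
  nonneg x := mul_nonneg (by positivity) (hρ.nonneg _)
  integral_eq_one := by
    have h1 : ∫ x, ρ x = 1 := by
      rw [← hρ.integral_eq_one, setIntegral_eq_integral_of_forall_compl_eq_zero]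
      intro x hx
      by_contra h
      exact hx (hρ.isCc.2.2 (subset_tsupport ρ h))
    simp only [rescale]
    rw [integral_const_mul, integral_comp_dil (inv_pos.2 hε), h1, smul_eq_mul, mul_one, inv_pow,
      inv_inv, inv_mul_cancel₀ (pow_ne_zero _ hε.ne')]

theorem rescale_inv (ε : ℝ) (z : G) : rescale ρ ε z⁻¹ = rescale ρ ε z := by
  rw [rescale, rescale, dil_inv, ← hρ.symm]

/-- Mollifications converge at Lebesgue points. -/
theorem ae_tendsto_lconv [CompleteSpace H] {f : G → H} (hf : LocallyIntegrable f volume) :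
    ∀ᵐ x, Tendsto (fun ε => lconv (rescale ρ ε) f volume x) (𝓝[>] 0) (𝓝 (f x)) := by
  obtain ⟨C, hC⟩ := hρ.isCc.2.1.exists_bound_of_continuous hρ.isCc.1
  have hC0 : 0 ≤ C := (norm_nonneg _).trans (hC 0)
  set c : ℝ := (volume {z : G | d.hnorm z < 1}).toReal
  -- This growth of order `ε ^ Q` cancels the factor `ε ^ (-Q)` of the kernel, so the mollification
  -- error is at most a constant times the mean oscillation of `f`.
  have hvol : ∀ x : G, ∀ ε > 0, volume.real {y | d.rdist x y ≤ ε} ≤ (2 * ε) ^ homDim G * c := by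
    intro x ε hε
    have h1 : {y | d.rdist x y ≤ ε} = (fun y => y * x⁻¹) ⁻¹' {z | d.hnorm z ≤ ε} := by
      ext y
      rw [mem_preimage, mem_ofPred_eq, mem_ofPred_eq, d.rdist_comm, d.rdist_eq]
    rw [Measure.real, h1, measure_preimage_mul_right]
    refine (ENNReal.toReal_mono ?_ (measure_mono (t := {z | d.hnorm z < 2 * ε})
      fun z (hz : d.hnorm z ≤ ε) => show d.hnorm z < 2 * ε by linarith)).trans ?_
    · rw [d.volume_hnorm_lt (by positivity)]
      exact ENNReal.mul_ne_top ENNReal.ofReal_ne_top d.volume_hnorm_lt_one_lt_top.ne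
    · rw [d.volume_hnorm_lt (by positivity), ENNReal.toReal_mul,
        ENNReal.toReal_ofReal (by positivity)]
  filter_upwards [d.ae_tendsto_average_rdist hf] with x hx
  rw [tendsto_iff_norm_sub_tendsto_zero]
  have hx2 := hx.const_mul (C * 2 ^ homDim G * c)
  rw [mul_zero] at hx2
  refine squeeze_zero' (Eventually.of_forall fun _ => norm_nonneg _) ?_ hx2
  filter_upwards [self_mem_nhdsWithin] with ε (hε : 0 < ε)
  have hk := hρ.isKernel_rescale hε
  have hcomp : IsCompact {y | d.rdist x y ≤ ε} := by
    have : {y | d.rdist x y ≤ ε} = (Homeomorph.mulRight x⁻¹) ⁻¹' {z | d.hnorm z ≤ ε} := by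
      ext y
      rw [mem_preimage, mem_ofPred_eq, mem_ofPred_eq, d.rdist_comm, d.rdist_eq]
      rfl
    rw [this, Homeomorph.isCompact_preimage]
    exact d.isCompact_hnorm_le ε
  have hfi : IntegrableOn (fun y => ‖f y - f x‖) {y | d.rdist x y ≤ ε} volume :=
    ((hf.integrableOn_isCompact hcomp).sub (integrableOn_const hcomp.measure_lt_top.ne)).norm
  have hsupp : ∀ y, d.rdist x y ≤ ε ∨ rescale ρ ε (x * y⁻¹) = 0 := by
    intro y
    by_cases h : rescale ρ ε (x * y⁻¹) = 0
    · exact Or.inr h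
    · exact Or.inl (hρ.hnorm_lt hε h).le
  have h_int : Integrable (fun y => rescale ρ ε (x * y⁻¹) • (f y - f x)) volume := by
    have h1 : IntegrableOn (fun y => rescale ρ ε (x * y⁻¹) • (f y - f x))
        {y | d.rdist x y ≤ ε} volume :=
      ((hf.integrableOn_isCompact hcomp).sub
        (integrableOn_const hcomp.measure_lt_top.ne)).continuousOn_smul
        (hk.continuous.comp (by fun_prop)).continuousOn hcomp
    refine (integrableOn_iff_integrable_of_support_subset fun y hy => ?_).1 h1
    exact (hsupp y).resolve_right (smul_ne_zero_iff.1 hy).1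
  have hsub : lconv (rescale ρ ε) f volume x - f x =
      ∫ y, rescale ρ ε (x * y⁻¹) • (f y - f x) := by
    have e : ∀ y, rescale ρ ε (x * y⁻¹) • f y =
        rescale ρ ε (x * y⁻¹) • (f y - f x) + rescale ρ ε (x * y⁻¹) • f x := fun y => by
      rw [← smul_add, sub_add_cancel]
    rw [lconv]
    simp_rw [e]
    rw [integral_add h_int ((hk.integrable_mul_inv x).smul_const _), integral_smul_const,
      hk.integral_mul_inv, one_smul, add_sub_cancel_right]
  have hbound : ∀ z, rescale ρ ε z ≤ (ε ^ homDim G)⁻¹ * C := fun z =>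
    mul_le_mul_of_nonneg_left ((le_abs_self _).trans (hC _)) (by positivity)
  rw [hsub]
  calc ‖∫ y, rescale ρ ε (x * y⁻¹) • (f y - f x)‖
      ≤ ∫ y in {y | d.rdist x y ≤ ε}, (ε ^ homDim G)⁻¹ * C * ‖f y - f x‖ := by
        rw [← setIntegral_eq_integral_of_forall_compl_eq_zero (s := {y | d.rdist x y ≤ ε})
          fun y hy => by rw [(hsupp y).resolve_left hy, zero_smul]]
        refine norm_integral_le_of_norm_le (hfi.const_mul _) (Eventually.of_forall fun y => ?_)
        rw [norm_smul, Real.norm_of_nonneg (hk.nonneg _)]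
        exact mul_le_mul_of_nonneg_right (hbound _) (norm_nonneg _)
    _ = (ε ^ homDim G)⁻¹ * C * (volume.real {y | d.rdist x y ≤ ε} *
          ⨍ y in {y | d.rdist x y ≤ ε}, ‖f y - f x‖) := by
        rw [integral_const_mul]
        congr 1
        rw [setAverage_eq, smul_eq_mul]
        by_cases h0 : volume.real {y | d.rdist x y ≤ ε} = 0
        · rw [h0, zero_mul]
          refine setIntegral_measure_zero _ ?_
          exact (measureReal_eq_zero_iff hcomp.measure_lt_top.ne).1 h0
        · rw [mul_inv_cancel_left₀ h0]
    _ ≤ (ε ^ homDim G)⁻¹ * C * ((2 * ε) ^ homDim G * c *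
          ⨍ y in {y | d.rdist x y ≤ ε}, ‖f y - f x‖) := by
        refine mul_le_mul_of_nonneg_left (mul_le_mul_of_nonneg_right (hvol x ε hε) ?_)
          (by positivity)
        rw [setAverage_eq]
        exact mul_nonneg (by positivity) (integral_nonneg fun _ => norm_nonneg _)
    _ = C * 2 ^ homDim G * c * ⨍ y in {y | d.rdist x y ≤ ε}, ‖f y - f x‖ := by
        rw [mul_pow]
        field_simp

end IsMollifier

end Mollification

/-! ### Gradients of mollifications and the absolutely continuous part of the gradient -/

section MollifiedGradient

open StratifiedGroup

variable {G : Type*} [NormedAddCommGroup G] [InnerProductSpace ℝ G] [FiniteDimensional ℝ G]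
  [StratifiedGroup G] [MeasurableSpace G] [BorelSpace G]

/-- Approximate differentiability and `gF ∈ DM^∞` involve no given mollifier; a truncated
homogeneous norm provides one for their proofs. -/
theorem exists_isMollifier (d : HomogeneousDist G) : ∃ ρ : G → ℝ, IsMollifier d ρ := by
  set f : G → ℝ := fun x => max 0 (1 / 2 - d.hnorm x) with hf
  have hfc : Continuous f := continuous_const.max (continuous_const.sub d.continuous_hnorm)
  have hf0 : ∀ x, 0 ≤ f x := fun x => le_max_left _ _
  have hsub : tsupport f ⊆ {x | d.hnorm x ≤ 1 / 2} := by
    refine closure_minimal (fun x hx => ?_) (isClosed_le d.continuous_hnorm continuous_const)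
    by_contra h
    have h : 1 / 2 < d.hnorm x := not_le.1 h
    exact hx (max_eq_left (by linarith))
  have hfs : HasCompactSupport f :=
    (d.isCompact_hnorm_le _).of_isClosed_subset (isClosed_tsupport _) hsub
  have hball : tsupport f ⊆ d.ball 0 1 := fun x hx => by
    have h1 : d.hnorm x ≤ 1 / 2 := hsub hx
    change d.hnorm x < 1
    linarith
  have hpos : 0 < ∫ x, f x := by
    refine hfc.integral_pos_of_hasCompactSupport_nonneg_nonzero hfs hf0 (x := 0) ?_
    simp [hf, d.hnorm_zero]
  refine ⟨fun x => (∫ x, f x)⁻¹ * f x, ⟨by fun_prop, hfs.mul_left, ?_⟩, ?_, ?_, ?_⟩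
  · exact (closure_mono (Function.support_mul_subset_right _ _)).trans hball
  · exact fun x => mul_nonneg (inv_nonneg.2 hpos.le) (hf0 x)
  · intro x
    simp only [hf]
    rw [d.hnorm_inv]
  · rw [integral_const_mul, setIntegral_eq_integral_of_forall_compl_eq_zero,
      inv_mul_cancel₀ hpos.ne']
    intro x hx
    by_contra h
    exact hx (hball (subset_tsupport f h))

variable {d : HomogeneousDist G} {Ω : Set G} {g : G → ℝ} {σ : G → Horiz G} {Λ : Measure G}

theorem IsPolarGrad.hasHDerivAt_mollify (h : IsPolarGrad Ω g σ Λ) (hΩ : IsOpen Ω)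
    (hg : MemLp g ∞ (volume.restrict Ω)) {ρ : G → ℝ} (hρ : IsMollifier d ρ) {ε : ℝ} (hε : 0 < ε)
    {x : G} (hx : x ∈ rightInner d Ω ε) (v : Horiz G) :
    HasHDerivAt (v : G) (mollify Ω ρ ε g) (inner ℝ (mollifyMeasure ρ ε σ Λ x) v) x := by
  have hk := hρ.isKernel_rescale hε
  rw [mollify_eq hΩ.measurableSet, real_inner_comm]
  refine h.hasHDerivAt_lconv hΩ hg hk.continuous hk.hasCompactSupport (fun y hy => ?_) v
  exact mem_of_mem_rightInner d hx (hρ.tsupport_rescale_subset hε hy)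

theorem IsPolarGrad.horizGrad_mollify (h : IsPolarGrad Ω g σ Λ) (hΩ : IsOpen Ω)
    (hg : MemLp g ∞ (volume.restrict Ω)) {ρ : G → ℝ} (hρ : IsMollifier d ρ) {ε : ℝ} (hε : 0 < ε)
    {x : G} (hx : x ∈ rightInner d Ω ε) :
    horizGrad (mollify Ω ρ ε g) x = mollifyMeasure ρ ε σ Λ x :=
  horizGrad_eq_of_hasHDerivAt fun i => h.hasHDerivAt_mollify hΩ hg hρ hε hx (frame G i)

theorem IsPolarGrad.continuous_mollifyMeasure (h : IsPolarGrad Ω g σ Λ) {ρ : G → ℝ}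
    (hρ : IsMollifier d ρ) {ε : ℝ} (hε : 0 < ε) : Continuous (mollifyMeasure ρ ε σ Λ) :=
  have hk := hρ.isKernel_rescale hε
  continuous_lconv hk.continuous hk.hasCompactSupport h.integrable.locallyIntegrable

theorem IsPolarGrad.isC1H_mollify (h : IsPolarGrad Ω g σ Λ) (hΩ : IsOpen Ω)
    (hg : MemLp g ∞ (volume.restrict Ω)) {ρ : G → ℝ} (hρ : IsMollifier d ρ) {ε : ℝ} (hε : 0 < ε) :
    IsC1H (rightInner d Ω ε) (mollify Ω ρ ε g) :=
  ⟨fun _ hx i => HasDerivAt.differentiableAt (h.hasHDerivAt_mollify hΩ hg hρ hε hx (frame G i)),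
    (h.continuous_mollifyMeasure hρ hε).continuousOn.congr fun _ hx =>
      h.horizGrad_mollify hΩ hg hρ hε hx⟩

theorem IsPolarGrad.integrableOn_horizGrad_mollify (h : IsPolarGrad Ω g σ Λ) (hΩ : IsOpen Ω)
    (hg : MemLp g ∞ (volume.restrict Ω)) {ρ : G → ℝ} (hρ : IsMollifier d ρ) {ε : ℝ} (hε : 0 < ε) :
    IntegrableOn (horizGrad (mollify Ω ρ ε g)) (rightInner d Ω ε) := by
  have := h.finite
  refine IntegrableOn.congr_fun
    ((hρ.isKernel_rescale hε).integrable_lconv h.integrable).integrableOn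
    (fun x hx => (h.horizGrad_mollify hΩ hg hρ hε hx).symm) (measurableSet_rightInner d Ω ε)

/-- The density of the absolutely continuous part of the vector measure `σ Λ`. -/
def acDensity (σ : G → Horiz G) (Λ : Measure G) (x : G) : Horiz G :=
  (Λ.rnDeriv volume x).toReal • σ x

theorem IsPolarGrad.integrable_acDensity (h : IsPolarGrad Ω g σ Λ) :
    Integrable (acDensity σ Λ) volume := by
  have := h.finite
  refine (integrable_withDensity_iff_integrable_smul' (Measure.measurable_rnDeriv Λ volume)
    (Measure.rnDeriv_lt_top Λ volume)).1 ?_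
  exact h.integrable.mono_measure (Measure.withDensity_rnDeriv_le Λ volume)

theorem IsPolarGrad.integral_smul_eq (h : IsPolarGrad Ω g σ Λ) {f : G → ℝ} (hf : Continuous f)
    {C : ℝ} (hC : ∀ x, ‖f x‖ ≤ C) :
    ∫ x, f x • σ x ∂Λ =
      ∫ x, f x • σ x ∂(Λ.singularPart volume) + ∫ x, f x • acDensity σ Λ x := by
  have := h.finite
  have hi : Integrable (fun x => f x • σ x) Λ :=
    h.integrable.bdd_smul C hf.aestronglyMeasurable (Eventually.of_forall hC)
  conv_lhs => rw [Measure.haveLebesgueDecomposition_add Λ volume]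
  rw [integral_add_measure (hi.mono_measure (Measure.singularPart_le Λ volume))
    (hi.mono_measure (Measure.withDensity_rnDeriv_le Λ volume)),
    integral_withDensity_eq_integral_toReal_smul (Measure.measurable_rnDeriv Λ volume)
    (Measure.rnDeriv_lt_top Λ volume)]
  congr 1
  congr 1 with x
  rw [acDensity, smul_comm]

/-- The total variation of `σ Λ - w · volume`. -/
def gradDefect (σ : G → Horiz G) (Λ : Measure G) (w : Horiz G) : Measure G :=
  Λ.singularPart volume + volume.withDensity fun y => ‖acDensity σ Λ y - w‖ₑ

instance (σ : G → Horiz G) (Λ : Measure G) [IsFiniteMeasure Λ] (w : Horiz G) :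
    SFinite (gradDefect σ Λ w) := by
  unfold gradDefect
  infer_instance

/-- As `k` has integral one, the constant field `w` is its own convolution, so the difference is the
convolution of `k` with the measure `σ Λ - w · volume`. -/
theorem IsPolarGrad.enorm_lconv_sub_le (h : IsPolarGrad Ω g σ Λ) {k : G → ℝ} (hk : IsKernel k)
    (w : Horiz G) (z : G) :
    ‖lconv k σ Λ z - w‖ₑ ≤ ∫⁻ y, ENNReal.ofReal (k (z * y⁻¹)) ∂(gradDefect σ Λ w) := by
  have := h.finite
  obtain ⟨C, hC⟩ := hk.hasCompactSupport.exists_bound_of_continuous hk.continuous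
  have hc : Continuous fun y => k (z * y⁻¹) := hk.continuous.comp (by fun_prop)
  have hi1 : Integrable (fun y => k (z * y⁻¹) • acDensity σ Λ y) volume :=
    h.integrable_acDensity.bdd_smul C hc.aestronglyMeasurable (Eventually.of_forall fun y => hC _)
  have hi2 : Integrable (fun y => k (z * y⁻¹) • w) volume := (hk.integrable_mul_inv z).smul_const w
  have e : lconv k σ Λ z - w = ∫ y, k (z * y⁻¹) • σ y ∂(Λ.singularPart volume) +
      ∫ y, k (z * y⁻¹) • (acDensity σ Λ y - w) := by
    simp_rw [smul_sub]
    rw [integral_sub hi1 hi2, integral_smul_const, hk.integral_mul_inv, one_smul, ← add_sub_assoc,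
      ← h.integral_smul_eq hc fun y => hC _]
    rfl
  have hnorm : ∀ᵐ y ∂(Λ.singularPart volume), ‖σ y‖ = 1 :=
    h.norm_eq_one.filter_mono (ae_mono (Measure.singularPart_le Λ volume))
  have hkm : Measurable fun y => ENNReal.ofReal (k (z * y⁻¹)) :=
    ENNReal.measurable_ofReal.comp hc.measurable
  have hWm : Measurable fun y => ‖acDensity σ Λ y - w‖ₑ :=
    (((Measure.measurable_rnDeriv Λ volume).ennreal_toReal.smul h.measurable).sub_const w).enorm
  rw [e, gradDefect, lintegral_add_measure, lintegral_withDensity_eq_lintegral_mul _ hWm hkm]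
  refine (enorm_add_le _ _).trans (add_le_add ?_ ?_)
  · refine (enorm_integral_le_lintegral_enorm _).trans (lintegral_mono_ae ?_)
    filter_upwards [hnorm] with y hy
    rw [enorm_smul, ← ofReal_norm (σ y), hy, ENNReal.ofReal_one, mul_one, ← ofReal_norm,
      Real.norm_of_nonneg (hk.nonneg _)]
  · refine (enorm_integral_le_lintegral_enorm _).trans (lintegral_mono fun y => ?_)
    rw [enorm_smul, ← ofReal_norm (k _), Real.norm_of_nonneg (hk.nonneg _), Pi.mul_apply, mul_comm]

end MollifiedGradient

/-! ### Differences along horizontal segments -/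

section HorizontalDifferences

open StratifiedGroup
open scoped Pointwise

variable {G : Type*} [NormedAddCommGroup G] [InnerProductSpace ℝ G] [FiniteDimensional ℝ G]
  [StratifiedGroup G] [MeasurableSpace G] [BorelSpace G]
  {Ω : Set G} {g : G → ℝ} {σ : G → Horiz G} {Λ : Measure G}

theorem IsKernel.lintegral_mul_right {k : G → ℝ} (hk : IsKernel k) (q : G) :
    ∫⁻ x, ENNReal.ofReal (k (x * q)) = 1 := by
  rw [← ofReal_integral_eq_lintegral_ofReal (hk.integrable.comp_mul_right q)
    (Eventually.of_forall fun x => hk.nonneg _), integral_mul_right_eq_self, hk.integral_eq_one,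
    ENNReal.ofReal_one]

/-- By Tonelli the `x`-integral of the kernel is computed before the integral in `y`; it is at most
one by right invariance and vanishes off `B`. -/
theorem IsPolarGrad.lintegral_enorm_lconv_sub_le (h : IsPolarGrad Ω g σ Λ) {k : G → ℝ}
    (hk : IsKernel k) (w : Horiz G) (p : G) {A B : Set G} (hA : MeasurableSet A)
    (hB : MeasurableSet B) (hAB : ∀ x ∈ A, ∀ y, k (x * p * y⁻¹) ≠ 0 → y ∈ B) :
    ∫⁻ x in A, ‖lconv k σ Λ (x * p) - w‖ₑ ≤ gradDefect σ Λ w B := by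
  have := h.finite
  calc ∫⁻ x in A, ‖lconv k σ Λ (x * p) - w‖ₑ
      ≤ ∫⁻ x in A, ∫⁻ y, ENNReal.ofReal (k (x * p * y⁻¹)) ∂(gradDefect σ Λ w) :=
        lintegral_mono fun x => h.enorm_lconv_sub_le hk w _
    _ = ∫⁻ y, ∫⁻ x in A, ENNReal.ofReal (k (x * p * y⁻¹)) ∂volume ∂(gradDefect σ Λ w) := by
        refine lintegral_lintegral_swap ?_
        refine Continuous.aemeasurable ?_
        exact ENNReal.continuous_ofReal.comp (hk.continuous.comp (by fun_prop))
    _ ≤ ∫⁻ y, B.indicator 1 y ∂(gradDefect σ Λ w) := by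
        refine lintegral_mono fun y => ?_
        by_cases hy : y ∈ B
        · rw [indicator_of_mem hy, Pi.one_apply]
          refine (setLIntegral_le_lintegral _ _).trans ?_
          simp_rw [mul_assoc]
          rw [hk.lintegral_mul_right]
        · rw [indicator_of_notMem hy, nonpos_iff_eq_zero]
          refine (setLIntegral_congr_fun hA fun x hx => ?_).trans lintegral_zero
          by_contra hne
          refine hy (hAB x hx y fun h0 => hne ?_)
          rw [h0, ENNReal.ofReal_zero]
    _ = gradDefect σ Λ w B := lintegral_indicator_one hB

/-- The increment is the integral of the mollified gradient over the segment, and `⟨w, v⟩` is the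
same integral for the constant field `w`; the previous bound applies to each `s`. -/
theorem IsPolarGrad.lintegral_enorm_lconv_mul_sub_le (h : IsPolarGrad Ω g σ Λ) (hΩ : IsOpen Ω)
    (hg : MemLp g ∞ (volume.restrict Ω)) {k : G → ℝ}
    (hk : IsKernel k) (w v : Horiz G) {A B : Set G} (hA : MeasurableSet A)
    (hB : MeasurableSet B) (hBΩ : B ⊆ Ω)
    (hAB : ∀ s ∈ Icc (0 : ℝ) 1, ∀ x ∈ A, ∀ y, x * (s • (v : G)) * y⁻¹ ∈ tsupport k → y ∈ B) :
    ∫⁻ x in A, ‖lconv k (Ω.indicator g) volume (x * v) - lconv k (Ω.indicator g) volume x -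
      inner ℝ w v‖ₑ ≤ ‖v‖ₑ * gradDefect σ Λ w B := by
  have hL : Continuous (lconv k σ Λ) :=
    continuous_lconv hk.continuous hk.hasCompactSupport h.integrable.locallyIntegrable
  have hc : Continuous fun p : G × ℝ => lconv k σ Λ (p.1 * (p.2 • (v : G))) - w :=
    (hL.comp (by fun_prop)).sub continuous_const
  calc ∫⁻ x in A, ‖lconv k (Ω.indicator g) volume (x * v) - lconv k (Ω.indicator g) volume x -
        inner ℝ w v‖ₑ
      ≤ ∫⁻ x in A, ∫⁻ s in Ioc (0 : ℝ) 1, ‖v‖ₑ * ‖lconv k σ Λ (x * (s • (v : G))) - w‖ₑ := by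
        refine setLIntegral_mono' hA fun x hx => ?_
        rw [h.lconv_sub hΩ hg hk.continuous hk.hasCompactSupport
          fun s hs y hy => hBΩ (hAB s hs x hx y hy)]
        have hcx : Continuous fun s : ℝ => lconv k σ Λ (x * (s • (v : G))) :=
          hL.comp (by fun_prop)
        have e : (∫ s in (0 : ℝ)..1, inner ℝ v (lconv k σ Λ (x * (s • (v : G))))) - inner ℝ w v =
            ∫ s in (0 : ℝ)..1, inner ℝ v (lconv k σ Λ (x * (s • (v : G))) - w) := by
          simp_rw [inner_sub_right]
          rw [intervalIntegral.integral_sub, intervalIntegral.integral_const, sub_zero, one_smul,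
            real_inner_comm w v]
          · exact (by fun_prop : Continuous _).intervalIntegrable _ _
          · exact intervalIntegrable_const
        rw [e, intervalIntegral.integral_of_le zero_le_one]
        refine (enorm_integral_le_lintegral_enorm _).trans (lintegral_mono fun s => ?_)
        simp only [← ofReal_norm]
        rw [← ENNReal.ofReal_mul (norm_nonneg _)]
        exact ENNReal.ofReal_le_ofReal (norm_inner_le_norm _ _)
    _ = ∫⁻ s in Ioc (0 : ℝ) 1, ∫⁻ x in A, ‖v‖ₑ * ‖lconv k σ Λ (x * (s • (v : G))) - w‖ₑ := by
        refine lintegral_lintegral_swap ?_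
        exact (measurable_const.mul hc.measurable.enorm).aemeasurable
    _ ≤ ∫⁻ _ in Ioc (0 : ℝ) 1, ‖v‖ₑ * gradDefect σ Λ w B := by
        refine setLIntegral_mono' measurableSet_Ioc fun s hs => ?_
        rw [lintegral_const_mul' _ _ enorm_ne_top]
        refine mul_le_mul_right (h.lintegral_enorm_lconv_sub_le hk w _ hA hB ?_) _
        exact fun x hx y hy => hAB s (Ioc_subset_Icc_self hs) x hx y (subset_tsupport k hy)
    _ = ‖v‖ₑ * gradDefect σ Λ w B := by simp

omit [StratifiedGroup G] in
theorem locallyIntegrable_indicator {E : Type*} [NormedAddCommGroup E] {f : G → E}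
    (hΩ : MeasurableSet Ω) (hf : MemLp f ∞ (volume.restrict Ω)) :
    LocallyIntegrable (Ω.indicator f) volume := by
  have h1 : MemLp (Ω.indicator f) ∞ volume := (memLp_indicator_iff_restrict hΩ).2 hf
  exact h1.locallyIntegrable le_top

variable (d : HomogeneousDist G)

omit [MeasurableSpace G] [BorelSpace G] in
theorem HomogeneousDist.hnorm_smul (v : Horiz G) {s : ℝ} (hs : 0 ≤ s) :
    d.hnorm (s • (v : G)) = s * d.hnorm (v : G) := by
  rcases hs.eq_or_lt with rfl | hs
  · rw [zero_smul, zero_mul, d.hnorm_zero]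
  · rw [← d.hnorm_dil hs, dil_of_mem v.2, pow_one]

/-- Mollify, use the bound for continuous kernels, and remove the mollification by Fatou's lemma.
The gap between `R + |v|` and `R'` leaves room for the support of the kernel. -/
theorem IsPolarGrad.lintegral_enorm_mul_sub_le (h : IsPolarGrad Ω g σ Λ) (hΩ : IsOpen Ω)
    (hg : MemLp g ∞ (volume.restrict Ω)) (w v : Horiz G) {x₀ : G} {R R' : ℝ}
    (hR : R + d.hnorm (v : G) < R') (hΩR : d.cball x₀ R' ⊆ Ω) :
    ∫⁻ x in d.cball x₀ R, ‖Ω.indicator g (x * v) - Ω.indicator g x - inner ℝ w v‖ₑ ≤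
      ‖v‖ₑ * gradDefect σ Λ w (d.cball x₀ R') := by
  obtain ⟨ρ, hρ⟩ := exists_isMollifier d
  set ε : ℕ → ℝ := fun n => 1 / ((n : ℝ) + 1) with hεdef
  have hε0 : ∀ n, 0 < ε n := fun n => by positivity
  have hεt : Tendsto ε atTop (𝓝 0) := tendsto_one_div_add_atTop_nhds_zero_nat
  have hεt' : Tendsto ε atTop (𝓝[>] 0) :=
    tendsto_nhdsWithin_iff.2 ⟨hεt, Eventually.of_forall hε0⟩
  have hli := locallyIntegrable_indicator hΩ.measurableSet hg
  set u : ℕ → G → ℝ := fun n => lconv (rescale ρ (ε n)) (Ω.indicator g) volume with hu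
  have huc : ∀ n, Continuous (u n) := fun n =>
    have hk := hρ.isKernel_rescale (hε0 n)
    continuous_lconv hk.continuous hk.hasCompactSupport hli
  have hae := hρ.ae_tendsto_lconv hli
  have hae' : ∀ᵐ x : G, Tendsto (fun ε => lconv (rescale ρ ε) (Ω.indicator g) volume (x * v))
      (𝓝[>] 0) (𝓝 (Ω.indicator g (x * v))) :=
    (measurePreserving_mul_right (volume : Measure G) (v : G)).quasiMeasurePreserving.ae hae
  let T : Set G := (fun p : ℝ × G => p.2 * (p.1 • (v : G))) '' (Icc (0 : ℝ) 1 ×ˢ d.cball x₀ R)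
  have hT : IsCompact T := (isCompact_Icc.prod (d.isCompact_cball x₀ R)).image (by fun_prop)
  have hTB : T ⊆ d.ball x₀ R' := by
    rintro _ ⟨⟨s, x⟩, ⟨hs, hx⟩, rfl⟩
    rw [d.mem_ball', ← mul_assoc]
    rw [d.mem_cball] at hx
    refine ((d.hnorm_mul_le _ _).trans (add_le_add hx ?_)).trans_lt hR
    rw [d.hnorm_smul v hs.1]
    exact mul_le_of_le_one_left (d.hnorm_nonneg _) hs.2
  obtain ⟨V, hV, hVB⟩ := compact_open_separated_mul_left hT (d.isOpen_ball x₀ R') hTB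
  rw [one_eq_zero] at hV
  obtain ⟨η, hη, hηV⟩ := d.exists_hnorm_lt_subset hV
  have hbound : ∀ᶠ n in atTop, ∫⁻ x in d.cball x₀ R, ‖u n (x * v) - u n x - inner ℝ w v‖ₑ ≤
      ‖v‖ₑ * gradDefect σ Λ w (d.cball x₀ R') := by
    filter_upwards [hεt.eventually_lt_const hη] with n hn
    refine h.lintegral_enorm_lconv_mul_sub_le hΩ hg (hρ.isKernel_rescale (hε0 n)) w v
      (d.isClosed_cball x₀ R).measurableSet (d.isClosed_cball x₀ R').measurableSet hΩR ?_
    intro s hs x hx y hy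
    have h1 : d.hnorm (x * (s • (v : G)) * y⁻¹) ≤ ε n := hρ.tsupport_rescale_subset (hε0 n) hy
    refine d.ball_subset_cball x₀ R' (hVB ⟨(x * (s • (v : G)) * y⁻¹)⁻¹, hηV _ ?_,
      x * (s • (v : G)), ⟨⟨s, x⟩, ⟨hs, hx⟩, rfl⟩, by group⟩)
    rw [d.hnorm_inv]
    linarith
  calc ∫⁻ x in d.cball x₀ R, ‖Ω.indicator g (x * v) - Ω.indicator g x - inner ℝ w v‖ₑ
      = ∫⁻ x in d.cball x₀ R, liminf (fun n => ‖u n (x * v) - u n x - inner ℝ w v‖ₑ) atTop := by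
        refine lintegral_congr_ae (ae_restrict_of_ae ?_)
        filter_upwards [hae, hae'] with x hx hx'
        refine (Tendsto.liminf_eq ?_).symm
        exact (((hx'.comp hεt').sub (hx.comp hεt')).sub_const _).enorm
    _ ≤ liminf (fun n => ∫⁻ x in d.cball x₀ R, ‖u n (x * v) - u n x - inner ℝ w v‖ₑ) atTop := by
        refine lintegral_liminf_le fun n => ?_
        have := huc n
        exact (by fun_prop : Continuous fun x => u n (x * v) - u n x - inner ℝ w v).measurable.enorm
    _ ≤ ‖v‖ₑ * gradDefect σ Λ w (d.cball x₀ R') := liminf_le_of_frequently_le' hbound.frequently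

omit [MeasurableSpace G] [BorelSpace G] in
theorem inner_horiz_proj (w : Horiz G) (x : G) :
    inner ℝ (w : G) (proj G 1 x) = inner ℝ (w : G) x := by
  conv_rhs => rw [← proj_of_mem w.2]
  exact (Submodule.inner_starProjection_left_eq_right _ _ _).symm

-- Only the first layer is seen by `w`, and there the group operation is additive.
omit [MeasurableSpace G] [BorelSpace G] in
theorem inner_horiz_mul (w : Horiz G) (x y : G) :
    inner ℝ (w : G) (x * y) = inner ℝ (w : G) x + inner ℝ (w : G) y := by
  rw [← inner_horiz_proj, proj_one_mul, inner_add_right, inner_horiz_proj, inner_horiz_proj]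

theorem aemeasurable_indicator_mul {f : G → ℝ} (hΩ : MeasurableSet Ω)
    (hf : MemLp f ∞ (volume.restrict Ω)) (z : G) :
    AEMeasurable (fun x => Ω.indicator f (x * z)) volume :=
  ((aestronglyMeasurable_indicator_iff hΩ).2 hf.1).aemeasurable.comp_quasiMeasurePreserving
    (measurePreserving_mul_right (volume : Measure G) z).quasiMeasurePreserving

omit [MeasurableSpace G] [BorelSpace G] in
theorem horizBall_pow_hnorm_le {a b : ℝ} (hb : ∀ v ∈ horizBall G a, d.hnorm v ≤ b) (n : ℕ) :
    ∀ z ∈ horizBall G a ^ n, d.hnorm z ≤ n * b := by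
  induction n with
  | zero =>
    intro z hz
    rw [pow_zero, Set.mem_one, one_eq_zero] at hz
    rw [hz, d.hnorm_zero]; simp
  | succ n ih =>
    intro z hz
    rw [pow_succ] at hz
    obtain ⟨z', hz', v, hv, rfl⟩ := hz
    refine (d.hnorm_mul_le _ _).trans ((add_le_add (ih z' hz') (hb v hv)).trans ?_)
    push_cast
    linarith

/-- The increment telescopes over the `n` horizontal factors of `z`, and so does the homomorphism
`⟨w, ·⟩`. Each factor costs one application of the horizontal estimate, on a ball enlarged by `b`.
-/
theorem IsPolarGrad.lintegral_enorm_mul_pow_sub_le (h : IsPolarGrad Ω g σ Λ) (hΩ : IsOpen Ω)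
    (hg : MemLp g ∞ (volume.restrict Ω)) (w : Horiz G) {x₀ : G} {R a b : ℝ}
    (hb : ∀ v ∈ horizBall G a, d.hnorm v < b) (n : ℕ) (hΩR : d.cball x₀ (R + n * b) ⊆ Ω) :
    ∀ z ∈ horizBall G a ^ n,
    ∫⁻ x in d.cball x₀ R, ‖Ω.indicator g (x * z) - Ω.indicator g x - inner ℝ (w : G) z‖ₑ ≤
      n * (ENNReal.ofReal a * gradDefect σ Λ w (d.cball x₀ (R + n * b))) := by
  induction n with
  | zero =>
    intro z hz
    rw [pow_zero, Set.mem_one, one_eq_zero] at hz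
    rw [hz]
    simp [mul_zero']
  | succ n ih =>
    intro z hz
    rw [pow_succ] at hz
    obtain ⟨z', hz', v, hv, rfl⟩ := hz
    have hb0 : 0 < b := (d.hnorm_nonneg _).trans_lt (hb v hv)
    have hmono : d.cball x₀ (R + n * b) ⊆ d.cball x₀ (R + (n + 1 : ℕ) * b) :=
      fun y (hy : d.dist y x₀ ≤ _) => show d.dist y x₀ ≤ _ by push_cast; linarith
    have ih' := (ih (hmono.trans hΩR) z' hz').trans
      (mul_le_mul_right (mul_le_mul_right (measure_mono hmono) _) _)
    have hz'n := horizBall_pow_hnorm_le d (fun v hv => (hb v hv).le) n z' hz'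
    have h1 := h.lintegral_enorm_mul_sub_le d hΩ hg w ⟨v, hv.1⟩ (x₀ := x₀) (R := R + n * b)
      (R' := R + (n + 1 : ℕ) * b) (by
        have := hb v hv
        push_cast
        linarith) hΩR
    -- The last increment starts at `x z'`; right translation by `z'` preserves the volume and moves
    -- the domain into the enlarged ball.
    have h2 : ∫⁻ x in d.cball x₀ R, ‖Ω.indicator g (x * z' * v) - Ω.indicator g (x * z') -
        inner ℝ (w : G) v‖ₑ ≤
        ENNReal.ofReal a * gradDefect σ Λ w (d.cball x₀ (R + (n + 1 : ℕ) * b)) := by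
      calc _ ≤ ∫⁻ x in (fun x => x * z') ⁻¹' d.cball x₀ (R + n * b), ‖Ω.indicator g (x * z' * v) -
            Ω.indicator g (x * z') - inner ℝ (w : G) v‖ₑ := by
            refine lintegral_mono_set fun x hx => ?_
            rw [mem_preimage, d.mem_cball, ← mul_assoc]
            rw [d.mem_cball] at hx
            exact (d.hnorm_mul_le _ _).trans (add_le_add hx hz'n)
        _ = ∫⁻ x in d.cball x₀ (R + n * b), ‖Ω.indicator g (x * v) -
            Ω.indicator g x - inner ℝ (w : G) v‖ₑ :=
            (measurePreserving_mul_right (volume : Measure G) z').setLIntegral_comp_preimage_emb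
              (measurableEmbedding_mulRight z')
              (fun x => ‖Ω.indicator g (x * v) - Ω.indicator g x - inner ℝ (w : G) v‖ₑ) _
        _ ≤ _ := by
            refine h1.trans (mul_le_mul_left ?_ _)
            rw [← ofReal_norm]
            exact ENNReal.ofReal_le_ofReal hv.2
    have hm : AEMeasurable (fun x => ‖Ω.indicator g (x * z' * v) - Ω.indicator g (x * z') -
        inner ℝ (w : G) v‖ₑ) (volume.restrict (d.cball x₀ R)) := by
      simp_rw [mul_assoc]
      exact ((((aemeasurable_indicator_mul hΩ.measurableSet hg _).sub
        (aemeasurable_indicator_mul hΩ.measurableSet hg _)).sub_const _).enorm).restrict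
    calc ∫⁻ x in d.cball x₀ R,
          ‖Ω.indicator g (x * (z' * v)) - Ω.indicator g x - inner ℝ (w : G) (z' * v)‖ₑ
        ≤ ∫⁻ x in d.cball x₀ R, (‖Ω.indicator g (x * z' * v) - Ω.indicator g (x * z') -
            inner ℝ (w : G) v‖ₑ +
            ‖Ω.indicator g (x * z') - Ω.indicator g x - inner ℝ (w : G) z'‖ₑ) := by
          refine lintegral_mono fun x => le_trans (le_of_eq ?_) (enorm_add_le _ _)
          rw [inner_horiz_mul, mul_assoc]
          congr 1
          ring
      _ ≤ _ := by
          rw [lintegral_add_left' hm]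
          refine (add_le_add h2 ih').trans (le_of_eq ?_)
          push_cast
          ring

end HorizontalDifferences

/-! ### Approximate differentiability -/

section ApproxDiff

open StratifiedGroup
open scoped Pointwise

variable {G : Type*} [NormedAddCommGroup G] [InnerProductSpace ℝ G] [FiniteDimensional ℝ G]
  [StratifiedGroup G] [MeasurableSpace G] [BorelSpace G]
  {Ω : Set G} {g : G → ℝ} {σ : G → Horiz G} {Λ : Measure G} (d : HomogeneousDist G)

namespace HomogeneousDist

theorem volume_cball (x : G) {r : ℝ} (hr : 0 < r) :
    volume (d.cball x r) = ENNReal.ofReal (r ^ homDim G) * volume {z : G | d.hnorm z ≤ 1} := by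
  rw [← volume_dil_image hr, ← measure_preimage_mul volume x (d.cball x r)]
  congr 1
  ext z
  rw [mem_preimage, d.mem_cball, inv_mul_cancel_left]
  constructor
  · intro hz
    refine ⟨dil r⁻¹ z, ?_, dil_dil_inv hr.ne' z⟩
    rw [mem_ofPred_eq, d.hnorm_dil (inv_pos.2 hr), inv_mul_le_iff₀ hr, mul_one]
    exact hz
  · rintro ⟨w, hw, rfl⟩
    rw [d.hnorm_dil hr]
    exact mul_le_of_le_one_right hr.le hw

theorem volume_cball_ne_zero (x : G) {r : ℝ} (hr : 0 < r) : volume (d.cball x r) ≠ 0 :=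
  ((d.volume_ball_pos x hr).trans_le (measure_mono (d.ball_subset_cball x r))).ne'

theorem volume_cball_ne_top (x : G) (r : ℝ) : volume (d.cball x r) ≠ ⊤ :=
  (d.isCompact_cball x r).measure_lt_top.ne

theorem volume_cball_mul (x : G) {r t : ℝ} (ht : 0 < t) (hr : 0 < r) :
    volume (d.cball x (t * r)) = ENNReal.ofReal (t ^ homDim G) * volume (d.cball x r) := by
  rw [d.volume_cball x hr, d.volume_cball x (mul_pos ht hr), mul_pow,
    ENNReal.ofReal_mul (by positivity), mul_assoc]

omit [MeasurableSpace G] [BorelSpace G] in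
theorem exists_hnorm_lt_of_mem_horizBall :
    ∃ m > 0, ∀ a > 0, ∀ v ∈ horizBall G a, d.hnorm v < m * a := by
  obtain ⟨m, hm⟩ := (isCompact_horizBall (G := G) 1).bddAbove_image d.continuous_hnorm.continuousOn
  refine ⟨|m| + 1, by positivity, fun a ha v hv => ?_⟩
  have h1 : a⁻¹ • v ∈ horizBall G 1 := by
    refine ⟨Submodule.smul_mem _ _ hv.1, ?_⟩
    rw [norm_smul, Real.norm_of_nonneg (inv_nonneg.2 ha.le), inv_mul_le_iff₀ ha, mul_one]
    exact hv.2
  have h2 : d.hnorm (a⁻¹ • v) ≤ m := hm ⟨_, h1, rfl⟩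
  have h3 := d.hnorm_smul ⟨v, hv.1⟩ (inv_nonneg.2 ha.le)
  rw [h3, inv_mul_le_iff₀ ha] at h2
  refine h2.trans_lt ?_
  nlinarith [le_abs_self m]

end HomogeneousDist

/-- Differences at distance `r` are controlled by the gradient measure. -/
theorem exists_lintegral_enorm_mul_sub_le : ∃ K > (0 : ℝ), ∃ κ > (0 : ℝ), ∀ {Ω : Set G} {g : G → ℝ}
    {σ : G → Horiz G} {Λ : Measure G}, IsPolarGrad Ω g σ Λ → IsOpen Ω →
    MemLp g ∞ (volume.restrict Ω) → ∀ (w : Horiz G) (x₀ : G) (r : ℝ), 0 < r →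
    d.cball x₀ (κ * r) ⊆ Ω → ∀ z, d.hnorm z ≤ 2 * r →
    ∫⁻ x in d.cball x₀ r, ‖Ω.indicator g (x * z) - Ω.indicator g x - inner ℝ (w : G) z‖ₑ ≤
      ENNReal.ofReal (K * r) * gradDefect σ Λ w (d.cball x₀ (κ * r)) := by
  obtain ⟨N, C, hC, hN⟩ := exists_mem_horizBall_pow d
  obtain ⟨m, hm, hmb⟩ := d.exists_hnorm_lt_of_mem_horizBall
  -- A `z` of size at most `2 r` needs `N` factors of norm at most `C (2 r)`, each of homogeneous
  -- size less than `m C (2 r)`. The `+ 1` in `N + 1` makes the constant positive.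
  refine ⟨(N + 1) * (C * 2), by positivity, 1 + N * (m * (C * 2)), by positivity, ?_⟩
  intro Ω g σ Λ h hΩ hg w x₀ r hr hsub z hz
  have e : (1 + N * (m * (C * 2))) * r = r + N * (m * (C * (2 * r))) := by ring
  rw [e] at hsub ⊢
  have ha : 0 < C * (2 * r) := by positivity
  refine (h.lintegral_enorm_mul_pow_sub_le d hΩ hg w (hmb _ ha) N hsub z
    (hN (2 * r) (by positivity) z hz)).trans ?_
  rw [← mul_assoc]
  refine mul_le_mul_left ?_ _
  rw [← ENNReal.ofReal_natCast, ← ENNReal.ofReal_mul (by positivity)]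
  refine ENNReal.ofReal_le_ofReal ?_
  nlinarith

/-- The first order remainder. -/
def remainder (Ω : Set G) (g : G → ℝ) (w : Horiz G) (x₀ x : G) : ℝ :=
  Ω.indicator g x - Ω.indicator g x₀ - inner ℝ (w : G) (x₀⁻¹ * x)

theorem aemeasurable_remainder (hΩ : MeasurableSet Ω) (hg : MemLp g ∞ (volume.restrict Ω))
    (w : Horiz G) (x₀ : G) : AEMeasurable (remainder Ω g w x₀) volume := by
  refine AEMeasurable.sub (((aestronglyMeasurable_indicator_iff hΩ).2 hg.1).aemeasurable.sub_const
    _) (Continuous.aemeasurable (by fun_prop))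

omit [MeasurableSpace G] [BorelSpace G] in
theorem remainder_mul_sub (Ω : Set G) (g : G → ℝ) (w : Horiz G) (x₀ x z : G) :
    remainder Ω g w x₀ (x * z) - remainder Ω g w x₀ x =
      Ω.indicator g (x * z) - Ω.indicator g x - inner ℝ (w : G) z := by
  rw [remainder, remainder, ← mul_assoc, inner_horiz_mul w (x₀⁻¹ * x)]
  ring

/-- A Poincaré-type comparison of two concentric means: `|f x| ≤ |f y| + |f y - f x|` is averaged
over `x` in the large ball and `y = x z` in the small one, where `z` has size at most `2 r`.
Increments of the remainder do not involve the centre (`remainder_mul_sub`), so the estimate for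
fixed `z` applies. -/
theorem exists_average_remainder_le : ∃ K > (0 : ℝ), ∃ κ > (0 : ℝ), ∀ {Ω : Set G} {g : G → ℝ}
    {σ : G → Horiz G} {Λ : Measure G}, IsPolarGrad Ω g σ Λ → IsOpen Ω →
    MemLp g ∞ (volume.restrict Ω) → ∀ (w : Horiz G) (x₀ : G) (r : ℝ), 0 < r →
    d.cball x₀ (κ * r) ⊆ Ω →
    (∫⁻ x in d.cball x₀ r, ‖remainder Ω g w x₀ x‖ₑ) / volume (d.cball x₀ r) ≤
      (∫⁻ x in d.cball x₀ (r / 2), ‖remainder Ω g w x₀ x‖ₑ) / volume (d.cball x₀ (r / 2)) +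
      ENNReal.ofReal (K * r) *
        (gradDefect σ Λ w (d.cball x₀ (κ * r)) / volume (d.cball x₀ (κ * r))) := by
  obtain ⟨K, hK, κ, hκ, hmain⟩ := exists_lintegral_enorm_mul_sub_le d
  -- The factor `4 ^ Q` compares the balls of radius `2 r` and `r / 2`, the factor `κ ^ Q` those of
  -- radius `κ r` and `r`.
  refine ⟨4 ^ homDim G * κ ^ homDim G * K, by positivity, κ, hκ, ?_⟩
  intro Ω g σ Λ h hΩ hg w x₀ r hr hsub
  set f := remainder Ω g w x₀ with hf
  set B : ℝ → Set G := fun r => d.cball x₀ r with hB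
  have hfm : AEMeasurable f volume := aemeasurable_remainder hΩ.measurableSet hg w x₀
  have hBm : ∀ t, MeasurableSet (B t) := fun t => (d.isClosed_cball x₀ t).measurableSet
  have hr2 : 0 < r / 2 := by positivity
  have hz := hmain h hΩ hg w x₀ r hr hsub
  simp_rw [← remainder_mul_sub Ω g w x₀] at hz
  have hDm : AEMeasurable (Function.uncurry fun x z => ‖f (x * z) - f x‖ₑ)
      ((volume : Measure G).prod volume) := by
    refine (AEMeasurable.sub ?_ hfm.comp_fst).enorm
    have hq := Measure.quasiMeasurePreserving_snd.comp
      (measurePreserving_prod_mul (volume : Measure G) volume).quasiMeasurePreserving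
    exact hfm.comp_quasiMeasurePreserving hq
  have h0 : volume (B (r / 2)) * ∫⁻ x in B r, ‖f x‖ₑ ≤
      volume (B r) * (∫⁻ x in B (r / 2), ‖f x‖ₑ) +
      ∫⁻ x in B r, ∫⁻ z in {z | d.hnorm z ≤ 2 * r}, ‖f (x * z) - f x‖ₑ := by
    calc volume (B (r / 2)) * ∫⁻ x in B r, ‖f x‖ₑ
        = ∫⁻ x in B r, ∫⁻ _ in B (r / 2), ‖f x‖ₑ := by
          simp_rw [setLIntegral_const]
          rw [lintegral_mul_const'' _ hfm.enorm.restrict, mul_comm]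
      _ ≤ ∫⁻ x in B r, ((∫⁻ y in B (r / 2), ‖f y‖ₑ) +
            ∫⁻ z in {z | d.hnorm z ≤ 2 * r}, ‖f (x * z) - f x‖ₑ) := by
          refine setLIntegral_mono' (hBm r) fun x hx => ?_
          have h1 : ∫⁻ _ in B (r / 2), ‖f x‖ₑ ≤
              ∫⁻ y in B (r / 2), (‖f y‖ₑ + ‖f y - f x‖ₑ) := by
            refine lintegral_mono fun y => ?_
            have := enorm_sub_le (a := f y) (b := f y - f x)
            rwa [sub_sub_cancel] at this
          refine h1.trans ?_
          rw [lintegral_add_left' hfm.enorm.restrict]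
          refine add_le_add le_rfl ?_
          rw [← (measurePreserving_mul_left (volume : Measure G) x).setLIntegral_comp_preimage_emb
            (measurableEmbedding_mulLeft x) (fun y => ‖f y - f x‖ₑ)]
          refine lintegral_mono_set fun z hz' => ?_
          have hz1 : d.hnorm (x₀⁻¹ * (x * z)) ≤ r / 2 := d.mem_cball.1 hz'
          have hx1 : d.hnorm (x₀⁻¹ * x) ≤ r := d.mem_cball.1 hx
          have e : z = (x₀⁻¹ * x)⁻¹ * (x₀⁻¹ * (x * z)) := by group
          rw [mem_ofPred_eq, e]
          refine (d.hnorm_mul_le _ _).trans ?_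
          rw [d.hnorm_inv]
          linarith
      _ = _ := by
          rw [lintegral_add_left measurable_const, setLIntegral_const, mul_comm]
  have h2 : ∫⁻ x in B r, ∫⁻ z in {z | d.hnorm z ≤ 2 * r}, ‖f (x * z) - f x‖ₑ ≤
      volume (B (2 * r)) * (ENNReal.ofReal (K * r) * gradDefect σ Λ w (B (κ * r))) := by
    rw [lintegral_lintegral_swap (by
      rw [Measure.prod_restrict]
      exact hDm.restrict)]
    calc _ ≤ ∫⁻ _ in {z | d.hnorm z ≤ 2 * r},
          (ENNReal.ofReal (K * r) * gradDefect σ Λ w (B (κ * r))) ∂(volume : Measure G) :=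
          setLIntegral_mono' (d.isCompact_hnorm_le _).measurableSet fun z hz1 => hz z hz1
      _ = _ := by
          rw [setLIntegral_const, mul_comm]
          congr 1
          rw [hB, ← d.preimage_mul_left_cball x₀, measure_preimage_mul]
  have hV0 : ∀ t > 0, volume (B t) ≠ 0 := fun t ht => d.volume_cball_ne_zero x₀ ht
  have hVt : ∀ t, volume (B t) ≠ ⊤ := fun t => d.volume_cball_ne_top x₀ t
  have h3 := h0.trans (add_le_add le_rfl h2)
  have h4 : volume (B (2 * r)) = ENNReal.ofReal (4 ^ homDim G) * volume (B (r / 2)) := by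
    rw [hB, ← d.volume_cball_mul x₀ (by norm_num) hr2]
    congr 2
    ring
  have h5 : volume (B (κ * r)) = ENNReal.ofReal (κ ^ homDim G) * volume (B r) :=
    d.volume_cball_mul x₀ hκ hr
  calc (∫⁻ x in B r, ‖f x‖ₑ) / volume (B r)
      = (volume (B (r / 2)) * ∫⁻ x in B r, ‖f x‖ₑ) / (volume (B (r / 2)) * volume (B r)) :=
        (ENNReal.mul_div_mul_left _ _ (hV0 _ hr2) (hVt _)).symm
    _ ≤ (volume (B r) * (∫⁻ x in B (r / 2), ‖f x‖ₑ) + volume (B (2 * r)) *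
          (ENNReal.ofReal (K * r) * gradDefect σ Λ w (B (κ * r)))) /
          (volume (B (r / 2)) * volume (B r)) := ENNReal.div_le_div_right h3 _
    _ = _ := by
        rw [ENNReal.add_div]
        congr 1
        · rw [mul_comm (volume (B (r / 2))), ENNReal.mul_div_mul_left _ _ (hV0 _ hr) (hVt _)]
        · have hκ0 : ENNReal.ofReal (κ ^ homDim G) ≠ 0 := by
            rw [Ne, ENNReal.ofReal_eq_zero, not_le]; positivity
          rw [h4, h5, mul_comm (ENNReal.ofReal (4 ^ homDim G)), mul_assoc,
            ENNReal.mul_div_mul_left _ _ (hV0 _ hr2) (hVt _),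
            ← ENNReal.mul_div_mul_left _ _ hκ0 ENNReal.ofReal_ne_top, ← mul_div_assoc]
          congr 1
          have e : ENNReal.ofReal (4 ^ homDim G * κ ^ homDim G * K * r) =
              ENNReal.ofReal (4 ^ homDim G) * ENNReal.ofReal (κ ^ homDim G) *
                ENNReal.ofReal (K * r) := by
            rw [← ENNReal.ofReal_mul (by positivity), ← ENNReal.ofReal_mul (by positivity)]
            congr 1
            ring
          rw [e]
          change _ = _ * gradDefect σ Λ w (B (κ * r))
          ring

end ApproxDiff

/-! ### Approximate differentiability at almost every point. -/

section ApproxDiffAE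

open StratifiedGroup

variable {G : Type*} [NormedAddCommGroup G] [InnerProductSpace ℝ G] [FiniteDimensional ℝ G]
  [StratifiedGroup G]

theorem isHHom_inner (w : Horiz G) : IsHHom fun y : G => (inner ℝ (w : G) y : ℝ) := by
  refine ⟨by fun_prop, inner_horiz_mul w, fun r _ x => ?_⟩
  change inner ℝ (w : G) (dil r x) = r * inner ℝ (w : G) x
  rw [← inner_horiz_proj, proj_dil, pow_one, real_inner_smul_right, inner_horiz_proj]

theorem MeasureTheory.ofReal_setAverage_norm {X E : Type*} [MeasurableSpace X]
    [NormedAddCommGroup E] {μ : Measure X} {s : Set X} {f : X → E} (hf : IntegrableOn f s μ)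
    (h0 : μ s ≠ 0) (ht : μ s ≠ ⊤) :
    ENNReal.ofReal (⨍ x in s, ‖f x‖ ∂μ) = (∫⁻ x in s, ‖f x‖ₑ ∂μ) / μ s := by
  rw [setAverage_eq, smul_eq_mul, ENNReal.ofReal_mul (by positivity),
    ofReal_integral_norm_eq_lintegral_enorm hf, ENNReal.ofReal_inv_of_pos
    (show 0 < μ.real s from ENNReal.toReal_pos h0 ht), ofReal_measureReal ht,
    ENNReal.div_eq_inv_mul]

variable [MeasurableSpace G] [BorelSpace G]
  {Ω : Set G} {g : G → ℝ} {σ : G → Horiz G} {Λ : Measure G} (d : HomogeneousDist G)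

/-- The defect splits into the singular part, of density zero at `x₀`, and the mean oscillation of
the absolutely continuous density, which vanishes at a Lebesgue point. -/
theorem tendsto_gradDefect_div (hW : Integrable (acDensity σ Λ) volume) {x₀ : G}
    (h1 : Tendsto (fun r => ⨍ y in d.cball x₀ r, ‖acDensity σ Λ y - acDensity σ Λ x₀‖)
      (𝓝[>] 0) (𝓝 0))
    (h2 : Tendsto (fun r => Λ.singularPart volume (d.cball x₀ r) / volume (d.cball x₀ r))
      (𝓝[>] 0) (𝓝 0)) :
    Tendsto (fun r => gradDefect σ Λ (acDensity σ Λ x₀) (d.cball x₀ r) / volume (d.cball x₀ r))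
      (𝓝[>] 0) (𝓝 0) := by
  have h3 := h2.add (ENNReal.tendsto_ofReal h1)
  rw [ENNReal.ofReal_zero, add_zero] at h3
  refine h3.congr' ?_
  filter_upwards [self_mem_nhdsWithin] with r (hr : 0 < r)
  have hi : IntegrableOn (fun y => acDensity σ Λ y - acDensity σ Λ x₀) (d.cball x₀ r) volume :=
    hW.integrableOn.sub (integrableOn_const (d.volume_cball_ne_top x₀ r))
  rw [ofReal_setAverage_norm hi (d.volume_cball_ne_zero x₀ hr) (d.volume_cball_ne_top x₀ r),
    gradDefect, Measure.add_apply, ENNReal.add_div,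
    withDensity_apply _ (d.isClosed_cball x₀ r).measurableSet]

/-- No rate is obtained here; convergence to zero only serves to close the iteration over halved
radii. -/
theorem tendsto_average_remainder (hg : LocallyIntegrable (Ω.indicator g) volume) (w : Horiz G)
    {x₀ : G}
    (h1 : Tendsto (fun r => ⨍ y in d.cball x₀ r, ‖Ω.indicator g y - Ω.indicator g x₀‖)
      (𝓝[>] 0) (𝓝 0)) :
    Tendsto (fun r => (∫⁻ x in d.cball x₀ r, ‖remainder Ω g w x₀ x‖ₑ) / volume (d.cball x₀ r))
      (𝓝[>] 0) (𝓝 0) := by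
  rw [ENNReal.tendsto_nhds_zero]
  intro ε hε
  have hε2 : 0 < ε / 2 := ENNReal.half_pos hε.ne'
  have h2 := ENNReal.tendsto_ofReal h1
  rw [ENNReal.ofReal_zero, ENNReal.tendsto_nhds_zero] at h2
  have hc : Continuous fun z : G => ‖(inner ℝ (w : G) z : ℝ)‖ₑ := by fun_prop
  have hc0 := hc.tendsto 0
  rw [inner_zero_right, enorm_zero] at hc0
  obtain ⟨η, hη, hηb⟩ := d.exists_hnorm_lt_subset (hc0.eventually_le_const hε2)
  filter_upwards [self_mem_nhdsWithin, h2 (ε / 2) hε2,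
    mem_nhdsWithin_of_mem_nhds (gt_mem_nhds hη)] with r (hr : 0 < r) h3 (hrη : r < η)
  have h0 := d.volume_cball_ne_zero x₀ hr
  have ht := d.volume_cball_ne_top x₀ r
  have hi : IntegrableOn (fun y => Ω.indicator g y - Ω.indicator g x₀) (d.cball x₀ r) volume :=
    (hg.integrableOn_isCompact (d.isCompact_cball x₀ r)).sub (integrableOn_const ht)
  rw [ofReal_setAverage_norm hi h0 ht] at h3
  calc (∫⁻ x in d.cball x₀ r, ‖remainder Ω g w x₀ x‖ₑ) / volume (d.cball x₀ r)
      ≤ (∫⁻ x in d.cball x₀ r, (‖Ω.indicator g x - Ω.indicator g x₀‖ₑ + ε / 2)) /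
          volume (d.cball x₀ r) := by
        refine ENNReal.div_le_div_right (setLIntegral_mono'
          (d.isClosed_cball x₀ r).measurableSet fun x hx => ?_) _
        refine enorm_sub_le.trans (add_le_add le_rfl (hηb _ ?_))
        exact (d.mem_cball.1 hx).trans_lt hrη
    _ = (∫⁻ x in d.cball x₀ r, ‖Ω.indicator g x - Ω.indicator g x₀‖ₑ) /
          volume (d.cball x₀ r) + ε / 2 := by
        rw [lintegral_add_right _ measurable_const, setLIntegral_const, ENNReal.add_div,
          ENNReal.mul_div_cancel_right h0 ht]
    _ ≤ ε / 2 + ε / 2 := add_le_add h3 le_rfl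
    _ = ε := ENNReal.add_halves ε

/-- Iterating over `r, r/2, r/4, …` sums the geometric series `η r (1 + 1/2 + 1/4 + …) = 2 η r`,
while the starting term tends to zero. -/
theorem le_ofReal_of_halving {b : ℝ → ℝ≥0∞} {η r₀ : ℝ} (hη : 0 ≤ η)
    (hb : ∀ r, 0 < r → r < r₀ → b r ≤ b (r / 2) + ENNReal.ofReal (η * r))
    (h0 : Tendsto b (𝓝[>] 0) (𝓝 0)) {r : ℝ} (hr : 0 < r) (hr₀ : r < r₀) :
    b r ≤ ENNReal.ofReal (2 * η * r) := by
  have hind : ∀ n : ℕ, b r ≤ b (r / 2 ^ n) + ENNReal.ofReal (2 * η * (r - r / 2 ^ n)) := by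
    intro n
    induction n with
    | zero => simp
    | succ n ih =>
      have h1 : r / 2 ^ n ≤ r := div_le_self hr.le (one_le_pow₀ one_le_two)
      refine ih.trans ((add_le_add (hb (r / 2 ^ n) (by positivity) (h1.trans_lt hr₀))
        le_rfl).trans (le_of_eq ?_))
      have e : r / 2 ^ n / 2 = r / 2 ^ (n + 1) := by rw [pow_succ, div_div]
      rw [add_assoc, ← ENNReal.ofReal_add (by positivity)
        (mul_nonneg (by positivity) (by linarith)), e]
      congr 2
      rw [← e]
      ring
  have ht : Tendsto (fun n : ℕ => r / 2 ^ n) atTop (𝓝[>] 0) := by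
    refine tendsto_nhdsWithin_iff.2 ⟨?_, Eventually.of_forall fun n => ?_⟩
    · have := (tendsto_pow_atTop_nhds_zero_of_lt_one (r := (1 / 2 : ℝ)) (by norm_num)
        (by norm_num)).const_mul r
      rw [mul_zero] at this
      refine this.congr fun n => ?_
      rw [one_div, inv_pow, div_eq_mul_inv]
    · exact (by positivity : 0 < r / 2 ^ n)
  have h2 := (h0.comp ht).add_const (ENNReal.ofReal (2 * η * r))
  rw [zero_add] at h2
  refine ge_of_tendsto' h2 fun n => (hind n).trans (add_le_add le_rfl
    (ENNReal.ofReal_le_ofReal (mul_le_mul_of_nonneg_left ?_ (by positivity))))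
  have : 0 < r / 2 ^ n := by positivity
  linarith

theorem IsPolarGrad.ae_hasApproxHorizGradAt (h : IsPolarGrad Ω g σ Λ) (hΩ : IsOpen Ω)
    (hg : MemLp g ∞ (volume.restrict Ω)) :
    ∀ᵐ x ∂(volume.restrict Ω), HasApproxHorizGradAt d g (acDensity σ Λ x) x := by
  have := h.finite
  have hli := locallyIntegrable_indicator hΩ.measurableSet hg
  obtain ⟨K, hK, κ, hκ, hstep⟩ := exists_average_remainder_le d
  rw [ae_restrict_iff' hΩ.measurableSet]
  filter_upwards [d.ae_tendsto_average_cball h.integrable_acDensity.locallyIntegrable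
    (Measure.mutuallySingular_singularPart Λ volume),
    d.ae_tendsto_average_cball hli (Θ := 0) Measure.MutuallySingular.zero_left]
    with x₀ hx hx' hx₀
  set w := acDensity σ Λ x₀
  refine ⟨fun y => inner ℝ (w : G) y, isHHom_inner w, fun y => rfl, ?_⟩
  have hD := tendsto_gradDefect_div d h.integrable_acDensity hx.1 hx.2
  have hb := tendsto_average_remainder d hli w hx'.1
  obtain ⟨R, hR, hRΩ⟩ := (d.isOpen_iff_dist Ω).1 hΩ x₀ hx₀
  have hsmall : ∀ t, t < R → d.cball x₀ t ⊆ Ω := fun t ht y (hy : d.dist y x₀ ≤ t) =>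
    hRΩ y (by rw [d.dist_comm]; linarith)
  have hkey : ∀ η > 0, ∀ᶠ r in 𝓝[>] (0 : ℝ),
      (∫⁻ x in d.cball x₀ r, ‖remainder Ω g w x₀ x‖ₑ) / volume (d.cball x₀ r) ≤
        ENNReal.ofReal (2 * η * r) := by
    intro η hη
    -- A mean defect of at most `η / K` turns the increment `K s` times the mean defect into `η s`,
    -- the form needed for the halving.
    have hD' := ENNReal.tendsto_nhds_zero.1 hD (ENNReal.ofReal (η / K))
      (ENNReal.ofReal_pos.2 (by positivity))
    obtain ⟨t, ht, htD⟩ := mem_nhdsGT_iff_exists_Ioo_subset.1 hD'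
    have ht : 0 < t := ht
    have hr₀ : 0 < min t R / κ := by positivity
    filter_upwards [self_mem_nhdsWithin, mem_nhdsWithin_of_mem_nhds (gt_mem_nhds hr₀)]
      with r (hr : 0 < r) (hrr₀ : r < min t R / κ)
    refine le_ofReal_of_halving (b := fun r =>
      (∫⁻ x in d.cball x₀ r, ‖remainder Ω g w x₀ x‖ₑ) / volume (d.cball x₀ r)) hη.le ?_ hb hr hrr₀
    intro s hs hs₀
    rw [lt_div_iff₀ hκ, mul_comm, lt_min_iff] at hs₀
    refine (hstep h hΩ hg w x₀ s hs (hsmall _ hs₀.2)).trans (add_le_add le_rfl ?_)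
    refine (mul_le_mul_right (htD ⟨by positivity, hs₀.1⟩) _).trans (le_of_eq ?_)
    rw [← ENNReal.ofReal_mul (by positivity)]
    congr 1
    field_simp
  rw [Metric.tendsto_nhds]
  intro ε hε
  -- The claim concerns open balls and the estimate closed ones, whose volume is at most `q` times
  -- larger; `η = ε / (4 q)` then leaves `ε / 2`.
  set q : ℝ := 2 ^ homDim G with hq
  have hq0 : 0 < q := by positivity
  have hη : 0 < ε / (4 * q) := by positivity
  filter_upwards [self_mem_nhdsWithin, hkey _ hη, mem_nhdsWithin_of_mem_nhds (gt_mem_nhds hR)]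
    with r (hr : 0 < r) hr1 (hrR : r < R)
  have hBΩ : d.ball x₀ r ⊆ Ω := (d.ball_subset_cball x₀ r).trans (hsmall r hrR)
  have h0 := d.volume_cball_ne_zero x₀ hr
  have ht := d.volume_cball_ne_top x₀ r
  have hvb : 0 < volume.real (d.ball x₀ r) :=
    ENNReal.toReal_pos (d.volume_ball_pos x₀ hr).ne' (d.volume_ball_lt_top x₀ r).ne
  have e1 : ∫ x in d.ball x₀ r, |g x - g x₀ - inner ℝ (w : G) (x₀⁻¹ * x)| / r =
      (∫⁻ x in d.ball x₀ r, ‖remainder Ω g w x₀ x‖ₑ).toReal / r := by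
    rw [← integral_norm_eq_lintegral_enorm
      (aemeasurable_remainder hΩ.measurableSet hg w x₀).aestronglyMeasurable.restrict,
      ← integral_div]
    refine setIntegral_congr_fun (d.isOpen_ball x₀ r).measurableSet fun x hx => ?_
    simp only [remainder]
    rw [indicator_of_mem (hBΩ hx), indicator_of_mem hx₀, Real.norm_eq_abs]
  rw [ENNReal.div_le_iff h0 ht] at hr1
  have e2 : (∫⁻ x in d.ball x₀ r, ‖remainder Ω g w x₀ x‖ₑ).toReal ≤
      2 * (ε / (4 * q)) * r * (q * volume.real (d.ball x₀ r)) := by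
    have h3 : volume (d.cball x₀ r) ≤ ENNReal.ofReal q * volume (d.ball x₀ r) :=
      d.volume_cball_le x₀ hr one_lt_two
    have h4 := (lintegral_mono_set (f := fun x => ‖remainder Ω g w x₀ x‖ₑ)
      (μ := volume) (d.ball_subset_cball x₀ r)).trans (hr1.trans (mul_le_mul_right h3 _))
    refine (ENNReal.toReal_mono ?_ h4).trans (le_of_eq ?_)
    · exact ENNReal.mul_ne_top ENNReal.ofReal_ne_top
        (ENNReal.mul_ne_top ENNReal.ofReal_ne_top (d.volume_ball_lt_top x₀ r).ne)
    · rw [ENNReal.toReal_mul, ENNReal.toReal_mul, ENNReal.toReal_ofReal (by positivity),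
        ENNReal.toReal_ofReal hq0.le]
      rfl
  rw [setAverage_eq, e1, Real.dist_eq, sub_zero, smul_eq_mul, abs_of_nonneg (by positivity)]
  calc (volume.real (d.ball x₀ r))⁻¹ *
        ((∫⁻ x in d.ball x₀ r, ‖remainder Ω g w x₀ x‖ₑ).toReal / r)
      ≤ (volume.real (d.ball x₀ r))⁻¹ *
        (2 * (ε / (4 * q)) * r * (q * volume.real (d.ball x₀ r)) / r) := by gcongr
    _ = ε / 2 := by
        field_simp
        norm_num
    _ < ε := by linarith

end ApproxDiffAE

/-! ### Pairings of a bounded field with mollified measures -/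

section Pairing

open StratifiedGroup

variable {G : Type*} [NormedAddCommGroup G] [InnerProductSpace ℝ G] [FiniteDimensional ℝ G]
  [StratifiedGroup G] [MeasurableSpace G] [BorelSpace G] {d : HomogeneousDist G} {ρ : G → ℝ}

omit [StratifiedGroup G] in
theorem MeasureTheory.MemLp.ae_norm_indicator_le {E : Type*} [NormedAddCommGroup E] {Ω : Set G}
    (hΩ : MeasurableSet Ω) {f : G → E} (hf : MemLp f ∞ (volume.restrict Ω)) :
    ∀ᵐ x, ‖Ω.indicator f x‖ ≤ (eLpNorm f ∞ (volume.restrict Ω)).toReal := by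
  have h1 : ∀ᵐ x ∂(volume.restrict Ω), ‖f x‖ ≤ (eLpNorm f ∞ (volume.restrict Ω)).toReal := by
    filter_upwards [ae_le_eLpNormEssSup (f := f) (μ := volume.restrict Ω)] with x hx
    rw [eLpNorm_exponent_top, ← toReal_enorm]
    exact ENNReal.toReal_mono (eLpNorm_exponent_top (f := f) ▸ hf.2.ne) hx
  filter_upwards [(ae_restrict_iff' hΩ).1 h1] with x hx
  by_cases hxΩ : x ∈ Ω
  · rw [indicator_of_mem hxΩ]
    exact hx hxΩ
  · rw [indicator_of_notMem hxΩ, norm_zero]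
    exact ENNReal.toReal_nonneg

/-- Multiplication by a continuous compactly supported function almost commutes with
mollification. -/
theorem IsMollifier.eventually_norm_lconv_smul_sub_le (hρ : IsMollifier d ρ) {φ : G → ℝ}
    (hφ : Continuous φ) (hφs : HasCompactSupport φ) {H : Type*} [NormedAddCommGroup H]
    [NormedSpace ℝ H] {f : G → H} (hf : AEStronglyMeasurable f volume)
    {M : ℝ} (hM : ∀ᵐ x, ‖f x‖ ≤ M) {δ : ℝ} (hδ : 0 < δ) :
    ∀ᶠ ε in 𝓝[>] (0 : ℝ), ∀ y, ‖lconv (rescale ρ ε) (fun x => φ x • f x) volume y -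
      φ y • lconv (rescale ρ ε) f volume y‖ ≤ δ * M := by
  obtain ⟨η, hη, hηb⟩ := d.exists_hnorm_lt_subset (eventually_norm_translate_sub_le hφ hφs hδ)
  filter_upwards [self_mem_nhdsWithin, mem_nhdsWithin_of_mem_nhds (gt_mem_nhds hη)]
    with ε (hε : 0 < ε) (hεη : ε < η) y
  have hk := hρ.isKernel_rescale hε
  obtain ⟨C, hC⟩ := hφs.exists_bound_of_continuous hφ
  have hc : Continuous fun x => rescale ρ ε (y * x⁻¹) := hk.continuous.comp (by fun_prop)
  have hi : Integrable (fun x => rescale ρ ε (y * x⁻¹) • f x) volume := by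
    refine ((hk.integrable_mul_inv y).mul_const M).mono' (hc.aestronglyMeasurable.smul hf) ?_
    filter_upwards [hM] with x hx
    rw [norm_smul, Real.norm_of_nonneg (hk.nonneg _)]
    exact mul_le_mul_of_nonneg_left hx (hk.nonneg _)
  have hi2 : Integrable (fun x => rescale ρ ε (y * x⁻¹) • φ x • f x) volume := by
    simp_rw [smul_comm _ (φ _)]
    exact hi.bdd_smul C hφ.aestronglyMeasurable (Eventually.of_forall hC)
  have e : lconv (rescale ρ ε) (fun x => φ x • f x) volume y - φ y • lconv (rescale ρ ε) f volume y
      = ∫ x, rescale ρ ε (y * x⁻¹) • (φ x - φ y) • f x := by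
    simp_rw [sub_smul, smul_sub]
    rw [integral_sub hi2 (by
      simp_rw [smul_comm _ (φ y)]
      exact hi.smul (φ y)), lconv, lconv, ← integral_smul]
    simp_rw [smul_comm _ (φ y)]
  rw [e]
  calc ‖∫ x, rescale ρ ε (y * x⁻¹) • (φ x - φ y) • f x‖
      ≤ ∫ x, rescale ρ ε (y * x⁻¹) * (δ * M) := by
        refine norm_integral_le_of_norm_le ((hk.integrable_mul_inv y).mul_const _) ?_
        filter_upwards [hM] with x hx
        rw [norm_smul, Real.norm_of_nonneg (hk.nonneg _), norm_smul]
        by_cases h : rescale ρ ε (y * x⁻¹) = 0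
        · simp [h]
        · refine mul_le_mul_of_nonneg_left (mul_le_mul ?_ hx (norm_nonneg _) hδ.le) (hk.nonneg _)
          have h1 := hηb _ ((hρ.hnorm_lt hε h).trans hεη) y
          simpa using! h1
    _ = δ * M := by rw [integral_mul_const, hk.integral_mul_inv, one_mul]

variable {Ω : Set G} {F : G → Horiz G} {σ : G → Horiz G} {Θ : Measure G} [IsFiniteMeasure Θ]

/-- By symmetry of the kernel the mollification passes from `σ Θ` to `φ F`, and `φ` can be pulled
out of it up to a uniformly small error. So convergence need only be known for continuous functions
`⟨ρ_ε * F, ·⟩` paired with `Θ`. -/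
theorem IsMollifier.tendsto_pairing (hρ : IsMollifier d ρ) (hΩ : MeasurableSet Ω)
    (hF : MemLp F ∞ (volume.restrict Ω)) (hσ : Measurable σ) (hσ1 : ∀ᵐ x ∂Θ, ‖σ x‖ = 1)
    {ε : ℕ → ℝ} (hε0 : ∀ k, 0 < ε k) (hε : Tendsto ε atTop (𝓝 0)) {φ : G → ℝ}
    (hφ : Continuous φ) (hφs : HasCompactSupport φ) {ℓ : ℝ}
    (hℓ : Tendsto (fun k => ∫ y, φ y *
      inner ℝ (lconv (rescale ρ (ε k)) (Ω.indicator F) volume y) (σ y) ∂Θ) atTop (𝓝 ℓ)) :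
    Tendsto (fun k => ∫ x in Ω, φ x * inner ℝ (F x) (mollifyMeasure ρ (ε k) σ Θ x)) atTop
      (𝓝 ℓ) := by
  set M := (eLpNorm F ∞ (volume.restrict Ω)).toReal with hMdef
  have hM : ∀ᵐ x, ‖Ω.indicator F x‖ ≤ M := hF.ae_norm_indicator_le hΩ
  have hM0 : 0 ≤ M := ENNReal.toReal_nonneg
  have hFm : AEStronglyMeasurable (Ω.indicator F) volume :=
    (aestronglyMeasurable_indicator_iff hΩ).2 hF.1
  have hli : LocallyIntegrable (Ω.indicator F) volume := locallyIntegrable_indicator hΩ hF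
  obtain ⟨C, hC⟩ := hφs.exists_bound_of_continuous hφ
  have hσi : Integrable σ Θ := Integrable.of_bound (C := 1) hσ.aestronglyMeasurable
    (hσ1.mono fun x hx => hx.le)
  have hφF : ∀ᵐ x, ‖φ x • Ω.indicator F x‖ ≤ C * M := by
    filter_upwards [hM] with x hx
    rw [norm_smul]
    exact mul_le_mul (hC x) hx (norm_nonneg _) ((norm_nonneg _).trans (hC x))
  have hφFm : AEStronglyMeasurable (fun x => φ x • Ω.indicator F x) volume :=
    hφ.aestronglyMeasurable.smul hFm
  have hφFli : LocallyIntegrable (fun x => φ x • Ω.indicator F x) volume :=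
    hli.continuous_smul hφ
  have hε' : Tendsto ε atTop (𝓝[>] 0) :=
    tendsto_nhdsWithin_iff.2 ⟨hε, Eventually.of_forall hε0⟩
  have e1 : ∀ k, ∫ x in Ω, φ x * inner ℝ (F x) (mollifyMeasure ρ (ε k) σ Θ x) =
      ∫ y, inner ℝ (lconv (rescale ρ (ε k)) (fun x => φ x • Ω.indicator F x) volume y)
        (σ y) ∂Θ := by
    intro k
    rw [← (hρ.isKernel_rescale (hε0 k)).integral_inner_lconv (hρ.rescale_inv (ε k)) hσi hφFm hφF,
      ← integral_indicator hΩ]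
    congr 1 with x
    by_cases hx : x ∈ Ω
    · rw [indicator_of_mem hx, indicator_of_mem hx, real_inner_smul_left]
      rfl
    · simp [hx]
  have hbdi : ∀ (u : G → Horiz G) (B : ℝ), Continuous u → (∀ y, ‖u y‖ ≤ B) →
      Integrable (fun y => (inner ℝ (u y) (σ y) : ℝ)) Θ := by
    intro u B hu hB
    refine Integrable.of_bound (C := B) (hu.aestronglyMeasurable.inner hσ.aestronglyMeasurable) ?_
    filter_upwards [hσ1] with y hy
    refine (norm_inner_le_norm _ _).trans ?_
    rw [hy, mul_one]
    exact hB y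
  simp_rw [e1]
  have hdiff : Tendsto (fun k => ∫ y, inner ℝ (lconv (rescale ρ (ε k))
      (fun x => φ x • Ω.indicator F x) volume y) (σ y) ∂Θ - ∫ y, φ y *
      inner ℝ (lconv (rescale ρ (ε k)) (Ω.indicator F) volume y) (σ y) ∂Θ) atTop (𝓝 0) := by
    rw [Metric.tendsto_nhds]
    intro t ht
    obtain ⟨δ, hδ, hδt⟩ : ∃ δ > 0, δ * M * Θ.real univ < t := by
      have hpos : 0 < M * Θ.real univ + 1 := by positivity
      refine ⟨t / (M * Θ.real univ + 1), by positivity, ?_⟩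
      rw [mul_assoc, div_mul_eq_mul_div, div_lt_iff₀ hpos]
      nlinarith
    filter_upwards [hε'.eventually (hρ.eventually_norm_lconv_smul_sub_le hφ hφs hFm hM hδ)]
      with k hk
    rw [dist_zero_right]
    have hker := hρ.isKernel_rescale (hε0 k)
    have hu1 := hbdi _ _ (continuous_lconv hker.continuous hker.hasCompactSupport hφFli)
      fun y => hker.norm_lconv_le hφF y
    have hc2 := continuous_lconv hker.continuous hker.hasCompactSupport hli
    have hu2 := hbdi (fun y => φ y • lconv (rescale ρ (ε k)) (Ω.indicator F) volume y) (C * M)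
      (hφ.smul hc2) fun y => by
      rw [norm_smul]
      exact mul_le_mul (hC y) (hker.norm_lconv_le hM y) (norm_nonneg _)
        ((norm_nonneg _).trans (hC y))
    simp_rw [← real_inner_smul_left]
    rw [← integral_sub hu1 hu2]
    refine lt_of_le_of_lt ?_ hδt
    refine norm_integral_le_of_norm_le_const ?_
    filter_upwards [hσ1] with y hy
    rw [← inner_sub_left]
    refine (norm_inner_le_norm _ _).trans ?_
    rw [hy, mul_one]
    exact hk y
  have := hdiff.add hℓ
  simpa using this

end Pairing

/-! ### The density of the pairing measure -/

section PairingDensity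

open StratifiedGroup

variable {G : Type*} [NormedAddCommGroup G] [InnerProductSpace ℝ G] [FiniteDimensional ℝ G]
  [StratifiedGroup G] [MeasurableSpace G] [BorelSpace G] {d : HomogeneousDist G} {ρ : G → ℝ}

/-- With both parts written as restrictions of `Λ`, integrals against either one are integrals
against `Λ` with cut off test functions, so a weak star limit for `Λ` serves for both. -/
theorem MeasureTheory.Measure.exists_singularPart_eq_restrict {X : Type*} [MeasurableSpace X]
    (Λ μ : Measure X) [Λ.HaveLebesgueDecomposition μ] : ∃ N : Set X, MeasurableSet N ∧ μ Nᶜ = 0 ∧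
      Λ.singularPart μ = Λ.restrict Nᶜ ∧ μ.withDensity (Λ.rnDeriv μ) = Λ.restrict N := by
  obtain ⟨N, hN, h1, h2⟩ := Measure.mutuallySingular_singularPart Λ μ
  refine ⟨N, hN, h2, Measure.singularPart_eq_restrict (by rwa [compl_compl]) h2, ?_⟩
  conv_rhs => rw [← Measure.singularPart_add_rnDeriv Λ μ]
  have h3 : μ.withDensity (Λ.rnDeriv μ) Nᶜ = 0 := withDensity_absolutelyContinuous _ _ h2
  rw [Measure.restrict_add, Measure.restrict_eq_zero.2 h1, zero_add,
    Measure.restrict_eq_self_of_ae_mem h3]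

variable {Ω : Set G} {F : G → Horiz G} {σ : G → Horiz G} {Λ : Measure G} [IsFiniteMeasure Λ]

/-- On the absolutely continuous part, weak* limits of `⟨ρ_ε * F, σ⟩` agree with `⟨F, σ⟩`. -/
theorem IsMollifier.ae_eq_inner_of_weakStar (hρ : IsMollifier d ρ) (hΩ : MeasurableSet Ω)
    (hF : MemLp F ∞ (volume.restrict Ω)) (hσ : Measurable σ) (hσ1 : ∀ᵐ x ∂Λ, ‖σ x‖ = 1)
    {ε : ℕ → ℝ} (hε0 : ∀ k, 0 < ε k) (hε : Tendsto ε atTop (𝓝 0)) {h : G → ℝ}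
    (hh : Integrable h Λ)
    (hlim : ∀ ψ : G → ℝ, Integrable ψ Λ → Tendsto (fun k => ∫ y, ψ y *
      inner ℝ (lconv (rescale ρ (ε k)) (Ω.indicator F) volume y) (σ y) ∂Λ) atTop
      (𝓝 (∫ y, ψ y * h y ∂Λ))) :
    h =ᵐ[volume.withDensity (Λ.rnDeriv volume)] fun y => inner ℝ (Ω.indicator F y) (σ y) := by
  obtain ⟨N, hN, -, -, hac⟩ := Measure.exists_singularPart_eq_restrict Λ (volume : Measure G)
  set M := (eLpNorm F ∞ (volume.restrict Ω)).toReal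
  have hM : ∀ᵐ x, ‖Ω.indicator F x‖ ≤ M := hF.ae_norm_indicator_le hΩ
  have hli : LocallyIntegrable (Ω.indicator F) volume := locallyIntegrable_indicator hΩ hF
  have hFm : AEStronglyMeasurable (Ω.indicator F) volume :=
    (aestronglyMeasurable_indicator_iff hΩ).2 hF.1
  have hε' : Tendsto ε atTop (𝓝[>] 0) :=
    tendsto_nhdsWithin_iff.2 ⟨hε, Eventually.of_forall hε0⟩
  have hacv : volume.withDensity (Λ.rnDeriv volume) ≪ volume := withDensity_absolutelyContinuous _ _
  -- On `N` the measure `Λ` is absolutely continuous, so the convergence `ρ_ε * F → F` at Lebesgue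
  -- points holds `Λ`-almost everywhere there, and strong and weak limits agree.
  rw [hac] at hacv ⊢
  have hσN : ∀ᵐ x ∂(Λ.restrict N), ‖σ x‖ = 1 := ae_restrict_of_ae hσ1
  have hconv := hacv.ae_le (hρ.ae_tendsto_lconv hli)
  have hFN := hacv.ae_le hM
  have h_int : Integrable (fun y => (inner ℝ (Ω.indicator F y) (σ y) : ℝ)) (Λ.restrict N) := by
    refine Integrable.of_bound (C := M) ((hFm.mono_ac hacv).inner hσ.aestronglyMeasurable) ?_
    filter_upwards [hFN, hσN] with y h1 h2
    refine (norm_inner_le_norm _ _).trans ?_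
    rw [h2, mul_one]
    exact h1
  refine Integrable.ae_eq_of_forall_setIntegral_eq _ _ hh.restrict h_int fun E hE _ => ?_
  have hψ : Integrable ((E ∩ N).indicator fun _ => (1 : ℝ)) Λ :=
    (integrable_const 1).indicator (hE.inter hN)
  have hset : ∀ u : G → ℝ, ∫ y, (E ∩ N).indicator (fun _ => (1 : ℝ)) y * u y ∂Λ =
      ∫ y in E, u y ∂(Λ.restrict N) := by
    intro u
    rw [Measure.restrict_restrict hE, ← integral_indicator (hE.inter hN)]
    congr 1 with y
    by_cases hy : y ∈ E ∩ N <;> simp [hy]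
  have h1 := hlim _ hψ
  simp_rw [hset] at h1
  refine tendsto_nhds_unique h1 ?_
  have hker := fun k => hρ.isKernel_rescale (hε0 k)
  refine tendsto_integral_of_dominated_convergence (fun _ => M) (fun k => ?_)
    (integrable_const M) (fun k => ?_) ?_
  · exact (continuous_lconv (hker k).continuous (hker k).hasCompactSupport
      hli).aestronglyMeasurable.inner hσ.aestronglyMeasurable
  · filter_upwards [ae_restrict_of_ae hσN] with y hy
    refine (norm_inner_le_norm _ _).trans ?_
    rw [hy, mul_one]
    exact (hker k).norm_lconv_le hM y
  · filter_upwards [ae_restrict_of_ae hconv] with y hy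
    exact (hy.comp hε').inner tendsto_const_nhds

/-- The weak limit `h` is explicit only on the absolutely continuous part, where `⟨F, σ⟩` times the
density of `Λ` is `⟨F, ∇_H g⟩`. -/
theorem withDensityᵥ_eq_singularPart_add
    {h : G → ℝ} (hh : Integrable h Λ)
    (hac : h =ᵐ[volume.withDensity (Λ.rnDeriv volume)]
      fun y => inner ℝ (Ω.indicator F y) (σ y)) :
    Integrable (fun x => (inner ℝ (Ω.indicator F x) (acDensity σ Λ x) : ℝ)) volume ∧
    Λ.withDensityᵥ h = (Λ.singularPart volume).withDensityᵥ h +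
      volume.withDensityᵥ fun x => inner ℝ (Ω.indicator F x) (acDensity σ Λ x) := by
  have hhac : Integrable h (volume.withDensity (Λ.rnDeriv volume)) :=
    hh.mono_measure (Measure.withDensity_rnDeriv_le Λ volume)
  have hhs : Integrable h (Λ.singularPart volume) :=
    hh.mono_measure (Measure.singularPart_le Λ volume)
  have hrn := Measure.measurable_rnDeriv Λ (volume : Measure G)
  have hrt := Measure.rnDeriv_lt_top Λ (volume : Measure G)
  have e : ∀ x, (inner ℝ (Ω.indicator F x) (acDensity σ Λ x) : ℝ) =
      (Λ.rnDeriv volume x).toReal • inner ℝ (Ω.indicator F x) (σ x) := fun x => by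
    rw [acDensity, real_inner_smul_right, smul_eq_mul]
  have hi : Integrable (fun x => (inner ℝ (Ω.indicator F x) (acDensity σ Λ x) : ℝ)) volume := by
    simp_rw [e]
    exact (integrable_withDensity_iff_integrable_smul' hrn hrt).1 (hhac.congr hac)
  refine ⟨hi, ?_⟩
  ext E hE
  rw [add_apply, withDensityᵥ_apply hh hE, withDensityᵥ_apply hhs hE,
    withDensityᵥ_apply hi hE]
  conv_lhs => rw [Measure.haveLebesgueDecomposition_add Λ volume]
  rw [Measure.restrict_add, integral_add_measure hhs.integrableOn hhac.integrableOn]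
  congr 1
  rw [integral_congr_ae (ae_restrict_of_ae hac)]
  simp_rw [e]
  rw [setIntegral_withDensity_eq_setIntegral_toReal_smul hrn (ae_restrict_of_ae hrt) _ hE]

theorem variation_withDensityᵥ_le_smul {X : Type*} [MeasurableSpace X] {Θ : Measure X} {h : X → ℝ}
    (hh : Integrable h Θ) {C : ℝ≥0∞} (hb : ∀ᵐ x ∂Θ, |h x| ≤ C.toReal) :
    (Θ.withDensityᵥ h).variation ≤ C • Θ := by
  rw [Measure.variation_withDensityᵥ hh, ← withDensity_const]
  refine withDensity_mono ?_
  filter_upwards [hb] with x hx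
  rw [← ofReal_norm]
  exact ENNReal.ofReal_le_of_le_toReal hx

-- Uniqueness of the Lebesgue decomposition: the first summand is concentrated on a null set.
omit [StratifiedGroup G] in
theorem singularPart_rnDeriv_of_eq_add {P : SignedMeasure G} {h f : G → ℝ}
    (hf : Integrable f volume) (hh : Integrable h Λ)
    (hadd : P = (Λ.singularPart volume).withDensityᵥ h + volume.withDensityᵥ f) :
    volume.withDensityᵥ (P.rnDeriv volume) = volume.withDensityᵥ f ∧
      P.singularPart volume = (Λ.singularPart volume).withDensityᵥ h := by
  obtain ⟨N, hN, hN1, hN2, -⟩ := Measure.exists_singularPart_eq_restrict Λ (volume : Measure G)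
  have hhs : Integrable h (Λ.singularPart volume) :=
    hh.mono_measure (Measure.singularPart_le Λ volume)
  have hs : (Λ.singularPart volume).withDensityᵥ h ⟂ᵥ
      (volume : Measure G).toENNRealVectorMeasure := by
    refine VectorMeasure.MutuallySingular.mk N hN (fun t ht htm => ?_) fun t ht htm => ?_
    · rw [withDensityᵥ_apply hhs htm]
      refine setIntegral_measure_zero _ (measure_mono_null ht ?_)
      rw [hN2, Measure.restrict_apply hN, inter_compl_self, measure_empty]
    · rw [Measure.toENNRealVectorMeasure_apply_measurable htm]
      exact measure_mono_null ht hN1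
  exact ⟨(WithDensityᵥEq.congr_ae (SignedMeasure.eq_rnDeriv _ f hf hs hadd)).symm,
    (SignedMeasure.eq_singularPart _ f hs hadd).symm⟩

end PairingDensity

/-! ### The Leibniz rule -/

section Leibniz

open StratifiedGroup

variable {G : Type*} [NormedAddCommGroup G] [InnerProductSpace ℝ G] [FiniteDimensional ℝ G]
  [StratifiedGroup G]

theorem HasHDerivAt.mul {v : G} {u w : G → ℝ} {a b : ℝ} {x : G} (hu : HasHDerivAt v u a x)
    (hw : HasHDerivAt v w b x) : HasHDerivAt v (fun y => u y * w y) (a * w x + u x * b) x := by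
  have h := HasDerivAt.mul hu hw
  rw [zero_smul, mul_zero'] at h
  exact h

theorem hasHDerivAt_zero_of_notMem_tsupport (v : G) {u : G → ℝ} {x : G} (hx : x ∉ tsupport u) :
    HasHDerivAt v u 0 x := by
  have hc : Continuous fun t : ℝ => x * (t • v) := by fun_prop
  have := hc.tendsto 0
  rw [zero_smul, mul_zero'] at this
  refine (hasDerivAt_const (0 : ℝ) (0 : ℝ)).congr_of_eventuallyEq ?_
  filter_upwards [this ((isClosed_tsupport u).isOpen_compl.mem_nhds hx)] with t ht
  exact image_eq_zero_of_notMem_tsupport ht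

theorem continuous_horizGrad {u : G → ℝ} (hu : ContDiff ℝ 1 u) : Continuous (horizGrad u) := by
  refine continuous_finsetSum _ fun i _ => ?_
  have : frameDeriv i u = fun x => fderiv ℝ u x (leftInvField (frame G i : G) x) := funext fun x =>
    (hasHDerivAt_of_differentiable (hu.differentiable one_ne_zero) _ x).frameDeriv_eq
  rw [this]
  exact (continuous_fderiv_leftInvField hu _).smul continuous_const

theorem hasHDerivAt_inner_horizGrad {u : G → ℝ} (hu : Differentiable ℝ u) (v : Horiz G) (x : G) :
    HasHDerivAt (v : G) u (inner ℝ (horizGrad u x) v) x := by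
  rw [inner_horizGrad hu]
  exact hasHDerivAt_of_differentiable hu _ _

theorem horizGrad_eq_zero_of_notMem_tsupport {u : G → ℝ} {x : G} (hx : x ∉ tsupport u) :
    horizGrad u x = 0 :=
  horizGrad_eq_of_hasHDerivAt fun i => by
    rw [inner_zero_left]
    exact hasHDerivAt_zero_of_notMem_tsupport _ hx

variable [MeasurableSpace G] [BorelSpace G] {d : HomogeneousDist G} {ρ : G → ℝ} {Ω : Set G}
  {g : G → ℝ} {F σ : G → Horiz G} {Λ : Measure G}

theorem IsMollifier.continuous_mollify (hρ : IsMollifier d ρ) (hΩ : MeasurableSet Ω)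
    (hg : MemLp g ∞ (volume.restrict Ω)) {ε : ℝ} (hε : 0 < ε) : Continuous (mollify Ω ρ ε g) := by
  have hk := hρ.isKernel_rescale hε
  rw [mollify_eq hΩ]
  exact continuous_lconv hk.continuous hk.hasCompactSupport (locallyIntegrable_indicator hΩ hg)

theorem IsMollifier.abs_mollify_le (hρ : IsMollifier d ρ) (hΩ : MeasurableSet Ω)
    (hg : MemLp g ∞ (volume.restrict Ω)) {ε : ℝ} (hε : 0 < ε) (x : G) :
    |mollify Ω ρ ε g x| ≤ (eLpNorm g ∞ (volume.restrict Ω)).toReal := by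
  rw [mollify_eq hΩ, ← Real.norm_eq_abs]
  exact (hρ.isKernel_rescale hε).norm_lconv_le (hg.ae_norm_indicator_le hΩ) x

theorem integrable_inner_of_hasCompactSupport (hF : MemLp F ∞ (volume.restrict Ω))
    {Φ : G → Horiz G} (hΦ : Continuous Φ) (hΦs : HasCompactSupport Φ) :
    Integrable (fun x => (inner ℝ (F x) (Φ x) : ℝ)) (volume.restrict Ω) := by
  obtain ⟨C, hC⟩ := hΦs.exists_bound_of_continuous hΦ
  have h1 : IntegrableOn (fun x => (inner ℝ (F x) (Φ x) : ℝ)) (tsupport Φ)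
      (volume.restrict Ω) := by
    refine ((hF.integrableOn_isCompact_of_top hΦs.isCompact).norm.mul_const C).mono'
      (hF.1.restrict.inner hΦ.aestronglyMeasurable) (Eventually.of_forall fun x => ?_)
    exact (norm_inner_le_norm _ _).trans (mul_le_mul_of_nonneg_left (hC x) (norm_nonneg _))
  refine (integrableOn_iff_integrable_of_support_subset fun y hy => subset_tsupport Φ ?_).1 h1
  intro h0
  exact hy (by simp [h0])

/-- The Leibniz rule for the product with a mollified function. -/
theorem IsPolarGrad.integral_mul_mollify (h : IsPolarGrad Ω g σ Λ) (hΩ : IsOpen Ω)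
    (hg : MemLp g ∞ (volume.restrict Ω)) (hρ : IsMollifier d ρ)
    (hF : MemLp F ∞ (volume.restrict Ω)) {ν : SignedMeasure G} (hν : IsDivergence Ω F ν)
    {φ : G → ℝ} (hφ : IsCcInf Ω φ) {ε : ℝ} (hε : 0 < ε)
    (hsub : tsupport φ ⊆ rightInner d Ω ε) :
    ∫ᵛ x, φ x * mollify Ω ρ ε g x ∂<•ν =
      -(∫ x in Ω, mollify Ω ρ ε g x * inner ℝ (F x) (horizGrad φ x)) -
        ∫ x in Ω, φ x * inner ℝ (F x) (mollifyMeasure ρ ε σ Λ x) := by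
  have hmc := hρ.continuous_mollify hΩ.measurableSet hg hε
  have hφ1 : ContDiff ℝ 1 φ := hφ.1.of_le (by norm_cast)
  have hφd : Differentiable ℝ φ := hφ1.differentiable one_ne_zero
  have hAc := h.continuous_mollifyMeasure hρ hε
  have hgc := continuous_horizGrad hφ1
  have hts : tsupport (fun x => φ x * mollify Ω ρ ε g x) ⊆ tsupport φ :=
    closure_mono (Function.support_mul_subset_left _ _)
  have hgs : HasCompactSupport (horizGrad φ) :=
    HasCompactSupport.intro hφ.2.1.isCompact fun x hx => horizGrad_eq_zero_of_notMem_tsupport hx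
  have hu : IsCc Ω fun x => φ x * mollify Ω ρ ε g x :=
    ⟨hφ.1.continuous.mul hmc, hφ.2.1.mul_right, hts.trans hφ.2.2⟩
  -- The product is only differentiable along the frame, which is why the divergence was extended to
  -- such test functions. The field `Φ` is its gradient by the product rule.
  have key := hν.integral_eq hΩ hF hu
    (Φ := fun x => mollify Ω ρ ε g x • horizGrad φ x + φ x • mollifyMeasure ρ ε σ Λ x)
    ((hmc.smul hgc).add (hφ.1.continuous.smul hAc)) (by
      intro i x
      by_cases hx : x ∈ tsupport φ
      · have h1 := (hasHDerivAt_inner_horizGrad hφd (frame G i) x).mul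
          (h.hasHDerivAt_mollify hΩ hg hρ hε (hsub hx) (frame G i))
        rw [inner_add_left, real_inner_smul_left, real_inner_smul_left]
        rwa [mul_comm (inner ℝ (horizGrad φ x) (frame G i))] at h1
      -- Off the support of `φ` the derivatives of the mollification may fail to exist, but the
      -- product vanishes near `x`.
      · rw [horizGrad_eq_zero_of_notMem_tsupport hx, image_eq_zero_of_notMem_tsupport hx, smul_zero,
          zero_smul, add_zero, inner_zero_left]
        exact hasHDerivAt_zero_of_notMem_tsupport _ fun h => hx (hts h))
  rw [key, neg_sub_left, ← integral_add]
  · congr 2 with x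
    rw [inner_add_right, real_inner_smul_right, real_inner_smul_right, add_comm]
  · have := integrable_inner_of_hasCompactSupport hF (hφ.1.continuous.smul hAc)
      hφ.2.1.smul_right
    simpa only [Pi.smul_apply', real_inner_smul_right] using this
  · have := integrable_inner_of_hasCompactSupport hF (hmc.smul hgc) hgs.smul_left
    simpa only [Pi.smul_apply', real_inner_smul_right] using this

end Leibniz

/-! ### Limits of mollifications -/

section MollifierLimits

open StratifiedGroup

variable {G : Type*} [NormedAddCommGroup G] [InnerProductSpace ℝ G] [FiniteDimensional ℝ G]
  [StratifiedGroup G] [MeasurableSpace G] [BorelSpace G] {d : HomogeneousDist G} {ρ : G → ℝ}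
  {Ω : Set G} {g : G → ℝ} {F σ : G → Horiz G} {Λ : Measure G}

omit [NormedAddCommGroup G] [InnerProductSpace ℝ G] [FiniteDimensional ℝ G] [StratifiedGroup G] [BorelSpace G] in
theorem isMeasureOn_withDensityᵥ {Θ : Measure G} (hΘ : Θ Ωᶜ = 0) {h : G → ℝ}
    (hh : Integrable h Θ) : IsMeasureOn Ω (Θ.withDensityᵥ h) := by
  rw [IsMeasureOn, Measure.variation_withDensityᵥ hh]
  exact withDensity_absolutelyContinuous _ _ hΘ

/-- For large `k` the support of `φ` lies in the inner set, where the gradient of the mollification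
is the mollified gradient measure, so both integrals coincide. -/
theorem IsPolarGrad.locWeakStarTendsto_horizGrad (h : IsPolarGrad Ω g σ Λ) (hΩ : IsOpen Ω)
    (hg : MemLp g ∞ (volume.restrict Ω)) (hρ : IsMollifier d ρ) {ε : ℕ → ℝ} (hε0 : ∀ k, 0 < ε k)
    (hε : Tendsto ε atTop (𝓝 0)) {P : SignedMeasure G}
    (hP : LocWeakStarTendsto Ω (fun _ => Ω)
      (fun k x => inner ℝ (F x) (mollifyMeasure ρ (ε k) σ Λ x)) P) :
    LocWeakStarTendsto Ω (fun k => rightInner d Ω (2 * ε k))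
      (fun k x => inner ℝ (F x) (horizGrad (mollify Ω ρ (ε k) g) x)) P := by
  intro φ hφ
  refine (hP φ hφ).congr' ?_
  filter_upwards [hε.eventually (eventually_subset_rightInner d hΩ hφ.2.1.isCompact hφ.2.2)]
    with k hk
  have hz : ∀ x, x ∉ tsupport φ → φ x = 0 := fun x hx => image_eq_zero_of_notMem_tsupport hx
  rw [setIntegral_eq_integral_of_forall_compl_eq_zero fun x hx => by
      rw [hz x fun h => hx (hφ.2.2 h), zero_mul],
    setIntegral_eq_integral_of_forall_compl_eq_zero fun x hx => by
      rw [hz x fun h => hx (hk h), zero_mul]]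
  congr 1 with x
  by_cases hx : x ∈ tsupport φ
  · rw [h.horizGrad_mollify hΩ hg hρ (hε0 k)
      (rightInner_anti d Ω (by linarith [hε0 k]) (hk hx))]
  · rw [hz x hx, zero_mul, zero_mul]

/-- The Leibniz rule in the limit. -/
theorem IsPolarGrad.isDivergence_smul (h : IsPolarGrad Ω g σ Λ) (hΩ : IsOpen Ω)
    (hg : MemLp g ∞ (volume.restrict Ω)) (hρ : IsMollifier d ρ)
    (hF : MemLp F ∞ (volume.restrict Ω)) {ν : SignedMeasure G} (hν : IsDivergence Ω F ν)
    {ε : ℕ → ℝ} (hε0 : ∀ k, 0 < ε k) (hε : Tendsto ε atTop (𝓝 0)) {gt : G → ℝ}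
    (hgtm : Measurable gt) {C : ℝ} (hgt : ∀ᵐ x ∂ν.variation, |gt x| ≤ C)
    (hgtlim : ∀ ψ : G → ℝ, Integrable ψ ν.variation → Tendsto
      (fun k => ∫ x, ψ x * mollify Ω ρ (ε k) g x ∂ν.variation) atTop
      (𝓝 (∫ x, ψ x * gt x ∂ν.variation)))
    {q : G → ℝ} (hq : Integrable q Λ) (hP : LocWeakStarTendsto Ω (fun _ => Ω)
      (fun k x => inner ℝ (F x) (mollifyMeasure ρ (ε k) σ Λ x)) (Λ.withDensityᵥ q)) :
    IsDivergence Ω (fun x => g x • F x) (smulMeasure gt ν + Λ.withDensityᵥ q) := by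
  obtain ⟨θ, hθm, hθi, hθ⟩ := exists_density_variation ν
  set β := ν.variation with hβ
  have hgθ : Integrable (fun x => gt x * θ x) β := hθi.bdd_mul hgtm.aestronglyMeasurable hgt
  have hsm : smulMeasure gt ν = β.withDensityᵥ fun x => gt x * θ x := by
    rw [smulMeasure, hθ]
    exact withDensity_withDensityᵥ hθi hgtm.aestronglyMeasurable hgθ
  have hvar : ∀ {Θ : Measure G} {f φ : G → ℝ}, Integrable f Θ → Continuous φ →
      (∃ B, ∀ x, ‖φ x‖ ≤ B) → (Θ.withDensityᵥ f).Integrable φ ∧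
        ∫ᵛ x, φ x ∂<•(Θ.withDensityᵥ f) = ∫ x, φ x * f x ∂Θ := by
    rintro Θ f φ hf hφ ⟨B, hB⟩
    refine ⟨?_, integral_withDensityᵥ_eq hf hφ.aestronglyMeasurable
      (hf.bdd_mul hφ.aestronglyMeasurable (Eventually.of_forall hB))⟩
    exact Integrable.of_bound hφ.aestronglyMeasurable B (Eventually.of_forall hB)
  refine ⟨?_, fun φ hφ => ?_⟩
  · have hm1 : IsMeasureOn Ω (β.withDensityᵥ fun x => gt x * θ x) :=
      isMeasureOn_withDensityᵥ hν.1 hgθ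
    have hm2 : IsMeasureOn Ω (Λ.withDensityᵥ q) := isMeasureOn_withDensityᵥ h.compl_eq_zero hq
    rw [hsm, IsMeasureOn, ← nonpos_iff_eq_zero]
    refine (Measure.le_iff'.1 VectorMeasure.variation_add_le Ωᶜ).trans (le_of_eq ?_)
    rw [Measure.add_apply, hm1, hm2, add_zero]
  have hφb := hφ.2.1.exists_bound_of_continuous hφ.1.continuous
  obtain ⟨B, hB⟩ := hφb
  obtain ⟨hi1, e1⟩ := hvar hgθ hφ.1.continuous ⟨B, hB⟩
  obtain ⟨hi2, e2⟩ := hvar hq hφ.1.continuous ⟨B, hB⟩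
  rw [hsm, VectorMeasure.integral_add_vectorMeasure hi1 hi2, e1]
  have hcc : IsCc Ω φ := ⟨hφ.1.continuous, hφ.2⟩
  have t2 := hP φ hcc
  have hφθ : Integrable (fun x => φ x * θ x) β :=
    hθi.bdd_mul hφ.1.continuous.aestronglyMeasurable (Eventually.of_forall hB)
  -- The density `θ` of the divergence is absorbed into the `L¹` test function `φ θ`.
  have t1 := hgtlim _ hφθ
  have hφ1 : ContDiff ℝ 1 φ := hφ.1.of_le (by norm_cast)
  have hgs : HasCompactSupport (horizGrad φ) :=
    HasCompactSupport.intro hφ.2.1.isCompact fun x hx => horizGrad_eq_zero_of_notMem_tsupport hx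
  have hFφ := integrable_inner_of_hasCompactSupport hF (continuous_horizGrad hφ1) hgs
  have hε' : Tendsto ε atTop (𝓝[>] 0) :=
    tendsto_nhdsWithin_iff.2 ⟨hε, Eventually.of_forall hε0⟩
  have t3 : Tendsto (fun k => ∫ x in Ω, mollify Ω ρ (ε k) g x * inner ℝ (F x) (horizGrad φ x))
      atTop (𝓝 (∫ x in Ω, inner ℝ (g x • F x) (horizGrad φ x))) := by
    refine tendsto_integral_of_dominated_convergence
      (fun x => (eLpNorm g ∞ (volume.restrict Ω)).toReal * ‖(inner ℝ (F x) (horizGrad φ x) : ℝ)‖)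
      (fun k => ?_) (hFφ.norm.const_mul _) (fun k => Eventually.of_forall fun x => ?_) ?_
    · exact (hρ.continuous_mollify hΩ.measurableSet hg (hε0 k)).aestronglyMeasurable.mul hFφ.1
    · rw [norm_mul]
      exact mul_le_mul_of_nonneg_right (hρ.abs_mollify_le hΩ.measurableSet hg (hε0 k) x)
        (norm_nonneg _)
    · have hae := hρ.ae_tendsto_lconv (locallyIntegrable_indicator hΩ.measurableSet hg)
      filter_upwards [ae_restrict_of_ae hae, ae_restrict_mem hΩ.measurableSet] with x hx hxΩ
      rw [indicator_of_mem hxΩ] at hx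
      rw [real_inner_smul_left]
      refine Tendsto.mul_const _ ?_
      simp_rw [mollify_eq hΩ.measurableSet]
      exact hx.comp hε'
  have hlim := t3.neg.sub t2
  have hev : ∀ᶠ k in atTop, ∫ x, φ x * θ x * mollify Ω ρ (ε k) g x ∂β =
      -(∫ x in Ω, mollify Ω ρ (ε k) g x * inner ℝ (F x) (horizGrad φ x)) -
        ∫ x in Ω, φ x * inner ℝ (F x) (mollifyMeasure ρ (ε k) σ Λ x) := by
    filter_upwards [hε.eventually (eventually_subset_rightInner d hΩ hφ.2.1.isCompact hφ.2.2)]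
      with k hk
    rw [← h.integral_mul_mollify hΩ hg hρ hF hν hφ (hε0 k)
      (hk.trans (rightInner_anti d Ω (by linarith [hε0 k])))]
    have hmc := hρ.continuous_mollify hΩ.measurableSet hg (hε0 k)
    have hu : HasCompactSupport fun x => φ x * mollify Ω ρ (ε k) g x := hφ.2.1.mul_right
    have huc : Continuous fun x => φ x * mollify Ω ρ (ε k) g x := hφ.1.continuous.mul hmc
    have e3 := (hvar hθi huc (hu.exists_bound_of_continuous huc)).2
    rw [← hθ] at e3
    rw [e3]
    congr 1 with x
    ring
  have hfin := tendsto_nhds_unique (t1.congr' hev) hlim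
  have e4 : ∫ x, φ x * (gt x * θ x) ∂β = ∫ x, φ x * θ x * gt x ∂β := by
    congr 1 with x
    ring
  rw [e4, hfin]
  ring

end MollifierLimits

/-! ### Extraction of the subsequence and the limit measures. -/

section ProductRule

open StratifiedGroup

variable {G : Type*} [NormedAddCommGroup G] [InnerProductSpace ℝ G] [FiniteDimensional ℝ G]
  [StratifiedGroup G] [MeasurableSpace G] [BorelSpace G] {d : HomogeneousDist G} {ρ : G → ℝ}
  {Ω : Set G} {g : G → ℝ} {F σ : G → Horiz G} {Λ : Measure G}

/-- Along a subsequence, the mollifications of `g` and the pairings of `F` with the mollified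
gradients converge, and the limits give the divergence of `gF`. -/
theorem IsPolarGrad.exists_subseq_limits (h : IsPolarGrad Ω g σ Λ) (hΩ : IsOpen Ω)
    (hg : MemLp g ∞ (volume.restrict Ω)) (hF : MemLp F ∞ (volume.restrict Ω))
    {divF : SignedMeasure G} (hdiv : IsDivergence Ω F divF) (hρ : IsMollifier d ρ)
    {ε : ℕ → ℝ} (hε0 : ∀ k, 0 < ε k) (hε : Tendsto ε atTop (𝓝 0)) :
    ∃ s : ℕ → ℕ, StrictMono s ∧
      ∃ (gt : G → ℝ) (P Ps : SignedMeasure G),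
        IsMeasureOn Ω P ∧ IsMeasureOn Ω Ps ∧
        WeakStarLInfTendsto divF.variation (fun k => mollify Ω ρ (ε (s k)) g) gt ∧
        LocWeakStarTendsto Ω (fun k => rightInner d Ω (2 * ε (s k)))
          (fun k x => inner ℝ (F x) (horizGrad (mollify Ω ρ (ε (s k)) g) x)) P ∧
        IsDivergence Ω (fun x => g x • F x) (smulMeasure gt divF + P) ∧
        P.variation ≤ eLpNorm F ∞ (volume.restrict Ω) • Λ ∧
        LocWeakStarTendsto Ω (fun _ => Ω)
          (fun k x => inner ℝ (F x)
            (mollifyMeasure ρ (ε (s k)) σ (Λ.singularPart volume) x)) Ps ∧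
        Ps.variation ≤ eLpNorm F ∞ (volume.restrict Ω) • Λ.singularPart volume ∧
        volume.withDensityᵥ (P.rnDeriv volume) =
          (volume.restrict Ω).withDensityᵥ (fun x => inner ℝ (F x) (acDensity σ Λ x)) ∧
        P.singularPart volume = Ps := by
  have := h.finite
  have hΩm := hΩ.measurableSet
  set β := divF.variation with hβ
  set M := (eLpNorm F ∞ (volume.restrict Ω)).toReal with hMdef
  have hM : ∀ᵐ x, ‖Ω.indicator F x‖ ≤ M := hF.ae_norm_indicator_le hΩm
  have hli : LocallyIntegrable (Ω.indicator F) volume := locallyIntegrable_indicator hΩm hF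
  have hker := fun k => hρ.isKernel_rescale (hε0 k)
  obtain ⟨s₁, hs₁, gt, hgtm, hgtb, hgtlim⟩ := exists_weakStar_subseq β
    (fun k => mollify Ω ρ (ε k) g) (eLpNorm g ∞ (volume.restrict Ω)).toReal
    (fun k => (hρ.continuous_mollify hΩm hg (hε0 k)).aestronglyMeasurable)
    (fun k => Eventually.of_forall fun x => hρ.abs_mollify_le hΩm hg (hε0 k) x)
  -- The second extraction takes place on the side of the field: `q` is the density of `(F, D_H g)`
  -- with respect to `Λ`, and its bound is the bound on the variation.
  obtain ⟨s₂, hs₂, q, hqm, hqb, hqlim⟩ := exists_weakStar_subseq Λ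
    (fun k y => inner ℝ (lconv (rescale ρ (ε (s₁ k))) (Ω.indicator F) volume y) (σ y)) M
    (fun k => (continuous_lconv (hker _).continuous (hker _).hasCompactSupport
      hli).aestronglyMeasurable.inner h.measurable.aestronglyMeasurable)
    (fun k => by
      filter_upwards [h.norm_eq_one] with y hy
      refine (norm_inner_le_norm (𝕜 := ℝ) _ _).trans ?_
      rw [hy, mul_one]
      exact (hker _).norm_lconv_le hM y)
  set e : ℕ → ℝ := fun k => ε (s₁ (s₂ k)) with he
  have he0 : ∀ k, 0 < e k := fun k => hε0 _
  have het : Tendsto e atTop (𝓝 0) := hε.comp (hs₁.comp hs₂).tendsto_atTop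
  have hqi : Integrable q Λ := Integrable.of_bound hqm.aestronglyMeasurable M hqb
  have hsing : Λ.singularPart volume ≤ Λ := Measure.singularPart_le Λ volume
  have hqs : Integrable q (Λ.singularPart volume) := hqi.mono_measure hsing
  have h_int : ∀ {Θ : Measure G} {φ : G → ℝ}, Integrable q Θ → IsCc Ω φ →
      ∫ᵛ x, φ x ∂<•(Θ.withDensityᵥ q) = ∫ x, φ x * q x ∂Θ := by
    intro Θ φ hΘ hφ
    obtain ⟨B, hB⟩ := hφ.2.1.exists_bound_of_continuous hφ.1
    exact integral_withDensityᵥ_eq hΘ hφ.1.aestronglyMeasurable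
      (hΘ.bdd_mul hφ.1.aestronglyMeasurable (Eventually.of_forall hB))
  have hcci : ∀ {φ : G → ℝ}, IsCc Ω φ → Integrable φ Λ := fun hφ =>
    hφ.1.integrable_of_hasCompactSupport hφ.2.1
  have hP : LocWeakStarTendsto Ω (fun _ => Ω)
      (fun k x => inner ℝ (F x) (mollifyMeasure ρ (e k) σ Λ x)) (Λ.withDensityᵥ q) := by
    intro φ hφ
    rw [h_int hqi hφ]
    exact hρ.tendsto_pairing hΩm hF h.measurable h.norm_eq_one he0 het hφ.1 hφ.2.1
      (hqlim φ (hcci hφ))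
  have hPs : LocWeakStarTendsto Ω (fun _ => Ω)
      (fun k x => inner ℝ (F x) (mollifyMeasure ρ (e k) σ (Λ.singularPart volume) x))
      ((Λ.singularPart volume).withDensityᵥ q) := by
    intro φ hφ
    rw [h_int hqs hφ]
    refine hρ.tendsto_pairing hΩm hF h.measurable (h.norm_eq_one.filter_mono (ae_mono hsing))
      he0 het hφ.1 hφ.2.1 ?_
    -- The same `q` serves for the singular part, by testing with `φ` cut off to the complement of
    -- `N`; no further subsequence is needed.
    obtain ⟨N, hN, -, hNs, -⟩ := Measure.exists_singularPart_eq_restrict Λ (volume : Measure G)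
    have hset : ∀ u : G → ℝ, ∫ y, φ y * u y ∂(Λ.singularPart volume) =
        ∫ y, Nᶜ.indicator φ y * u y ∂Λ := by
      intro u
      rw [hNs, ← integral_indicator hN.compl]
      congr 1 with y
      by_cases hy : y ∈ N <;> simp [hy]
    simp_rw [hset]
    exact hqlim _ ((hcci hφ).indicator hN.compl)
  have hqac := hρ.ae_eq_inner_of_weakStar hΩm hF h.measurable h.norm_eq_one he0 het hqi hqlim
  obtain ⟨hWi, hadd⟩ := withDensityᵥ_eq_singularPart_add hqi hqac
  obtain ⟨hrn, hsp⟩ := singularPart_rnDeriv_of_eq_add hWi hqi hadd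
  refine ⟨s₁ ∘ s₂, hs₁.comp hs₂, gt, Λ.withDensityᵥ q, (Λ.singularPart volume).withDensityᵥ q,
    isMeasureOn_withDensityᵥ h.compl_eq_zero hqi,
    isMeasureOn_withDensityᵥ (Measure.absolutelyContinuous_of_le hsing h.compl_eq_zero) hqs,
    ⟨fun k => ?_, ?_, fun ψ hψ => (hgtlim ψ hψ).comp hs₂.tendsto_atTop⟩,
    h.locWeakStarTendsto_horizGrad hΩ hg hρ he0 het hP,
    h.isDivergence_smul hΩ hg hρ hF hdiv he0 het hgtm hgtb
      (fun ψ hψ => (hgtlim ψ hψ).comp hs₂.tendsto_atTop) hqi hP,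
    variation_withDensityᵥ_le_smul hqi hqb, hPs,
    variation_withDensityᵥ_le_smul hqs (hqb.filter_mono (ae_mono hsing)), ?_, hsp⟩
  · exact memLp_top_of_bound (hρ.continuous_mollify hΩm hg (hε0 _)).aestronglyMeasurable _
      (Eventually.of_forall fun x => hρ.abs_mollify_le hΩm hg (hε0 _) x)
  · exact memLp_top_of_bound hgtm.aestronglyMeasurable _ hgtb
  · rw [hrn]
    have hind : (fun x => (inner ℝ (Ω.indicator F x) (acDensity σ Λ x) : ℝ)) =
        Ω.indicator fun x => inner ℝ (F x) (acDensity σ Λ x) := by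
      funext x
      by_cases hx : x ∈ Ω <;> simp [hx]
    rw [hind] at hWi ⊢
    have hWr := (integrable_indicator_iff hΩm).1 hWi
    ext t ht
    rw [withDensityᵥ_apply hWi ht, withDensityᵥ_apply hWr ht, setIntegral_indicator hΩm,
      Measure.restrict_restrict ht]

end ProductRule

end

theorem mainTheorem1 {G : Type*} [NormedAddCommGroup G] [InnerProductSpace ℝ G]
    [FiniteDimensional ℝ G] [StratifiedGroup G] [MeasurableSpace G] [BorelSpace G]
    (d : HomogeneousDist G) (Ω : Set G) (hΩ : IsOpen Ω)
    (F : G → Horiz G) (hF : IsDMInf Ω F)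
    (g : G → ℝ) (hg : MemLp g ∞ (volume.restrict Ω)) (hgvar : horizVariation Ω g < ⊤) :
    -- `gF ∈ DM^∞(HΩ)`
    IsDMInf Ω (fun x => g x • F x) ∧
    -- the polar decomposition `D_H g = σ Λ` and the approximate differential `W = ∇_H g`,
    -- which is the density of the absolutely continuous part of `D_H g`
    ∃ (σ : G → Horiz G) (Λ : Measure G) (W : G → Horiz G),
      IsPolarGrad Ω g σ Λ ∧
      IntegrableOn W Ω ∧
      (∀ᵐ x ∂(volume.restrict Ω), HasApproxHorizGradAt d g (W x) x) ∧
      (∀ᵐ x ∂(volume.restrict Ω), W x = (Λ.rnDeriv volume x).toReal • σ x) ∧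
      ∀ divF : SignedMeasure G, IsDivergence Ω F divF →
      ∀ ρ : G → ℝ, IsMollifier d ρ →
        -- the measures `⟨F, ∇_H g_ε⟩ μ` are well defined
        (∀ ε : ℝ, 0 < ε →
          IsC1H (rightInner d Ω (2 * ε)) (mollify Ω ρ ε g) ∧
          IntegrableOn (horizGrad (mollify Ω ρ ε g)) (rightInner d Ω (2 * ε))) ∧
        ∀ ε' : ℕ → ℝ, (∀ k, 0 < ε' k) → Tendsto ε' atTop (𝓝 0) →
          ∃ s : ℕ → ℕ, StrictMono s ∧
          -- `gt` is the limit of the mollifications, `P` is `(F, D_H g)`, `Ps` is `(F, D_H^s g)`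
          ∃ (gt : G → ℝ) (P Ps : SignedMeasure G),
            IsMeasureOn Ω P ∧ IsMeasureOn Ω Ps ∧
            WeakStarLInfTendsto divF.variation (fun k => mollify Ω ρ (ε' (s k)) g) gt ∧
            LocWeakStarTendsto Ω (fun k => rightInner d Ω (2 * ε' (s k)))
              (fun k x => inner ℝ (F x) (horizGrad (mollify Ω ρ (ε' (s k)) g) x)) P ∧
            IsDivergence Ω (fun x => g x • F x) (smulMeasure gt divF + P) ∧
            P.variation ≤ eLpNorm F ∞ (volume.restrict Ω) • Λ ∧
            LocWeakStarTendsto Ω (fun _ => Ω)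
              (fun k x => inner ℝ (F x)
                (mollifyMeasure ρ (ε' (s k)) σ (Λ.singularPart volume) x)) Ps ∧
            Ps.variation ≤ eLpNorm F ∞ (volume.restrict Ω) • Λ.singularPart volume ∧
            volume.withDensityᵥ (P.rnDeriv volume) =
              (volume.restrict Ω).withDensityᵥ (fun x => inner ℝ (F x) (W x)) ∧
            P.singularPart volume = Ps := by
  obtain ⟨hFm, divF₀, hdivF₀⟩ := hF
  obtain ⟨σ, Λ, h⟩ := exists_isPolarGrad hΩ hg hgvar
  refine ⟨⟨?_, ?_⟩, σ, Λ, acDensity σ Λ, h, h.integrable_acDensity.integrableOn,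
    h.ae_hasApproxHorizGradAt d hΩ hg, Eventually.of_forall fun _ => rfl,
    fun divF hdiv ρ hρ => ⟨fun ε hε => ?_, fun ε hε0 hε =>
      h.exists_subseq_limits hΩ hg hFm hdiv hρ hε0 hε⟩⟩
  · exact hFm.smul hg
  -- Any mollifier and any sequence of scales exhibit a divergence of `gF`.
  · obtain ⟨ρ, hρ⟩ := exists_isMollifier d
    obtain ⟨s, -, gt, P, Ps, -, -, -, -, hd, -⟩ := h.exists_subseq_limits hΩ hg hFm hdivF₀ hρ
      (ε := fun n : ℕ => 1 / ((n : ℝ) + 1)) (fun k => by positivity)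
      tendsto_one_div_add_atTop_nhds_zero_nat
    exact ⟨_, hd⟩
  · have hsub : rightInner d Ω (2 * ε) ⊆ rightInner d Ω ε :=
      rightInner_anti d Ω (by linarith)
    obtain ⟨h1, h2⟩ := h.isC1H_mollify hΩ hg hρ hε
    exact ⟨⟨fun x hx => h1 x (hsub hx), h2.mono hsub⟩,
      (h.integrableOn_horizGrad_mollify hΩ hg hρ hε).mono_set hsub⟩
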